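/- Fix $m\ge 1$ colors. Let $L_i(n)\ge 0$ be the quantity of color $i$ ($1\le i\le m$) in an urn after $n\ge 0$ steps, and put $C(n)=\sum_{i=1}^m L_i(n)$ and $P_i(n)=L_i(n)/C(n)$. Initially, $C(0)^2\sim\mathrm{Gamma}(\frac{m+1}{2},\frac12)$ (shape, rate) and $(P_1(0),\dots,P_m(0))\sim\mathrm{Dirichlet}(1,\dots,1)$, independently of each other. At step $n+1$, given everything so far, a color $I(n+1)$ is chosen so that $I(n+1)=i$ with conditional probability $P_i(n)$; then, given in addition $I(n+1)$, a positive random quantity $A(n+1)$ is sampled whose conditional density, on the event $C(n)=c$, is $(a+c)\exp\big(-\frac12(a+c)^2+\frac12c^2\big)$, $a>0$ (the time until the next point of an inhomogeneous Poisson process of rate $t$ at time $t$, given a point at $c$). Finally $L_{I(n+1)}(n+1)=L_{I(n+1)}(n)+A(n+1)$ and $L_j(n+1)=L_j(n)$ for $j\ne I(n+1)$. Then there is a random vector $P=(P_1,\dots,P_m)\sim\mathrm{Dirichlet}(\frac12,\dots,\frac12)$ such that $(P_1(n),\dots,P_m(n))\to(P_1,\dots,P_m)$ almost surely as $n\to\infty$.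 Conditional on $P$, the indices $I(1),I(2),\dots$ are independent and identically distributed with $\mathbb P(I(1)=i\mid P)=P_i$ for $1\le i\le m$. Almost surely every color is chosen infinitely often. Finally, conditional on $P$, for each $1\le i\le m$ the sequence of additions to color $i$ (the initial quantity $L_i(0)$, followed by the quantities $A(n)$ at the successive steps $n$ with $I(n)=i$) is distributed as the sequence of inter-jump times (the first one measured from time $0$) of an inhomogeneous Poisson process on $[0,\infty)$ with rate $t$ at time $t$, multiplied by $\sqrt{P_i}$, and these sequences are conditionally independent for distinct $i$. -/

import Mathlib

open MeasureTheory ProbabilityTheory Filter Topology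

noncomputable section

namespace ContinuousUrn

/-- The point `(x_0, …, x_{d-1}, 1 - x_0 - ⋯ - x_{d-1})` of the hyperplane `∑ y_j = 1`. -/
def simplexPoint {d : ℕ} (x : Fin d → ℝ) : Fin (d + 1) → ℝ :=
  Fin.snoc (α := fun _ => ℝ) x (1 - ∑ j, x j)

/-- The Dirichlet distribution with parameters `α` on the open simplex in `ℝ^(d+1)`, given by its
density in the first `d` coordinates with respect to `d`-dimensional Lebesgue measure. -/
def dirichletMeasure {d : ℕ} (α : Fin (d + 1) → ℝ) : Measure (Fin (d + 1) → ℝ) :=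
  ((volume : Measure (Fin d → ℝ)).withDensity
    ({x : Fin d → ℝ | ∀ j, 0 < simplexPoint x j}.indicator fun x =>
      ENNReal.ofReal (Real.Gamma (∑ j, α j) / (∏ j, Real.Gamma (α j)) *
        ∏ j, simplexPoint x j ^ (α j - 1)))).map simplexPoint

/-- The law on `(0, ∞)` with density `(a + c) exp (-(a + c)² / 2 + c² / 2)`, for `c ≥ 0`. -/
def gapMeasure (c : ℝ) : Measure ℝ :=
  (volume.restrict (Set.Ioi 0)).withDensity fun a =>
    ENNReal.ofReal ((a + c) * Real.exp (-(1 / 2) * (a + c) ^ 2 + (1 / 2) * c ^ 2))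

section Conditioning

variable {Ω 𝓧 𝓨 ι : Type*} [MeasurableSpace Ω] [MeasurableSpace 𝓧] [MeasurableSpace 𝓨]

/-- Conditionally on `X`, the random variable `Y` has the (random) law `ν`. -/
def HasCondLaw (Y : Ω → 𝓨) (X : Ω → 𝓧) (ν : Ω → Measure 𝓨) (μ : Measure Ω) : Prop :=
  ∀ B : Set 𝓨, MeasurableSet B →
    μ⟦Y ⁻¹' B | MeasurableSpace.comap X inferInstance⟧ =ᵐ[μ] fun ω => (ν ω).real B

/-- The family `Y` is conditionally independent given `X`. -/
def CondIndepFamily (Y : ι → Ω → 𝓨) (X : Ω → 𝓧) (μ : Measure Ω) : Prop :=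
  ∀ (S : Finset ι) (B : ι → Set 𝓨), (∀ i, MeasurableSet (B i)) →
    μ⟦⋂ i ∈ S, Y i ⁻¹' B i | MeasurableSpace.comap X inferInstance⟧ =ᵐ[μ]
      fun ω => ∏ i ∈ S, (μ⟦Y i ⁻¹' B i | MeasurableSpace.comap X inferInstance⟧) ω

end Conditioning

/-- The `k`-th jump time (`k ≥ 0`) of the point process with successive inter-jump times `x`;
the first one, `x 0`, is measured from time `0`. -/
def jumpTime (x : ℕ → ℝ) (k : ℕ) : ℝ := ∑ j ∈ Finset.range (k + 1), x j

/-- The number of jumps in `(s, t]` of the point process with inter-jump times `x`. -/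
def jumpCount (s t : ℝ) (x : ℕ → ℝ) : ℕ :=
  {k : ℕ | jumpTime x k ∈ Set.Ioc s t}.ncard

/-- `ν` is the law of the sequence of inter-jump times of an inhomogeneous Poisson process on
`[0, ∞)` of instantaneous rate `rate t` at time `t`: the jump times are positive, strictly
increasing and locally finite, the number of jumps in `(s, t]` is Poisson with mean
`∫ u in s..t, rate u`, and the numbers of jumps in successive intervals are independent. -/
structure IsPoissonInterJumpLaw (rate : ℝ → ℝ) (ν : Measure (ℕ → ℝ)) : Prop where
  isProbabilityMeasure : IsProbabilityMeasure ν
  pos : ∀ᵐ x ∂ν, ∀ k, 0 < x k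
  tendsto_jumpTime : ∀ᵐ x ∂ν, Tendsto (jumpTime x) atTop atTop
  hasLaw_jumpCount : ∀ s t : ℝ, 0 ≤ s → s ≤ t →
    HasLaw (jumpCount s t) (poissonMeasure (∫ u in s..t, rate u).toNNReal) ν
  indep_jumpCount : ∀ t : ℕ → ℝ, 0 ≤ t 0 → Monotone t →
    iIndepFun (fun k => jumpCount (t k) (t (k + 1))) ν

section Urn

variable {Ω : Type*} {d : ℕ}

/-- The total quantity `C(n)` in the urn. -/
def total (L : ℕ → Ω → Fin (d + 1) → ℝ) (n : ℕ) (ω : Ω) : ℝ := ∑ i, L n ω i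

/-- The vector of proportions of the colors at step `n`. -/
def proportion (L : ℕ → Ω → Fin (d + 1) → ℝ) (n : ℕ) (ω : Ω) : Fin (d + 1) → ℝ :=
  fun i => L n ω i / total L n ω

/-- The history up to step `n`: the initial quantities, and the first `n` choices and additions. -/
def past (L : ℕ → Ω → Fin (d + 1) → ℝ) (I : ℕ → Ω → Fin (d + 1)) (A : ℕ → Ω → ℝ) (n : ℕ)
    (ω : Ω) : (Fin (d + 1) → ℝ) × (Fin n → Fin (d + 1) × ℝ) :=
  (L 0 ω, fun k => (I k ω, A k ω))

/-- The continuous urn with `d + 1` colors. `L n ω i` is the quantity of color `i` after `n` steps;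
`I n` is the color chosen and `A n` the quantity added at step `n + 1`. -/
structure IsContinuousUrn [MeasurableSpace Ω] (L : ℕ → Ω → Fin (d + 1) → ℝ)
    (I : ℕ → Ω → Fin (d + 1)) (A : ℕ → Ω → ℝ) (μ : Measure Ω) : Prop where
  measurable_initial : Measurable (L 0)
  measurable_index : ∀ n, Measurable (I n)
  measurable_addition : ∀ n, Measurable (A n)
  initial_nonneg : ∀ᵐ ω ∂μ, ∀ i, 0 ≤ L 0 ω i
  /-- With `m = d + 1` colors, `C(0)² ∼ Gamma((m + 1) / 2, 1 / 2)`. -/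
  hasLaw_total_sq : HasLaw (fun ω => total L 0 ω ^ 2)
    (gammaMeasure ((((d + 1 : ℕ) : ℝ) + 1) / 2) (1 / 2)) μ
  hasLaw_proportion : HasLaw (proportion L 0) (dirichletMeasure fun _ => 1) μ
  indep_initial : IndepFun (total L 0) (proportion L 0) μ
  /-- Given the past, color `i` is chosen with probability equal to its current proportion. -/
  index_cond : ∀ n i, μ⟦I n ⁻¹' {i} | MeasurableSpace.comap (past L I A n) inferInstance⟧ =ᵐ[μ]
    fun ω => proportion L n ω i
  /-- Given the past and the chosen color, the law of the addition depends on `C(n)` only. -/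
  addition_cond : ∀ n, HasCondLaw (A n) (fun ω => (past L I A n ω, I n ω))
    (fun ω => gapMeasure (total L n ω)) μ
  succ_eq : ∀ n ω, L (n + 1) ω =
    Function.update (L n ω) (I n ω) (L n ω (I n ω) + A n ω)

/-- The sequence of additions to color `i`: first its initial quantity, then the quantities added
at the successive steps at which color `i` is chosen. -/
def colorAdditions (L : ℕ → Ω → Fin (d + 1) → ℝ) (I : ℕ → Ω → Fin (d + 1)) (A : ℕ → Ω → ℝ)
    (i : Fin (d + 1)) (ω : Ω) : ℕ → ℝ
  | 0 => L 0 ω i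
  | k + 1 => A (Nat.nth (fun n => I n ω = i) k) ω

end Urn

end ContinuousUrn

end

open MeasureTheory ProbabilityTheory Filter Topology

noncomputable section

namespace ContinuousUrn

open scoped ENNReal

section

/-! ### Hitting-time densities -/

/-! The urn has the same law as an explicit mixture, in which the limit is present from the start.
Draw p from Dirichlet(1/2, …, 1/2). Give each color a clock started at a unit exponential time; at
each step choose a color with law p, independently of everything else, and advance its clock by a
fresh unit exponential. The quantity of color i is √(2 p_i × clock_i), that is, √p_i times a jump
time of the Poisson process of rate t. For this model every assertion is either built in or a
consequence of the strong law of large numbers: clock_i is asymptotic to p_i n, so the quantity of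
color i is asymptotic to √2 p_i √n and the proportions tend to p.

The two laws are matched by a Bayesian computation. Let h(a, t) be the density of the hitting time
of level a by Brownian motion. After n steps with quantities l and total C, the posterior density of
p is ∏ h(l_i, p_i) / h(C, 1): the law of independent hitting times of the levels l_i, conditioned to
have sum 1. It has total mass 1 because hitting-time densities convolve
(`lintegral_hittingDensity_mul`). At time 0, the Dirichlet(1/2) density times Rayleigh densities
equals the initial density of the urn times this posterior (`dirichlet_mul_rayleigh`). At each step,
posterior times mixture transition equals urn transition times updated posterior
(`posteriorDensity_update`); this rests on the explicit ratio of h(l + a, p) to h(l, p). Induction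
(`IsContinuousUrn.lintegral_mixture`) and a passage to infinite paths give
`IsContinuousUrn.map_pathOf`.

The limit P is then taken to be a measurable function of the path, the limsup of the proportions.
Along mixture paths it is almost surely p, so (path, P) for the urn has the law of (path, p) for the
mixture (`IsContinuousUrn.measure_inter_limitShare`), and conditioning on P amounts to fixing p.
With p and the choices fixed, the exponential variables received by distinct colors are disjoint
subfamilies of an i.i.d. family, which yields the independent rescaled Poisson sequences. That the
time change s ↦ √(2s) of a unit-rate renewal process with exponential gaps satisfies the defining
properties of the Poisson process of rate t is proved from scratch, by conditioning on the first gap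
(`expSeq_jumpCount_eq`). -/

/-- The density at time `t` of the first hitting time of level `a` by a Brownian motion. -/
def hittingDensity (a t : ℝ) : ℝ :=
  if 0 < t then a / √(2 * Real.pi) / (t * √t) * Real.exp (-(a ^ 2 / (2 * t))) else 0

lemma hittingDensity_of_pos {t : ℝ} (ht : 0 < t) (a : ℝ) :
    hittingDensity a t = a / √(2 * Real.pi) / (t * √t) * Real.exp (-(a ^ 2 / (2 * t))) :=
  if_pos ht

lemma hittingDensity_of_nonpos {t : ℝ} (ht : t ≤ 0) (a : ℝ) : hittingDensity a t = 0 :=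
  if_neg ht.not_gt

lemma hittingDensity_nonneg {a : ℝ} (ha : 0 ≤ a) (t : ℝ) : 0 ≤ hittingDensity a t := by
  unfold hittingDensity
  split_ifs with h <;> positivity

lemma hittingDensity_pos {a t : ℝ} (ha : 0 < a) (ht : 0 < t) : 0 < hittingDensity a t := by
  rw [hittingDensity_of_pos ht]
  positivity

@[fun_prop]
lemma measurable_hittingDensity_uncurry : Measurable fun x : ℝ × ℝ => hittingDensity x.1 x.2 := by
  unfold hittingDensity
  exact Measurable.ite (measurableSet_lt measurable_const measurable_snd) (by fun_prop)
    measurable_const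

lemma measurable_hittingDensity {α : Type*} [MeasurableSpace α] {f g : α → ℝ} (hf : Measurable f)
    (hg : Measurable g) : Measurable fun x => hittingDensity (f x) (g x) :=
  measurable_hittingDensity_uncurry.comp (hf.prodMk hg)

lemma lintegral_gaussian :
    ∫⁻ x : ℝ, ENNReal.ofReal (Real.exp (-(x ^ 2 / 2))) = ENNReal.ofReal √(2 * Real.pi) := by
  have h := integral_gaussian (1 / 2)
  rw [show Real.pi / (1 / 2) = 2 * Real.pi by ring] at h
  have hi := integrable_exp_neg_mul_sq (b := 1 / 2) (by norm_num)
  rw [← ofReal_integral_eq_lintegral_ofReal]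
  · congr 1
    convert! h using 2
    ext x; congr 1; ring
  · convert! hi using 2
    congr 1; ring
  · exact ae_of_all _ fun x => (Real.exp_pos _).le

/-! ### The Cauchy–Schlömilch substitution -/

section CauchySchloemilch

variable {α β : ℝ}

lemma image_sub_div_Ioi (hα : 0 < α) (hβ : 0 < β) :
    (fun v : ℝ => β * v - α / v) '' Set.Ioi 0 = Set.univ := by
  refine Set.eq_univ_of_forall fun y => ?_
  have hs : |y| < √(y ^ 2 + 4 * α * β) := by
    rw [← Real.sqrt_sq_eq_abs]
    exact Real.sqrt_lt_sqrt (sq_nonneg y) (by nlinarith [mul_pos hα hβ])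
  have hsq : √(y ^ 2 + 4 * α * β) ^ 2 = y ^ 2 + 4 * α * β := Real.sq_sqrt (by positivity)
  set r := √(y ^ 2 + 4 * α * β)
  have hpos : 0 < y + r := by linarith [neg_abs_le y]
  -- The positive root of β v² − y v − α = 0.
  refine ⟨(y + r) / (2 * β), div_pos hpos (by positivity), ?_⟩
  simp only
  have : y + r ≠ 0 := hpos.ne'
  field_simp
  nlinarith

/-- The substitution x = β v − α / v is increasing from (0, ∞) onto ℝ with derivative β + α / v², so
this is the Gaussian integral. -/
lemma lintegral_add_mul_exp_sub_div (hα : 0 < α) (hβ : 0 < β) :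
    ∫⁻ v in Set.Ioi (0 : ℝ), ENNReal.ofReal (β + α / v ^ 2) *
      ENNReal.ofReal (Real.exp (-((β * v - α / v) ^ 2 / 2))) = ENNReal.ofReal √(2 * Real.pi) := by
  rw [← lintegral_gaussian, ← setLIntegral_univ (μ := volume)
    (fun x : ℝ => ENNReal.ofReal (Real.exp (-(x ^ 2 / 2)))), ← image_sub_div_Ioi hα hβ,
    lintegral_image_eq_lintegral_deriv_mul_of_monotoneOn (f' := fun v => β + α / v ^ 2)
      measurableSet_Ioi]
  · intro v hv
    have hv' : v ≠ 0 := (Set.mem_Ioi.1 hv).ne'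
    have h := ((hasDerivAt_id v).const_mul β).sub ((hasDerivAt_inv hv').const_mul α)
    refine (h.congr_deriv ?_).hasDerivWithinAt
    simp [div_eq_mul_inv]
  · intro v hv w hw hvw
    have : α / w ≤ α / v := div_le_div_of_nonneg_left hα.le hv hvw
    have : β * v ≤ β * w := by gcongr
    simp only
    linarith

/-- The inversion v ↦ α / (β v) exchanges β v and α / v, so it preserves the exponent; only the
Jacobian appears. -/
lemma lintegral_exp_sub_div_inversion (hα : 0 < α) (hβ : 0 < β) :
    ∫⁻ v in Set.Ioi (0 : ℝ), ENNReal.ofReal (Real.exp (-((β * v - α / v) ^ 2 / 2))) =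
      ∫⁻ v in Set.Ioi (0 : ℝ), ENNReal.ofReal (α / β / v ^ 2) *
        ENNReal.ofReal (Real.exp (-((β * v - α / v) ^ 2 / 2))) := by
  have him : (fun v : ℝ => α / β / v) '' Set.Ioi 0 = Set.Ioi 0 := by
    ext y
    constructor
    · rintro ⟨v, hv, rfl⟩
      have := Set.mem_Ioi.1 hv
      exact Set.mem_Ioi.2 (by positivity)
    · intro hy
      have := Set.mem_Ioi.1 hy
      refine ⟨α / β / y, Set.mem_Ioi.2 (by positivity), ?_⟩
      simp only
      field_simp
  conv_lhs => rw [← him]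
  rw [lintegral_image_eq_lintegral_deriv_mul_of_antitoneOn (f' := fun v => -(α / β / v ^ 2))
      measurableSet_Ioi]
  · refine setLIntegral_congr_fun measurableSet_Ioi fun v hv => ?_
    have hv' : 0 < v := hv
    simp only [neg_neg]
    congr 4
    field_simp
    ring
  · intro v hv
    have hv' : v ≠ 0 := (Set.mem_Ioi.1 hv).ne'
    have h := (hasDerivAt_inv hv').const_mul (α / β)
    refine (h.congr_deriv ?_).hasDerivWithinAt
    simp [div_eq_mul_inv]
  · intro v hv w hw hvw
    exact div_le_div_of_nonneg_left (by positivity) hv hvw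

/-- Let J₀ and J₂ be the integrals with weights 1 and 1 / v². Inversion gives β J₀ = α J₂, the
Gaussian substitution gives β J₀ + α J₂ = √(2π), and these two relations determine J₀ + J₂. -/
lemma lintegral_one_add_mul_exp_sub_div (hα : 0 < α) (hβ : 0 < β) :
    ∫⁻ v in Set.Ioi (0 : ℝ), ENNReal.ofReal (1 + 1 / v ^ 2) *
      ENNReal.ofReal (Real.exp (-((β * v - α / v) ^ 2 / 2))) =
      ENNReal.ofReal ((α + β) / (2 * α * β) * √(2 * Real.pi)) := by
  set e : ℝ → ℝ≥0∞ := fun v => ENNReal.ofReal (Real.exp (-((β * v - α / v) ^ 2 / 2)))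
  have he : Measurable e := by fun_prop
  set J₀ := ∫⁻ v in Set.Ioi (0 : ℝ), e v
  set J₂ := ∫⁻ v in Set.Ioi (0 : ℝ), ENNReal.ofReal (1 / v ^ 2) * e v
  have key : ∀ x y : ℝ, 0 ≤ x → 0 ≤ y →
      ∫⁻ v in Set.Ioi (0 : ℝ), ENNReal.ofReal (x + y / v ^ 2) * e v =
        ENNReal.ofReal x * J₀ + ENNReal.ofReal y * J₂ := by
    intro x y hx hy
    rw [← lintegral_const_mul _ he, ← lintegral_const_mul _ (by fun_prop),
      ← lintegral_add_left (by fun_prop)]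
    refine lintegral_congr fun v => ?_
    rw [ENNReal.ofReal_add hx (by positivity), add_mul, ← mul_assoc, ← ENNReal.ofReal_mul hy,
      mul_one_div]
  have h1 : ENNReal.ofReal β * J₀ + ENNReal.ofReal α * J₂ = ENNReal.ofReal √(2 * Real.pi) := by
    rw [← key β α hβ.le hα.le, lintegral_add_mul_exp_sub_div hα hβ]
  have h2 : J₀ = ENNReal.ofReal (α / β) * J₂ := by
    have := lintegral_exp_sub_div_inversion hα hβ
    have h3 := key 0 (α / β) le_rfl (by positivity)
    simp only [zero_add, ENNReal.ofReal_zero, zero_mul] at h3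
    rw [← h3]
    exact this
  have h3 : ENNReal.ofReal β * J₀ = ENNReal.ofReal α * J₂ := by
    rw [h2, ← mul_assoc, ← ENNReal.ofReal_mul hβ.le, mul_div_cancel₀ _ hβ.ne']
  have hJ2 : J₂ = ENNReal.ofReal (√(2 * Real.pi) / (2 * α)) := by
    rw [h3, ← two_mul, ← mul_assoc, ← ENNReal.ofReal_ofNat,
        ← ENNReal.ofReal_mul (by norm_num)] at h1
    rw [ENNReal.ofReal_div_of_pos (by positivity), ← h1, mul_comm,
      ENNReal.mul_div_cancel_right (by simpa using hα) ENNReal.ofReal_ne_top]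
  have hJ0 : J₀ = ENNReal.ofReal (√(2 * Real.pi) / (2 * β)) := by
    rw [h2, hJ2, ← ENNReal.ofReal_mul (by positivity)]
    congr 1
    field_simp
  rw [key 1 1 zero_le_one zero_le_one, hJ0, hJ2, ENNReal.ofReal_one, one_mul, one_mul,
    ← ENNReal.ofReal_add (by positivity) (by positivity)]
  congr 1
  field_simp

end CauchySchloemilch

lemma image_mul_sq_div_Ioi {t : ℝ} (ht : 0 < t) :
    (fun v : ℝ => t * v ^ 2 / (1 + v ^ 2)) '' Set.Ioi 0 = Set.Ioo 0 t := by
  ext s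
  constructor
  · rintro ⟨v, hv, rfl⟩
    have := Set.mem_Ioi.1 hv
    refine ⟨by positivity, ?_⟩
    rw [div_lt_iff₀ (by positivity)]
    nlinarith
  · rintro ⟨h0, h1⟩
    have h2 : 0 < t - s := by linarith
    refine ⟨√(s / (t - s)), Set.mem_Ioi.2 (by positivity), ?_⟩
    simp only
    rw [Real.sq_sqrt (by positivity)]
    field_simp
    ring

/-- Hitting times of successive levels are independent, so their densities convolve. -/
lemma lintegral_hittingDensity_mul {a b : ℝ} (ha : 0 < a) (hb : 0 < b) (t : ℝ) :
    ∫⁻ s, ENNReal.ofReal (hittingDensity a s) * ENNReal.ofReal (hittingDensity b (t - s)) =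
      ENNReal.ofReal (hittingDensity (a + b) t) := by
  have hsupp : ∫⁻ s, ENNReal.ofReal (hittingDensity a s) *
      ENNReal.ofReal (hittingDensity b (t - s)) =
      ∫⁻ s in Set.Ioo 0 t, ENNReal.ofReal (hittingDensity a s) *
      ENNReal.ofReal (hittingDensity b (t - s)) := by
    rw [← lintegral_indicator measurableSet_Ioo]
    refine lintegral_congr fun s => ?_
    by_cases hs : s ∈ Set.Ioo 0 t
    · rw [Set.indicator_of_mem hs]
    · rw [Set.indicator_of_notMem hs]
      rcases le_or_gt s 0 with h | h
      · simp [hittingDensity_of_nonpos h]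
      · have : t - s ≤ 0 := by
          by_contra hc
          exact hs ⟨h, by linarith⟩
        simp [hittingDensity_of_nonpos this]
  rw [hsupp]
  rcases le_or_gt t 0 with ht | ht
  · simp [Set.Ioo_eq_empty_of_le ht, hittingDensity_of_nonpos ht]
  have hst : 0 < √t := Real.sqrt_pos.2 ht
  have htt : √t ^ 2 = t := Real.sq_sqrt ht.le
  -- With s = t v² / (1 + v²) one has t − s = t / (1 + v²), and a² / s + b² / (t − s) = ((a + b)² +
  -- (b v − a / v)²) / t. The first term is the exponent of the answer; the second is of
  -- Cauchy–Schlömilch form with α = a / √t and β = b / √t.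
  rw [← image_mul_sq_div_Ioi ht, lintegral_image_eq_lintegral_deriv_mul_of_monotoneOn
    (f' := fun v => t * (2 * v) / (1 + v ^ 2) ^ 2) measurableSet_Ioi]
  rotate_left
  · intro v hv
    have h0 : (1 : ℝ) + v ^ 2 ≠ 0 := by positivity
    have h := ((hasDerivAt_pow 2 v).const_mul t).div ((hasDerivAt_pow 2 v).const_add 1) h0
    refine (h.congr_deriv ?_).hasDerivWithinAt
    field_simp
    push_cast
    ring
  · intro v hv w hw hvw
    have hv' : 0 < v := hv
    simp only
    rw [div_le_div_iff₀ (by positivity) (by positivity)]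
    have : v ^ 2 ≤ w ^ 2 := by gcongr
    nlinarith
  have hpt : ∀ v ∈ Set.Ioi (0 : ℝ), ENNReal.ofReal (t * (2 * v) / (1 + v ^ 2) ^ 2) *
      (ENNReal.ofReal (hittingDensity a (t * v ^ 2 / (1 + v ^ 2))) *
        ENNReal.ofReal (hittingDensity b (t - t * v ^ 2 / (1 + v ^ 2)))) =
      ENNReal.ofReal (a * b / Real.pi / t ^ 2 * Real.exp (-((a + b) ^ 2 / (2 * t)))) *
        (ENNReal.ofReal (1 + 1 / v ^ 2) *
          ENNReal.ofReal (Real.exp (-((b / √t * v - a / √t / v) ^ 2 / 2)))) := by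
    intro v hv
    have hv' : 0 < v := hv
    have hs : 0 < t * v ^ 2 / (1 + v ^ 2) := by positivity
    have hts : t - t * v ^ 2 / (1 + v ^ 2) = t / (1 + v ^ 2) := by field_simp; ring
    rw [hts, hittingDensity_of_pos hs, hittingDensity_of_pos (by positivity : 0 < t / (1 + v ^ 2))]
    rw [← ENNReal.ofReal_mul (by positivity), ← ENNReal.ofReal_mul (by positivity),
      ← ENNReal.ofReal_mul (by positivity), ← ENNReal.ofReal_mul (by positivity)]
    congr 1
    have hexp : Real.exp (-((a + b) ^ 2 / (2 * t))) *
        Real.exp (-((b / √t * v - a / √t / v) ^ 2 / 2)) =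
        Real.exp (-(a ^ 2 / (2 * (t * v ^ 2 / (1 + v ^ 2))))) *
          Real.exp (-(b ^ 2 / (2 * (t / (1 + v ^ 2))))) := by
      rw [← Real.exp_add, ← Real.exp_add]
      congr 1
      have : (b / √t * v - a / √t / v) ^ 2 = (b * v - a / v) ^ 2 / t := by
        field_simp
        rw [htt]
        ring
      rw [this]
      field_simp
      ring
    have e1 : √(t * v ^ 2 / (1 + v ^ 2)) = √t * v / √(1 + v ^ 2) := by
      rw [Real.sqrt_div (by positivity), Real.sqrt_mul ht.le, Real.sqrt_sq hv'.le]
    have e2 : √(t / (1 + v ^ 2)) = √t / √(1 + v ^ 2) := Real.sqrt_div ht.le _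
    have e3 : √(1 + v ^ 2) ^ 2 = 1 + v ^ 2 := Real.sq_sqrt (by positivity)
    have e4 : √(2 * Real.pi) ^ 2 = 2 * Real.pi := Real.sq_sqrt (by positivity)
    have hw : 0 < √(1 + v ^ 2) := Real.sqrt_pos.2 (by positivity)
    have hp : 0 < √(2 * Real.pi) := by positivity
    have hpi := Real.pi_pos
    rw [e1, e2]
    calc _ = (t * (2 * v) / (1 + v ^ 2) ^ 2) * (a / √(2 * Real.pi) /
          (t * v ^ 2 / (1 + v ^ 2) * (√t * v / √(1 + v ^ 2)))) *
          (b / √(2 * Real.pi) / (t / (1 + v ^ 2) * (√t / √(1 + v ^ 2)))) *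
          (Real.exp (-(a ^ 2 / (2 * (t * v ^ 2 / (1 + v ^ 2))))) *
          Real.exp (-(b ^ 2 / (2 * (t / (1 + v ^ 2)))))) := by ring
      _ = (a * b / Real.pi / t ^ 2 * (1 + 1 / v ^ 2)) * (Real.exp (-((a + b) ^ 2 / (2 * t))) *
        Real.exp (-((b / √t * v - a / √t / v) ^ 2 / 2))) := by
          rw [hexp]
          congr 1
          generalize √(1 + v ^ 2) = w at *
          generalize √(2 * Real.pi) = q at *
          generalize √t = r at *
          have : Real.pi = q ^ 2 / 2 := by linarith
          rw [this]
          field_simp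
          rw [e3, htt]
          ring
      _ = _ := by ring
  rw [setLIntegral_congr_fun measurableSet_Ioi hpt, lintegral_const_mul _ (by fun_prop),
    lintegral_one_add_mul_exp_sub_div (by positivity) (by positivity),
    ← ENNReal.ofReal_mul (by positivity), hittingDensity_of_pos ht]
  congr 1
  have e4 : √(2 * Real.pi) ^ 2 = 2 * Real.pi := Real.sq_sqrt (by positivity)
  have hp : 0 < √(2 * Real.pi) := by positivity
  generalize √(2 * Real.pi) = q at *
  have : Real.pi = q ^ 2 / 2 := by linarith
  rw [this]
  generalize √t = r at *
  subst htt
  field_simp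

end

section

/-! ### Lebesgue integrals on `Fin n → ℝ` -/

lemma lintegral_fin_cons {n : ℕ} {F : (Fin (n + 1) → ℝ) → ℝ≥0∞} (hF : Measurable F) :
    ∫⁻ x, F x = ∫⁻ a : ℝ, ∫⁻ y : Fin n → ℝ, F (Fin.cons a y) := by
  have h := (volume_preserving_piFinSuccAbove (fun _ : Fin (n + 1) => ℝ) 0).symm
  rw [← h.lintegral_comp hF, Measure.volume_eq_prod, lintegral_prod]
  · simp [MeasurableEquiv.piFinSuccAbove, Fin.insertNthEquiv]
  · exact (hF.comp h.measurable).aemeasurable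

lemma measurable_snoc {n : ℕ} :
    Measurable fun z : ℝ × (Fin n → ℝ) =>
        (Fin.snoc (α := fun _ => ℝ) z.2 z.1 : Fin (n + 1) → ℝ) := by
  refine measurable_pi_lambda _ fun i => ?_
  refine Fin.lastCases ?_ (fun j => ?_) i
  · simp only [Fin.snoc_last]; fun_prop
  · simp only [Fin.snoc_castSucc]; fun_prop

lemma lintegral_fin_snoc {n : ℕ} {F : (Fin (n + 1) → ℝ) → ℝ≥0∞} (hF : Measurable F) :
    ∫⁻ x, F x = ∫⁻ y : Fin n → ℝ, ∫⁻ a : ℝ, F (Fin.snoc (α := fun _ => ℝ) y a) := by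
  have h := (volume_preserving_piFinSuccAbove (fun _ : Fin (n + 1) => ℝ) (Fin.last n)).symm
  rw [← h.lintegral_comp hF, Measure.volume_eq_prod, lintegral_prod_symm]
  · simp [MeasurableEquiv.piFinSuccAbove, Fin.insertNthEquiv, Fin.insertNth_last']
  · exact (hF.comp h.measurable).aemeasurable

lemma lintegral_fin_prod {n : ℕ} {f : Fin n → ℝ → ℝ≥0∞} (hf : ∀ i, Measurable (f i)) :
    ∫⁻ x : Fin n → ℝ, ∏ i, f i (x i) = ∏ i, ∫⁻ a, f i a := by
  induction n with
  | zero => simp [volume_pi]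
  | succ n ih =>
    rw [lintegral_fin_cons (by fun_prop)]
    simp only [Fin.prod_univ_succ, Fin.cons_zero, Fin.cons_succ]
    rw [← ih (fun i => hf i.succ), ← lintegral_mul_const _ (hf 0)]
    refine lintegral_congr fun a => ?_
    rw [lintegral_const_mul _ (Finset.measurable_prod _ fun i _ => by
      have := hf i.succ; fun_prop)]

lemma pi_withDensity {n : ℕ} {f : Fin n → ℝ → ℝ≥0∞} (hf : ∀ i, Measurable (f i))
    [∀ i, SigmaFinite ((volume : Measure ℝ).withDensity (f i))] :
    Measure.pi (fun i => (volume : Measure ℝ).withDensity (f i)) =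
      (volume : Measure (Fin n → ℝ)).withDensity fun x => ∏ i, f i (x i) := by
  refine Measure.pi_eq fun s hs => ?_
  rw [withDensity_apply _ (.univ_pi hs), ← lintegral_indicator (.univ_pi hs)]
  have : ∀ x : Fin n → ℝ, (Set.univ.pi s).indicator (fun x => ∏ i, f i (x i)) x =
      ∏ i, (s i).indicator (f i) (x i) := by
    intro x
    by_cases hx : x ∈ Set.univ.pi s
    · rw [Set.indicator_of_mem hx]
      exact Finset.prod_congr rfl fun i _ => (Set.indicator_of_mem (hx i trivial) _).symm
    · rw [Set.indicator_of_notMem hx]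
      simp only [Set.mem_univ_pi, not_forall] at hx
      obtain ⟨i, hi⟩ := hx
      exact (Finset.prod_eq_zero (Finset.mem_univ i) (Set.indicator_of_notMem hi _)).symm
  simp_rw [this]
  rw [lintegral_fin_prod fun i => (hf i).indicator (hs i)]
  refine Finset.prod_congr rfl fun i _ => ?_
  rw [lintegral_indicator (hs i), withDensity_apply _ (hs i)]

/-! ### Exponential clocks -/

lemma lintegral_expMeasure_one {F : ℝ → ℝ≥0∞} (hF : Measurable F) :
    ∫⁻ y, F y ∂(expMeasure 1) = ∫⁻ y in Set.Ioi 0, ENNReal.ofReal (Real.exp (-y)) * F y := by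
  have h : expMeasure 1 = volume.withDensity (exponentialPDF 1) := rfl
  rw [h, lintegral_withDensity_eq_lintegral_mul _ (by unfold exponentialPDF; fun_prop) hF,
    setLIntegral_congr Ioi_ae_eq_Ici, ← lintegral_indicator measurableSet_Ici]
  refine lintegral_congr fun y => ?_
  by_cases hy : y ∈ Set.Ici (0 : ℝ)
  · rw [Set.indicator_of_mem hy, Pi.mul_apply, exponentialPDF_of_nonneg hy]
    simp
  · rw [Set.indicator_of_notMem hy, Pi.mul_apply, exponentialPDF_of_neg (by simpa using hy),
      zero_mul]

instance : IsProbabilityMeasure (expMeasure 1) := isProbabilityMeasure_expMeasure one_pos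

lemma ae_expMeasure_pos : ∀ᵐ y ∂(expMeasure 1), 0 < y := by
  rw [ae_iff, ← lintegral_indicator_one (by measurability), lintegral_expMeasure_one
    (measurable_one.indicator (by measurability))]
  rw [setLIntegral_congr_fun (g := fun _ => 0) measurableSet_Ioi, lintegral_zero]
  intro y hy
  have : y ∉ {a : ℝ | ¬ 0 < a} := by simpa using hy
  simp only [Set.indicator_of_notMem this, mul_zero]

/-- The density of the increment of `y ↦ √(l² + 2 p y)` run for a unit exponential time. -/
lemma lintegral_expMeasure_sqrt_sub {p l : ℝ} (hp : 0 < p) (hl : 0 ≤ l) {F : ℝ → ℝ≥0∞}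
    (hF : Measurable F) :
    ∫⁻ y, F (√(l ^ 2 + 2 * p * y) - l) ∂(expMeasure 1) =
      ∫⁻ a in Set.Ioi 0, ENNReal.ofReal
        ((a + l) / p * Real.exp (-(((a + l) ^ 2 - l ^ 2) / (2 * p)))) * F a := by
  have him : (fun a : ℝ => ((a + l) ^ 2 - l ^ 2) / (2 * p)) '' Set.Ioi 0 = Set.Ioi 0 := by
    ext y
    constructor
    · rintro ⟨a, ha, rfl⟩
      have : 0 < a := ha
      have : 0 < (a + l) ^ 2 - l ^ 2 := by nlinarith
      exact Set.mem_Ioi.2 (by positivity)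
    · intro hy
      have hy' : 0 < y := hy
      refine ⟨√(l ^ 2 + 2 * p * y) - l, ?_, ?_⟩
      · have : l < √(l ^ 2 + 2 * p * y) := by
          refine Real.lt_sqrt_of_sq_lt ?_
          have : 0 < 2 * p * y := by positivity
          linarith
        exact Set.mem_Ioi.2 (by linarith)
      · simp only [sub_add_cancel]
        rw [Real.sq_sqrt (by positivity)]
        field_simp
        ring
  rw [lintegral_expMeasure_one (by fun_prop)]
  conv_lhs => rw [← him]
  rw [lintegral_image_eq_lintegral_deriv_mul_of_monotoneOn (f' := fun a => (a + l) / p)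
    measurableSet_Ioi]
  · refine setLIntegral_congr_fun measurableSet_Ioi fun a ha => ?_
    have ha' : 0 < a := ha
    rw [← mul_assoc, ← ENNReal.ofReal_mul (by positivity)]
    congr 2
    have : l ^ 2 + 2 * p * (((a + l) ^ 2 - l ^ 2) / (2 * p)) = (a + l) ^ 2 := by
      field_simp; ring
    rw [this, Real.sqrt_sq (by positivity)]
    ring
  · intro a _
    have h := ((((hasDerivAt_id a).add_const l).pow 2).sub_const (l ^ 2)).div_const (2 * p)
    refine (h.congr_deriv ?_).hasDerivWithinAt
    simp only [id]
    field_simp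
    norm_num
    ring
  · intro a ha b hb hab
    have ha' : 0 < a := ha
    simp only
    gcongr

lemma lintegral_gapMeasure {c : ℝ} {F : ℝ → ℝ≥0∞} (hF : Measurable F) :
    ∫⁻ a, F a ∂(gapMeasure c) = ∫⁻ a in Set.Ioi 0, ENNReal.ofReal
      ((a + c) * Real.exp (-(1 / 2) * (a + c) ^ 2 + (1 / 2) * c ^ 2)) * F a := by
  rw [gapMeasure, lintegral_withDensity_eq_lintegral_mul _ (by fun_prop) hF]
  rfl

/-- The case p = 1 of the preceding substitution. Realizing every gap law as an image of one fixed
exponential law makes its dependence on c visibly measurable. -/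
lemma gapMeasure_eq_map {c : ℝ} (hc : 0 ≤ c) :
    gapMeasure c = (expMeasure 1).map fun y => √(c ^ 2 + 2 * y) - c := by
  refine Measure.ext_of_lintegral _ fun F hF => ?_
  rw [lintegral_map hF (by fun_prop), lintegral_gapMeasure hF]
  have := lintegral_expMeasure_sqrt_sub one_pos hc hF
  simp only [mul_one] at this
  rw [this]
  refine lintegral_congr fun a => ?_
  congr 3
  · ring
  · congr 1; ring

lemma isProbabilityMeasure_gapMeasure {c : ℝ} (hc : 0 ≤ c) :
    IsProbabilityMeasure (gapMeasure c) := by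
  rw [gapMeasure_eq_map hc]
  exact Measure.isProbabilityMeasure_map (by fun_prop)

/-! ### Integrals over the simplex -/

lemma simplexPoint_last {d : ℕ} (x : Fin d → ℝ) : simplexPoint x (Fin.last d) = 1 - ∑ j, x j := by
  simp [simplexPoint]

lemma simplexPoint_castSucc {d : ℕ} (x : Fin d → ℝ) (j : Fin d) :
    simplexPoint x j.castSucc = x j := by
  simp [simplexPoint]

lemma sum_simplexPoint {d : ℕ} (x : Fin d → ℝ) : ∑ i, simplexPoint x i = 1 := by
  simp [Fin.sum_univ_castSucc, simplexPoint_last, simplexPoint_castSucc]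

@[fun_prop]
lemma measurable_simplexPoint {d : ℕ} : Measurable (simplexPoint (d := d)) :=
  measurable_snoc.comp ((measurable_const.sub (by fun_prop)).prodMk measurable_id)

/-- The (d + 1)-fold convolution of hitting-time densities: the first coordinate is split off, the
others are integrated by induction, and one two-fold convolution remains. -/
lemma lintegral_prod_hittingDensity {d : ℕ} {l : Fin (d + 1) → ℝ} (hl : ∀ i, 0 < l i) (t : ℝ) :
    ∫⁻ x : Fin d → ℝ, (∏ j : Fin d, ENNReal.ofReal (hittingDensity (l j.castSucc) (x j))) *
      ENNReal.ofReal (hittingDensity (l (Fin.last d)) (t - ∑ j, x j)) =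
      ENNReal.ofReal (hittingDensity (∑ i, l i) t) := by
  induction d generalizing t with
  | zero => simp [volume_pi]
  | succ d ih =>
    have hm : ∀ (a : ℝ) , Measurable fun t => ENNReal.ofReal (hittingDensity a t) := fun a =>
      (measurable_hittingDensity measurable_const measurable_id).ennreal_ofReal
    have hm1 : ∀ i : Fin d, Measurable fun x : Fin d → ℝ =>
        ENNReal.ofReal (hittingDensity (l i.succ.castSucc) (x i)) := fun i =>
      (hm _).comp (measurable_pi_apply i)
    have hm2 : ∀ i : Fin (d + 1), Measurable fun x : Fin (d + 1) → ℝ =>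
        ENNReal.ofReal (hittingDensity (l i.castSucc) (x i)) := fun i =>
      (hm _).comp (measurable_pi_apply i)
    rw [lintegral_fin_cons]
    swap
    · exact (Finset.measurable_prod _ fun i _ => hm2 i).mul ((hm _).comp (by fun_prop))
    have : ∀ a : ℝ, ∫⁻ y : Fin d → ℝ, (∏ j : Fin (d + 1), ENNReal.ofReal
        (hittingDensity (l j.castSucc) (Fin.cons (α := fun _ => ℝ) a y j))) *
        ENNReal.ofReal (hittingDensity (l (Fin.last (d + 1)))
          (t - ∑ j, Fin.cons (α := fun _ => ℝ) a y j)) =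
        ENNReal.ofReal (hittingDensity (l 0) a) *
          ENNReal.ofReal (hittingDensity (∑ i : Fin (d + 1), l i.succ) (t - a)) := by
      intro a
      rw [← ih (l := fun i => l i.succ) (fun i => hl _), ← lintegral_const_mul]
      · refine lintegral_congr fun y => ?_
        simp only [Fin.prod_univ_succ, Fin.sum_univ_succ, Fin.cons_zero, Fin.cons_succ, mul_assoc,
          Fin.castSucc_zero, Fin.succ_castSucc, Fin.succ_last, sub_sub]
      · exact (Finset.measurable_prod _ fun i _ => hm1 i).mul ((hm _).comp (by fun_prop))
    simp_rw [this]
    rw [lintegral_hittingDensity_mul (hl 0) (Finset.sum_pos (fun i _ => hl _) (by simp)),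
      Fin.sum_univ_succ l]

/-- The conditional density of the limit, at a point `p` of the simplex, given quantities `l`. -/
def posteriorDensity {d : ℕ} (l p : Fin (d + 1) → ℝ) : ℝ≥0∞ :=
  ENNReal.ofReal ((∏ i, hittingDensity (l i) (p i)) / hittingDensity (∑ i, l i) 1)

lemma measurable_posteriorDensity {d : ℕ} {α : Type*} [MeasurableSpace α]
    {f g : α → Fin (d + 1) → ℝ} (hf : Measurable f) (hg : Measurable g) :
    Measurable fun x => posteriorDensity (f x) (g x) := by
  refine Measurable.ennreal_ofReal (Measurable.div ?_ ?_)
  · exact Finset.measurable_prod _ fun i _ => measurable_hittingDensity (by fun_prop) (by fun_prop)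
  · exact measurable_hittingDensity (by fun_prop) (by fun_prop)

/-- The multiple convolution at time 1 is exactly the normalizing denominator. -/
lemma lintegral_posteriorDensity {d : ℕ} {l : Fin (d + 1) → ℝ} (hl : ∀ i, 0 < l i) :
    ∫⁻ x, posteriorDensity l (simplexPoint x) = 1 := by
  have hpos : 0 < hittingDensity (∑ i, l i) 1 :=
    hittingDensity_pos (Finset.sum_pos (fun i _ => hl _) (by simp)) one_pos
  have h := lintegral_prod_hittingDensity hl 1
  have hpt : ∀ x : Fin d → ℝ, posteriorDensity l (simplexPoint x) =
      ((∏ j : Fin d, ENNReal.ofReal (hittingDensity (l j.castSucc) (x j))) *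
      ENNReal.ofReal (hittingDensity (l (Fin.last d)) (1 - ∑ j, x j))) *
      (ENNReal.ofReal (hittingDensity (∑ i, l i) 1))⁻¹ := by
    intro x
    rw [posteriorDensity, ENNReal.ofReal_div_of_pos hpos, div_eq_mul_inv,
      ENNReal.ofReal_prod_of_nonneg fun i _ => hittingDensity_nonneg (hl i).le _,
      Fin.prod_univ_castSucc]
    simp only [simplexPoint_last, simplexPoint_castSucc]
  simp_rw [hpt]
  rw [lintegral_mul_const'', h, ENNReal.mul_inv_cancel (by simpa using hpos) ENNReal.ofReal_ne_top]
  refine Measurable.aemeasurable ?_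
  refine (Finset.measurable_prod _ fun i _ => ?_).mul ?_
  · exact (measurable_hittingDensity (by fun_prop) (by fun_prop)).ennreal_ofReal
  · exact (measurable_hittingDensity (by fun_prop) (by fun_prop)).ennreal_ofReal

lemma measurableSet_pos {n : ℕ} : MeasurableSet {p : Fin n → ℝ | ∀ i, 0 < p i} := by
  simp only [Set.ofPred_forall]
  exact .iInter fun i => measurableSet_lt measurable_const (measurable_pi_apply i)

lemma lintegral_dirichletMeasure {d : ℕ} {α : Fin (d + 1) → ℝ} {F : (Fin (d + 1) → ℝ) → ℝ≥0∞}
    (hF : Measurable F) :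
    ∫⁻ p, F p ∂(dirichletMeasure α) = ∫⁻ x : Fin d → ℝ,
      ({p : Fin (d + 1) → ℝ | ∀ j, 0 < p j}.indicator (fun p => ENNReal.ofReal
        (Real.Gamma (∑ j, α j) / (∏ j, Real.Gamma (α j)) * ∏ j, p j ^ (α j - 1)))
        (simplexPoint x)) * F (simplexPoint x) := by
  rw [dirichletMeasure, lintegral_map hF measurable_simplexPoint,
    lintegral_withDensity_eq_lintegral_mul _ _ (by fun_prop)]
  · rfl
  · refine Measurable.indicator (by fun_prop) ?_
    exact measurable_simplexPoint measurableSet_pos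

lemma ae_dirichletMeasure_pos {d : ℕ} (α : Fin (d + 1) → ℝ) :
    ∀ᵐ p ∂(dirichletMeasure α), (∀ i, 0 < p i) ∧ ∑ i, p i = 1 := by
  have hm : MeasurableSet {p : Fin (d + 1) → ℝ | (∀ i, 0 < p i) ∧ ∑ i, p i = 1} :=
    measurableSet_pos.inter (measurableSet_eq_fun (by fun_prop) measurable_const)
  rw [ae_iff, ← Set.compl_ofPred, ← lintegral_indicator_one hm.compl, lintegral_dirichletMeasure
    (measurable_one.indicator hm.compl)]
  rw [lintegral_congr (g := fun _ => 0), lintegral_zero]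
  intro x
  by_cases h : ∀ i, 0 < simplexPoint x i
  · rw [Set.indicator_of_notMem (s := {p : Fin (d + 1) → ℝ | (∀ i, 0 < p i) ∧ ∑ i, p i = 1}ᶜ),
      mul_zero]
    simp [h, sum_simplexPoint]
  · rw [Set.indicator_of_notMem (by simpa using h), zero_mul]

end

section

/-! ### The initial quantities -/

lemma lintegral_comp_smul_fin {d : ℕ} {c : ℝ} (hc : 0 < c) {G : (Fin d → ℝ) → ℝ≥0∞}
    (hG : Measurable G) :
    ENNReal.ofReal (c ^ d) * ∫⁻ x, G (c • x) = ∫⁻ y, G y := by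
  rw [← lintegral_map (μ := volume) hG (by fun_prop), Measure.map_addHaar_smul _ hc.ne',
    lintegral_smul_measure, smul_eq_mul, ← mul_assoc, ← ENNReal.ofReal_mul (by positivity)]
  simp only [Module.finrank_fintype_fun_eq_card, Fintype.card_fin]
  rw [abs_of_pos (by positivity), mul_inv_cancel₀ (by positivity), ENNReal.ofReal_one, one_mul]

lemma smul_simplexPoint {d : ℕ} (c : ℝ) (x : Fin d → ℝ) :
    c • simplexPoint x = Fin.snoc (α := fun _ => ℝ) (c • x) (c - ∑ j, (c • x) j) := by
  ext i
  refine Fin.lastCases ?_ (fun j => ?_) i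
  · simp [simplexPoint_last, mul_sub, Finset.mul_sum]
  · simp [simplexPoint_castSucc]

/-- Integration in the coordinates "total" and "proportions". -/
lemma lintegral_smul_simplexPoint {d : ℕ} {H : (Fin (d + 1) → ℝ) → ℝ≥0∞} (hH : Measurable H)
    (hH0 : ∀ l, ¬ (∀ i, 0 < l i) → H l = 0) :
    ∫⁻ c in Set.Ioi (0 : ℝ), ENNReal.ofReal (c ^ d) * ∫⁻ x : Fin d → ℝ, H (c • simplexPoint x) =
      ∫⁻ l, H l := by
  have hm : Measurable fun z : ℝ × (Fin d → ℝ) =>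
      H (Fin.snoc (α := fun _ => ℝ) z.2 (z.1 - ∑ j, z.2 j)) :=
    hH.comp (measurable_snoc.comp
      ((measurable_fst.sub (by fun_prop)).prodMk measurable_snd))
  have h1 : ∀ c ∈ Set.Ioi (0 : ℝ), ENNReal.ofReal (c ^ d) *
      ∫⁻ x : Fin d → ℝ, H (c • simplexPoint x) =
      ∫⁻ y : Fin d → ℝ, H (Fin.snoc (α := fun _ => ℝ) y (c - ∑ j, y j)) := by
    intro c hc
    rw [← lintegral_comp_smul_fin (Set.mem_Ioi.1 hc)
      (G := fun y => H (Fin.snoc (α := fun _ => ℝ) y (c - ∑ j, y j)))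
      (hm.comp (measurable_const.prodMk measurable_id))]
    simp only [smul_simplexPoint]
  rw [setLIntegral_congr_fun measurableSet_Ioi h1, ← lintegral_indicator measurableSet_Ioi]
  -- The restriction to c > 0 is automatic: if all coordinates are positive, so is their sum c.
  have h2 : ∀ c : ℝ, (Set.Ioi (0 : ℝ)).indicator (fun c => ∫⁻ y : Fin d → ℝ,
      H (Fin.snoc (α := fun _ => ℝ) y (c - ∑ j, y j))) c =
      ∫⁻ y : Fin d → ℝ, H (Fin.snoc (α := fun _ => ℝ) y (c - ∑ j, y j)) := by
    intro c
    by_cases hc : c ∈ Set.Ioi (0 : ℝ)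
    · rw [Set.indicator_of_mem hc]
    · rw [Set.indicator_of_notMem hc, eq_comm]
      rw [lintegral_congr (g := fun _ => 0), lintegral_zero]
      intro y
      refine hH0 _ fun h => hc ?_
      have : 0 < ∑ i, Fin.snoc (α := fun _ => ℝ) y (c - ∑ j, y j) i :=
        Finset.sum_pos (fun i _ => h i) (by simp)
      simpa [Fin.sum_univ_castSucc] using this
  simp_rw [h2]
  -- For fixed first d coordinates, the last one differs from the total by a translation.
  rw [lintegral_lintegral_swap hm.aemeasurable, lintegral_fin_snoc hH]
  refine lintegral_congr fun y => ?_
  exact lintegral_sub_right_eq_self (μ := volume)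
    (fun a => H (Fin.snoc (α := fun _ => ℝ) y a)) (∑ j, y j)

/-- The normalizing constant of the density of the initial quantities. -/
def initialConst (d : ℕ) : ℝ :=
  2 * ((1 / 2 : ℝ) ^ ((((d + 1 : ℕ) : ℝ) + 1) / 2) / Real.Gamma ((((d + 1 : ℕ) : ℝ) + 1) / 2)) *
    Real.Gamma ((d + 1 : ℕ) : ℝ)

lemma initialConst_pos (d : ℕ) : 0 < initialConst d := by
  have h1 : 0 < Real.Gamma ((((d + 1 : ℕ) : ℝ) + 1) / 2) := Real.Gamma_pos_of_pos (by positivity)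
  have h2 : 0 < Real.Gamma ((d + 1 : ℕ) : ℝ) := Real.Gamma_pos_of_pos (by positivity)
  unfold initialConst
  positivity

/-- The density of the initial quantities. -/
def initialDensity {d : ℕ} : (Fin (d + 1) → ℝ) → ℝ≥0∞ :=
  {l | ∀ i, 0 < l i}.indicator fun l =>
    ENNReal.ofReal (initialConst d * (∑ i, l i) * Real.exp (-((∑ i, l i) ^ 2 / 2)))

@[fun_prop]
lemma measurable_initialDensity {d : ℕ} : Measurable (initialDensity (d := d)) :=
  Measurable.indicator (by fun_prop) measurableSet_pos

/-- The substitution y = c². The power of c is kept as c * c ^ d: the factor c ^ d will be the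
Jacobian of the passage from total and proportions to quantities, and the remaining c is the total
in `initialDensity`. -/
lemma lintegral_sqrt_gammaMeasure (d : ℕ) {G : ℝ → ℝ≥0∞} (hG : Measurable G) :
    ∫⁻ y, G (√y) ∂(gammaMeasure ((((d + 1 : ℕ) : ℝ) + 1) / 2) (1 / 2)) =
      ∫⁻ c in Set.Ioi (0 : ℝ), ENNReal.ofReal (2 * ((1 / 2 : ℝ) ^ ((((d + 1 : ℕ) : ℝ) + 1) / 2) /
        Real.Gamma ((((d + 1 : ℕ) : ℝ) + 1) / 2)) * (c * c ^ d)
            * Real.exp (-(c ^ 2 / 2))) * G c := by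
  have hs : (0 : ℝ) < (((d + 1 : ℕ) : ℝ) + 1) / 2 := by positivity
  set s := (((d + 1 : ℕ) : ℝ) + 1) / 2 with hsdef
  have hΓ := Real.Gamma_pos_of_pos hs
  have him : (fun c : ℝ => c ^ 2) '' Set.Ioi 0 = Set.Ioi 0 := by
    ext y
    constructor
    · rintro ⟨c, hc, rfl⟩
      exact Set.mem_Ioi.2 (pow_pos hc 2)
    · intro hy
      exact ⟨√y, Set.mem_Ioi.2 (Real.sqrt_pos.2 hy), Real.sq_sqrt (le_of_lt hy)⟩
  have h0 : ∫⁻ y, G (√y) ∂(gammaMeasure s (1 / 2)) =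
      ∫⁻ y in Set.Ioi 0, gammaPDF s (1 / 2) y * G (√y) := by
    rw [gammaMeasure, lintegral_withDensity_eq_lintegral_mul _
      (by unfold gammaPDF; fun_prop) (by fun_prop),
      setLIntegral_congr Ioi_ae_eq_Ici, ← lintegral_indicator measurableSet_Ici]
    refine lintegral_congr fun y => ?_
    by_cases hy : y ∈ Set.Ici (0 : ℝ)
    · rw [Set.indicator_of_mem hy, Pi.mul_apply]
    · rw [Set.indicator_of_notMem hy, Pi.mul_apply, gammaPDF_of_neg (by simpa using hy), zero_mul]
  rw [h0]
  conv_lhs => rw [← him]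
  rw [lintegral_image_eq_lintegral_deriv_mul_of_monotoneOn (f' := fun c => 2 * c)
    measurableSet_Ioi]
  · refine setLIntegral_congr_fun measurableSet_Ioi fun c hc => ?_
    have hc' : 0 < c := hc
    rw [gammaPDF_of_nonneg (by positivity), ← mul_assoc, ← ENNReal.ofReal_mul (by positivity),
      Real.sqrt_sq hc'.le]
    congr 2
    have : (c ^ 2) ^ (s - 1) = c ^ d := by
      rw [← Real.rpow_natCast c 2, ← Real.rpow_mul hc'.le, ← Real.rpow_natCast c d]
      congr 1
      rw [hsdef]
      push_cast
      ring
    rw [this, show (1 / 2 * c ^ 2 : ℝ) = c ^ 2 / 2 by ring]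
    ring
  · intro c _
    exact ((hasDerivAt_pow 2 c).congr_deriv (by norm_num)).hasDerivWithinAt
  · intro a ha b hb hab
    have ha' : 0 < a := ha
    simp only
    gcongr

variable {Ω : Type*} [MeasurableSpace Ω] {μ : Measure Ω} {d : ℕ}
  {L : ℕ → Ω → Fin (d + 1) → ℝ} {I : ℕ → Ω → Fin (d + 1)} {A : ℕ → Ω → ℝ}

lemma IsContinuousUrn.measurable_total_zero (h : IsContinuousUrn L I A μ) :
    Measurable (total L 0) := by
  have := h.measurable_initial
  unfold total
  fun_prop

lemma IsContinuousUrn.measurable_proportion_zero (h : IsContinuousUrn L I A μ) :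
    Measurable (proportion L 0) := by
  have h1 := h.measurable_initial
  have h2 := h.measurable_total_zero
  unfold proportion
  refine measurable_pi_lambda _ fun i => ?_
  exact ((measurable_pi_apply i).comp h1).div h2

lemma IsContinuousUrn.lintegral_total_zero (h : IsContinuousUrn L I A μ) {G : ℝ → ℝ≥0∞}
    (hG : Measurable G) :
    ∫⁻ ω, G (total L 0 ω) ∂μ =
      ∫⁻ c in Set.Ioi (0 : ℝ), ENNReal.ofReal (2 * ((1 / 2 : ℝ) ^ ((((d + 1 : ℕ) : ℝ) + 1) / 2) /
        Real.Gamma ((((d + 1 : ℕ) : ℝ) + 1) / 2)) * (c * c ^ d)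
            * Real.exp (-(c ^ 2 / 2))) * G c := by
  rw [← lintegral_sqrt_gammaMeasure d hG, ← h.hasLaw_total_sq.lintegral_comp
    (Measurable.aemeasurable (by fun_prop))]
  refine lintegral_congr_ae ?_
  filter_upwards [h.initial_nonneg] with ω hω
  rw [Real.sqrt_sq]
  exact Finset.sum_nonneg fun i _ => hω i

lemma IsContinuousUrn.ae_total_zero_pos (h : IsContinuousUrn L I A μ) :
    ∀ᵐ ω ∂μ, 0 < total L 0 ω := by
  have hm : MeasurableSet {ω | 0 < total L 0 ω} :=
    measurableSet_lt measurable_const h.measurable_total_zero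
  have := h.lintegral_total_zero (G := (Set.Ioi (0 : ℝ))ᶜ.indicator 1)
    (measurable_one.indicator measurableSet_Ioi.compl)
  rw [setLIntegral_congr_fun (g := fun _ => 0) measurableSet_Ioi, lintegral_zero] at this
  · rw [ae_iff, ← Set.compl_ofPred, ← lintegral_indicator_one hm.compl, ← this]
    rfl
  · intro c hc
    simp only
    rw [Set.indicator_of_notMem (by simpa using hc), mul_zero]

/-- Dirichlet(1, …, 1) is uniform on the simplex, so the product law of total and proportions
becomes, in the coordinates L = C P, a function of the total alone. -/
lemma IsContinuousUrn.lintegral_initial [IsProbabilityMeasure μ] (h : IsContinuousUrn L I A μ)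
    {F : (Fin (d + 1) → ℝ) → ℝ≥0∞} (hF : Measurable F) :
    ∫⁻ ω, F (L 0 ω) ∂μ = ∫⁻ l, initialDensity l * F l := by
  have hC := h.measurable_total_zero
  have hP := h.measurable_proportion_zero
  have hlaw := (indepFun_iff_map_prod_eq_prod_map_map hC.aemeasurable hP.aemeasurable).1
    h.indep_initial
  have h1 : ∫⁻ ω, F (L 0 ω) ∂μ = ∫⁻ ω, F (total L 0 ω • proportion L 0 ω) ∂μ := by
    refine lintegral_congr_ae ?_
    filter_upwards [h.ae_total_zero_pos] with ω hω
    congr 1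
    ext i
    simp only [Pi.smul_apply, proportion, smul_eq_mul]
    field_simp
  have hFm : Measurable fun z : ℝ × (Fin (d + 1) → ℝ) => F (z.1 • z.2) := by fun_prop
  have hprob : IsProbabilityMeasure (μ.map (proportion L 0)) :=
    Measure.isProbabilityMeasure_map hP.aemeasurable
  rw [h1, ← lintegral_map (f := fun z : ℝ × (Fin (d + 1) → ℝ) => F (z.1 • z.2)) hFm
    (hC.prodMk hP), hlaw, lintegral_prod _ hFm.aemeasurable, lintegral_map
    (Measurable.lintegral_prod_right' hFm) hC, h.lintegral_total_zero
    (Measurable.lintegral_prod_right' hFm), h.hasLaw_proportion.map_eq]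
  have hm2 : Measurable fun l : Fin (d + 1) → ℝ => initialDensity l * F l := by fun_prop
  rw [← lintegral_smul_simplexPoint hm2]
  swap
  · intro l hl
    rw [initialDensity, Set.indicator_of_notMem (by exact hl), zero_mul]
  refine setLIntegral_congr_fun measurableSet_Ioi fun c hc => ?_
  have hc' : 0 < c := hc
  simp only
  rw [lintegral_dirichletMeasure (by fun_prop), ← lintegral_const_mul, ← lintegral_const_mul]
  rotate_left
  · exact hm2.comp (measurable_simplexPoint.const_smul c)
  · refine Measurable.mul ?_ (hF.comp (measurable_simplexPoint.const_smul c))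
    exact (Measurable.indicator (by fun_prop) measurableSet_pos).comp measurable_simplexPoint
  refine lintegral_congr fun x => ?_
  by_cases hx : ∀ i, 0 < simplexPoint x i
  · have hcx : ∀ i, 0 < (c • simplexPoint x) i := fun i => mul_pos hc' (hx i)
    have hΓ : 0 < Real.Gamma ((((d + 1 : ℕ) : ℝ) + 1) / 2) := Real.Gamma_pos_of_pos (by positivity)
    rw [initialDensity, Set.indicator_of_mem (by exact hx), Set.indicator_of_mem (by exact hcx),
      ← mul_assoc (ENNReal.ofReal _), ← mul_assoc (ENNReal.ofReal _),
          ← ENNReal.ofReal_mul (by positivity), ← ENNReal.ofReal_mul (by positivity)]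
    congr 2
    have hsum : ∑ i, (c • simplexPoint x) i = c := by
      simp [← Finset.mul_sum, sum_simplexPoint]
    rw [hsum, initialConst]
    simp
    ring
  · have hcx : ¬ ∀ i, 0 < (c • simplexPoint x) i := fun hh => hx fun i =>
      (mul_pos_iff_of_pos_left hc').1 (hh i)
    rw [initialDensity, Set.indicator_of_notMem (by exact hx),
        Set.indicator_of_notMem (by exact hcx)]
    simp

lemma IsContinuousUrn.ae_initial_pos [IsProbabilityMeasure μ] (h : IsContinuousUrn L I A μ) :
    ∀ᵐ ω ∂μ, ∀ i, 0 < L 0 ω i := by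
  have hm : MeasurableSet {ω | ∀ i, 0 < L 0 ω i} := h.measurable_initial measurableSet_pos
  have := h.lintegral_initial (F := {l : Fin (d + 1) → ℝ | ∀ i, 0 < l i}ᶜ.indicator 1)
    (measurable_one.indicator measurableSet_pos.compl)
  rw [lintegral_congr (f := fun l => initialDensity l * _) (g := fun _ => 0),
      lintegral_zero] at this
  · rw [ae_iff, ← Set.compl_ofPred, ← lintegral_indicator_one hm.compl, ← this]
    rfl
  · intro l
    by_cases hl : ∀ i, 0 < l i
    · rw [Set.indicator_of_notMem (s := {l : Fin (d + 1) → ℝ | ∀ i, 0 < l i}ᶜ) (by simpa using hl),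
        mul_zero]
    · rw [initialDensity, Set.indicator_of_notMem (by exact hl), zero_mul]

/-! ### The mixture at time zero -/

/-- Legendre's duplication formula at (d + 1) / 2. It reconciles the normalization of Dirichlet(1/2,
…, 1/2) with that of the initial law. -/
lemma initialConst_eq (d : ℕ) :
    Real.Gamma (((d + 1 : ℕ) : ℝ) / 2) / √Real.pi ^ (d + 1) =
      initialConst d * √(2 * Real.pi) / √(2 * Real.pi) ^ (d + 1) := by
  have hdup := Real.Gamma_mul_Gamma_add_half (((d + 1 : ℕ) : ℝ) / 2)
  have h2 : ((d + 1 : ℕ) : ℝ) / 2 + 1 / 2 = (((d + 1 : ℕ) : ℝ) + 1) / 2 := by ring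
  have h3 : 2 * (((d + 1 : ℕ) : ℝ) / 2) = ((d + 1 : ℕ) : ℝ) := by ring
  rw [h2, h3] at hdup
  have hΓ : 0 < Real.Gamma ((((d + 1 : ℕ) : ℝ) + 1) / 2) := Real.Gamma_pos_of_pos (by positivity)
  have hr2 : (√2 : ℝ) ^ 2 = 2 := Real.sq_sqrt (by norm_num)
  have hpow : (1 / 2 : ℝ) ^ ((((d + 1 : ℕ) : ℝ) + 1) / 2) = ((√2) ^ (d + 2))⁻¹ := by
    rw [one_div, Real.inv_rpow (by norm_num), Real.sqrt_eq_rpow, ← Real.rpow_natCast,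
      ← Real.rpow_mul (by norm_num)]
    congr 2
    push_cast
    ring
  have hpow2 : (2 : ℝ) ^ (1 - ((d + 1 : ℕ) : ℝ)) = ((√2) ^ (2 * d))⁻¹ := by
    rw [pow_mul, hr2, ← Real.rpow_natCast, ← Real.rpow_neg (by norm_num)]
    congr 1
    push_cast
    ring
  have hΓm : Real.Gamma ((d + 1 : ℕ) : ℝ) = Real.Gamma (((d + 1 : ℕ) : ℝ) / 2) *
      Real.Gamma ((((d + 1 : ℕ) : ℝ) + 1) / 2) * √2 ^ (2 * d) / √Real.pi := by
    rw [hdup, hpow2]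
    have : 0 < √Real.pi := Real.sqrt_pos.2 Real.pi_pos
    field_simp
  unfold initialConst
  rw [hΓm, hpow, Real.sqrt_mul (by norm_num), mul_pow]
  have hp : 0 < √Real.pi := Real.sqrt_pos.2 Real.pi_pos
  have h2p : 0 < √(2 : ℝ) := by positivity
  generalize √(2 : ℝ) = r at *
  field_simp
  rw [← hr2]
  ring

/-- Mixing Rayleigh variables over a `Dirichlet(1/2, …, 1/2)` vector gives the initial law, with
the announced posterior. -/
lemma dirichlet_mul_rayleigh {l p : Fin (d + 1) → ℝ} (hl : ∀ i, 0 < l i) :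
    ({p : Fin (d + 1) → ℝ | ∀ j, 0 < p j}.indicator (fun p => ENNReal.ofReal
        (Real.Gamma (∑ _j : Fin (d + 1), (1 / 2 : ℝ)) / (∏ _j : Fin (d + 1), Real.Gamma (1 / 2)) *
          ∏ j, p j ^ ((1 / 2 : ℝ) - 1))) p) *
      ∏ i, ENNReal.ofReal (l i / p i * Real.exp (-(l i ^ 2 / (2 * p i)))) =
    initialDensity l * posteriorDensity l p := by
  have hC : 0 < ∑ i, l i := Finset.sum_pos (fun i _ => hl i) (by simp)
  by_cases hp : ∀ j, 0 < p j
  · have hnn : ∀ i, 0 ≤ l i / p i * Real.exp (-(l i ^ 2 / (2 * p i))) := fun i => by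
      have := hl i; have := hp i; positivity
    have hΓ : 0 < Real.Gamma (∑ _j : Fin (d + 1), (1 / 2 : ℝ)) :=
      Real.Gamma_pos_of_pos (Finset.sum_pos (fun _ _ => by norm_num) (by simp))
    have hΓ' : 0 < Real.Gamma (1 / 2) := Real.Gamma_pos_of_pos (by norm_num)
    have hpp : 0 < ∏ j, p j ^ ((1 / 2 : ℝ) - 1) :=
      Finset.prod_pos fun j _ => Real.rpow_pos_of_pos (hp j) _
    have hK := initialConst_pos d
    rw [initialDensity, Set.indicator_of_mem (by exact hp), Set.indicator_of_mem (by exact hl),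
      posteriorDensity, ← ENNReal.ofReal_prod_of_nonneg fun i _ => hnn i,
      ← ENNReal.ofReal_mul (by positivity), ← ENNReal.ofReal_mul (by positivity)]
    congr 1
    -- A hitting-time density, seen as a function of its level, is a Rayleigh density times
    -- p_i^(−1/2) / √(2π), and p_i^(−1/2) is a factor of the Dirichlet(1/2) density.
    have e1 : ∀ i, hittingDensity (l i) (p i) = (l i / p i * Real.exp (-(l i ^ 2 / (2 * p i)))) *
        p i ^ ((1 / 2 : ℝ) - 1) * (√(2 * Real.pi))⁻¹ := by
      intro i
      have := hp i
      rw [hittingDensity_of_pos (hp i), Real.rpow_sub (hp i), Real.rpow_one, ← Real.sqrt_eq_rpow]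
      have : √(p i) ^ 2 = p i := Real.sq_sqrt (hp i).le
      have : 0 < √(p i) := Real.sqrt_pos.2 (hp i)
      have : 0 < √(2 * Real.pi) := by positivity
      field_simp
      simp only [*]
    simp_rw [e1, Finset.prod_mul_distrib]
    rw [hittingDensity_of_pos one_pos]
    have hconst := initialConst_eq d
    have hs : ∑ _j : Fin (d + 1), (1 / 2 : ℝ) = ((d + 1 : ℕ) : ℝ) / 2 := by
      simp; ring
    rw [hs]
    simp only [Finset.prod_const, Finset.card_univ, Fintype.card_fin, Real.Gamma_one_half_eq,
      Real.sqrt_one, mul_one, div_one]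
    rw [hconst, ← Finset.prod_mul_distrib]
    have h2 : 0 < √(2 * Real.pi) := by positivity
    have h3 := Real.exp_pos (-((∑ i, l i) ^ 2 / 2))
    rw [inv_pow]
    field_simp
  · rw [Set.indicator_of_notMem (by exact hp), zero_mul]
    push Not at hp
    obtain ⟨i, hi⟩ := hp
    rw [posteriorDensity, Finset.prod_eq_zero (Finset.mem_univ i) (hittingDensity_of_nonpos hi _)]
    simp

end

section

/-! ### Conditional probabilities given a random variable -/

section Conditioning

variable {Ω 𝓧 : Type*} [MeasurableSpace Ω] [MeasurableSpace 𝓧] {μ : Measure Ω}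
  {X : Ω → 𝓧} {E : Set Ω} {ρ : Ω → ℝ}

lemma measure_inter_preimage_of_condExp [IsProbabilityMeasure μ] (hX : Measurable X)
    (hE : MeasurableSet E)
    (h : μ⟦E | MeasurableSpace.comap X inferInstance⟧ =ᵐ[μ] ρ) {S : Set 𝓧} (hS : MeasurableSet S) :
    μ (E ∩ X ⁻¹' S) = ∫⁻ ω in X ⁻¹' S, ENNReal.ofReal (ρ ω) ∂μ := by
  have hint : Integrable (E.indicator fun _ => (1 : ℝ)) μ :=
    (integrable_const 1).indicator hE
  have hnn : 0 ≤ᵐ[μ] μ⟦E | MeasurableSpace.comap X inferInstance⟧ :=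
    condExp_nonneg (ae_of_all _ fun ω => Set.indicator_nonneg (fun _ _ => zero_le_one) ω)
  have h1 := setIntegral_condExp hX.comap_le hint ⟨S, hS, rfl⟩
  rw [integral_indicator hE, Measure.restrict_restrict hE] at h1
  simp only [integral_const, smul_eq_mul, mul_one, measureReal_restrict_apply_univ] at h1
  have h2 : (fun ω => ENNReal.ofReal ((μ⟦E | MeasurableSpace.comap X inferInstance⟧) ω))
      =ᵐ[μ.restrict (X ⁻¹' S)] fun ω => ENNReal.ofReal (ρ ω) :=
    ae_restrict_of_ae (h.mono fun ω hω => congrArg ENNReal.ofReal hω)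
  rw [← lintegral_congr_ae h2,
    ← ofReal_integral_eq_lintegral_ofReal integrable_condExp.integrableOn
      (ae_restrict_of_ae hnn), h1, measureReal_def, ENNReal.ofReal_toReal (measure_ne_top _ _)]

lemma aemeasurable_of_condExp (hX : Measurable X)
    (h : μ⟦E | MeasurableSpace.comap X inferInstance⟧ =ᵐ[μ] ρ) : AEMeasurable ρ μ :=
  ((stronglyMeasurable_condExp.mono hX.comap_le).measurable.aemeasurable).congr h

/-- Both sides integrate `H` against the image under `X` of a measure: `μ` restricted to `E`, and
`μ` with density `ρ`. The defining property of the conditional probability says that these images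
agree on every measurable set. -/
lemma setLIntegral_of_condExp [IsProbabilityMeasure μ] (hX : Measurable X) (hE : MeasurableSet E)
    (h : μ⟦E | MeasurableSpace.comap X inferInstance⟧ =ᵐ[μ] ρ) {H : 𝓧 → ℝ≥0∞}
    (hH : Measurable H) :
    ∫⁻ ω in E, H (X ω) ∂μ = ∫⁻ ω, ENNReal.ofReal (ρ ω) * H (X ω) ∂μ := by
  have hρ := (aemeasurable_of_condExp hX h).ennreal_ofReal
  have hmap : (μ.restrict E).map X = (μ.withDensity fun ω => ENNReal.ofReal (ρ ω)).map X := by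
    ext S hS
    rw [Measure.map_apply hX hS, Measure.map_apply hX hS, Measure.restrict_apply (hX hS),
      withDensity_apply _ (hX hS), Set.inter_comm, measure_inter_preimage_of_condExp hX hE h hS]
  rw [← lintegral_map hH hX, hmap, lintegral_map hH hX,
    lintegral_withDensity_eq_lintegral_mul₀ hρ (g := fun ω => H (X ω))
      (hH.comp hX).aemeasurable]
  rfl

/-- A conditional probability is characterized by its integrals over the events generated by the
conditioning variable. -/
lemma condExp_eq_of_measure_inter [IsProbabilityMeasure μ] (hX : Measurable X)
    (hE : MeasurableSet E) {g : 𝓧 → ℝ}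
    (hg : Measurable g) (hg0 : ∀ x, 0 ≤ g x) (hg1 : ∀ x, g x ≤ 1)
    (h : ∀ S : Set 𝓧, MeasurableSet S →
      μ (E ∩ X ⁻¹' S) = ∫⁻ ω in X ⁻¹' S, ENNReal.ofReal (g (X ω)) ∂μ) :
    μ⟦E | MeasurableSpace.comap X inferInstance⟧ =ᵐ[μ] fun ω => g (X ω) := by
  have hgX : Integrable (fun ω => g (X ω)) μ :=
    Integrable.of_bound (hg.comp hX).aestronglyMeasurable 1
      (ae_of_all _ fun ω => by rw [Real.norm_of_nonneg (hg0 _)]; exact hg1 _)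
  refine (ae_eq_condExp_of_forall_setIntegral_eq hX.comap_le ((integrable_const 1).indicator hE)
    (fun _ _ _ => hgX.integrableOn) ?_ ?_).symm
  · rintro _ ⟨S, hS, rfl⟩ -
    rw [integral_indicator hE, Measure.restrict_restrict hE]
    simp only [integral_const, smul_eq_mul, mul_one, measureReal_restrict_apply_univ]
    rw [measureReal_def, h S hS, integral_eq_lintegral_of_nonneg_ae (ae_of_all _ fun ω => hg0 _)
      hgX.aestronglyMeasurable.restrict]
  · exact (hg.comp (comap_measurable X)).stronglyMeasurable.aestronglyMeasurable

end Conditioning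

/-! ### The path of an urn -/

/-- The space of paths: initial quantities, then the successive choices and additions. -/
abbrev Path (d : ℕ) : Type := (Fin (d + 1) → ℝ) × (ℕ → Fin (d + 1) × ℝ)

variable {d : ℕ}

/-- The quantities after `n` steps along a path. -/
def Path.L : ℕ → Path d → Fin (d + 1) → ℝ
  | 0, z => z.1
  | n + 1, z => Function.update (Path.L n z) (z.2 n).1 (Path.L n z (z.2 n).1 + (z.2 n).2)

/-- The color chosen at step `n + 1` along a path. -/
def Path.I (n : ℕ) (z : Path d) : Fin (d + 1) := (z.2 n).1

/-- The quantity added at step `n + 1` along a path. -/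
def Path.A (n : ℕ) (z : Path d) : ℝ := (z.2 n).2

/-- Prescribe what happens at step `n + 1`. -/
def Path.set (n : ℕ) (z : Path d) (s : Fin (d + 1) × ℝ) : Path d := (z.1, Function.update z.2 n s)

/-- Forget what happens after step `n`. -/
def Path.trunc (n : ℕ) (z : Path d) : Path d := (z.1, fun k => if k < n then z.2 k else (0, 0))

lemma measurable_update_add {α : Type*} [MeasurableSpace α] {f : α → Fin (d + 1) → ℝ}
    {i : α → Fin (d + 1)} {a : α → ℝ} (hf : Measurable f) (hi : Measurable i) (ha : Measurable a) :
    Measurable fun x => Function.update (f x) (i x) (f x (i x) + a x) := by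
  refine measurable_pi_lambda _ fun j => ?_
  have : (fun x => Function.update (f x) (i x) (f x (i x) + a x) j) =
      fun x => if i x = j then f x j + a x else f x j := by
    ext x
    by_cases h : i x = j
    · subst h; simp
    · simp [h, Function.update_of_ne (Ne.symm h)]
  rw [this]
  have hfj : Measurable fun x => f x j := (measurable_pi_apply j).comp hf
  exact Measurable.ite (hi (measurableSet_singleton j)) (hfj.add ha) hfj

@[fun_prop]
lemma Path.measurable_I (n : ℕ) : Measurable (Path.I (d := d) n) := by
  unfold Path.I; fun_prop

@[fun_prop]
lemma Path.measurable_A (n : ℕ) : Measurable (Path.A (d := d) n) := by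
  unfold Path.A; fun_prop

@[fun_prop]
lemma Path.measurable_L (n : ℕ) : Measurable (Path.L (d := d) n) := by
  induction n with
  | zero => exact measurable_fst
  | succ n ih => exact measurable_update_add ih (Path.measurable_I n) (Path.measurable_A n)

lemma Path.measurable_set (n : ℕ) :
    Measurable fun y : Path d × (Fin (d + 1) × ℝ) => Path.set n y.1 y.2 := by
  unfold Path.set
  refine Measurable.prodMk (by fun_prop) (measurable_pi_lambda _ fun k => ?_)
  by_cases hk : k = n
  · subst hk; simp only [Function.update_self]; fun_prop
  · simp only [Function.update_of_ne hk]; fun_prop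

lemma Path.measurable_trunc (n : ℕ) : Measurable (Path.trunc (d := d) n) := by
  unfold Path.trunc
  refine Measurable.prodMk (by fun_prop) (measurable_pi_lambda _ fun k => ?_)
  split_ifs <;> fun_prop

lemma Path.trunc_succ (n : ℕ) (z : Path d) :
    Path.trunc (n + 1) z = Path.set n (Path.trunc n z) (z.2 n) := by
  unfold Path.trunc Path.set
  refine Prod.ext rfl (funext fun k => ?_)
  by_cases hk : k = n
  · subst hk; simp
  · simp only [Function.update_of_ne hk]
    congr 1
    rw [Nat.lt_succ_iff_lt_or_eq]
    simp [hk]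

lemma Path.L_congr {n : ℕ} {z z' : Path d} (h0 : z.1 = z'.1) (h : ∀ k < n, z.2 k = z'.2 k) :
    Path.L n z = Path.L n z' := by
  induction n with
  | zero => exact h0
  | succ n ih =>
    simp only [Path.L]
    rw [ih fun k hk => h k (by omega), h n (by omega)]

lemma Path.L_trunc (n : ℕ) (z : Path d) : Path.L n (Path.trunc n z) = Path.L n z :=
  Path.L_congr rfl fun k hk => by simp [Path.trunc, hk]

lemma Path.L_succ_set (n : ℕ) (z : Path d) (s : Fin (d + 1) × ℝ) :
    Path.L (n + 1) (Path.set n z s) =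
      Function.update (Path.L n z) s.1 (Path.L n z s.1 + s.2) := by
  have : Path.L n (Path.set n z s) = Path.L n z :=
    Path.L_congr rfl fun k hk => by simp [Path.set, Function.update_of_ne hk.ne]
  simp only [Path.L, this]
  simp [Path.set]

section PathOf

variable {Ω : Type*} (L : ℕ → Ω → Fin (d + 1) → ℝ) (I : ℕ → Ω → Fin (d + 1)) (A : ℕ → Ω → ℝ)

/-- The path of an urn. -/
def pathOf (ω : Ω) : Path d := (L 0 ω, fun k => (I k ω, A k ω))

/-- The truncated path as a function of the history. -/
def pastPath (n : ℕ) (y : (Fin (d + 1) → ℝ) × (Fin n → Fin (d + 1) × ℝ)) : Path d :=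
  (y.1, fun k => if hk : k < n then y.2 ⟨k, hk⟩ else (0, 0))

lemma measurable_pastPath (n : ℕ) : Measurable (pastPath (d := d) n) := by
  unfold pastPath
  refine Measurable.prodMk (by fun_prop) (measurable_pi_lambda _ fun k => ?_)
  split_ifs <;> fun_prop

lemma trunc_pathOf (n : ℕ) (ω : Ω) :
    Path.trunc n (pathOf L I A ω) = pastPath n (past L I A n ω) := by
  refine Prod.ext rfl (funext fun k => ?_)
  by_cases hk : k < n <;> simp [Path.trunc, pathOf, pastPath, past, hk]

variable {L I A}

lemma Path.L_pathOf (h : ∀ n ω, L (n + 1) ω =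
    Function.update (L n ω) (I n ω) (L n ω (I n ω) + A n ω)) (n : ℕ) (ω : Ω) :
    Path.L n (pathOf L I A ω) = L n ω := by
  induction n with
  | zero => rfl
  | succ n ih => rw [h n ω, Path.L, ih]; rfl

lemma measurable_pathOf [MeasurableSpace Ω] (h0 : Measurable (L 0)) (hI : ∀ n, Measurable (I n))
    (hA : ∀ n, Measurable (A n)) : Measurable (pathOf L I A) := by
  unfold pathOf; fun_prop

end PathOf

/-! ### One-step integration formulas for the urn -/

section Urn

variable {Ω : Type*} [MeasurableSpace Ω] {μ : Measure Ω}
  {L : ℕ → Ω → Fin (d + 1) → ℝ} {I : ℕ → Ω → Fin (d + 1)} {A : ℕ → Ω → ℝ}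

lemma IsContinuousUrn.measurable_pathOf (h : IsContinuousUrn L I A μ) :
    Measurable (pathOf L I A) :=
  ContinuousUrn.measurable_pathOf h.measurable_initial h.measurable_index h.measurable_addition

lemma IsContinuousUrn.measurable_past (h : IsContinuousUrn L I A μ) (n : ℕ) :
    Measurable (past L I A n) := by
  have h0 := h.measurable_initial
  have h1 := h.measurable_index
  have h2 := h.measurable_addition
  unfold past
  fun_prop

/-- The quantities after `n` steps as a function of the history. -/
lemma IsContinuousUrn.L_eq_pastPath (h : IsContinuousUrn L I A μ) (n : ℕ) (ω : Ω) :
    L n ω = Path.L n (pastPath n (past L I A n ω)) := by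
  rw [← trunc_pathOf, Path.L_trunc, Path.L_pathOf h.succ_eq]

/-- The joint law of the conditioning variable and the addition is the image of (law of the
conditioning variable) ⊗ Exp(1) under an explicit map; Tonelli then gives the disintegration. -/
lemma IsContinuousUrn.lintegral_addition [IsProbabilityMeasure μ] (h : IsContinuousUrn L I A μ)
    {n : ℕ} (hpos : ∀ᵐ ω ∂μ, 0 ≤ total L n ω)
    {Ψ : (((Fin (d + 1) → ℝ) × (Fin n → Fin (d + 1) × ℝ)) × Fin (d + 1)) × ℝ → ℝ≥0∞}
    (hΨ : Measurable Ψ) :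
    ∫⁻ ω, Ψ ((past L I A n ω, I n ω), A n ω) ∂μ =
      ∫⁻ ω, ∫⁻ a, Ψ ((past L I A n ω, I n ω), a) ∂(gapMeasure (total L n ω)) ∂μ := by
  set X : Ω → ((Fin (d + 1) → ℝ) × (Fin n → Fin (d + 1) × ℝ)) × Fin (d + 1) :=
    fun ω => (past L I A n ω, I n ω)
  have hX : Measurable X := (h.measurable_past n).prodMk (h.measurable_index n)
  have hA := h.measurable_addition n
  set c : ((Fin (d + 1) → ℝ) × (Fin n → Fin (d + 1) × ℝ)) × Fin (d + 1) → ℝ :=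
    fun x => ∑ i, Path.L n (pastPath n x.1) i
  have hc : Measurable c := by
    have : Measurable fun x : ((Fin (d + 1) → ℝ) × (Fin n → Fin (d + 1) × ℝ)) × Fin (d + 1) =>
      Path.L n (pastPath n x.1) :=
      (Path.measurable_L n).comp ((measurable_pastPath n).comp measurable_fst)
    fun_prop
  have hcX : ∀ ω, c (X ω) = total L n ω := fun ω => by
    simp only [c, X, total, h.L_eq_pastPath n ω]
  -- The exponential representation of the gap, with the total read off the history.
  set f : (((Fin (d + 1) → ℝ) × (Fin n → Fin (d + 1) × ℝ)) × Fin (d + 1)) × ℝ → ℝ :=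
    fun z => √(c z.1 ^ 2 + 2 * z.2) - c z.1
  have hf : Measurable f := by fun_prop
  have hprob : IsProbabilityMeasure (μ.map X) := Measure.isProbabilityMeasure_map hX.aemeasurable
  have hlaw : μ.map (fun ω => (X ω, A n ω)) =
      ((μ.map X).prod (expMeasure 1)).map fun z => (z.1, f z) := by
    have : IsFiniteMeasure (μ.map fun ω => (X ω, A n ω)) :=
      Measure.isFiniteMeasure_map _ _
    refine Measure.ext_prod fun {S B} hS hB => ?_
    rw [Measure.map_apply (hX.prodMk hA) (hS.prod hB), Measure.map_apply
      (measurable_fst.prodMk hf) (hS.prod hB), Measure.prod_apply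
      ((measurable_fst.prodMk hf) (hS.prod hB)), lintegral_map
      (measurable_measure_prodMk_left ((measurable_fst.prodMk hf) (hS.prod hB))) hX]
    have h1 := measure_inter_preimage_of_condExp hX (hA hB) (h.addition_cond n B hB) hS
    have e1 : (fun ω => (X ω, A n ω)) ⁻¹' S ×ˢ B = A n ⁻¹' B ∩ X ⁻¹' S := by
      ext ω; simp [and_comm]
    rw [e1, h1, ← lintegral_indicator (hX hS)]
    refine lintegral_congr_ae ?_
    filter_upwards [hpos] with ω hω
    by_cases hωS : ω ∈ X ⁻¹' S
    · rw [Set.indicator_of_mem hωS]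
      have := isProbabilityMeasure_gapMeasure hω
      rw [ofReal_measureReal (measure_ne_top _ _), gapMeasure_eq_map hω,
        Measure.map_apply (by fun_prop) hB]
      congr 1
      ext y
      have : X ω ∈ S := hωS
      simp [f, hcX, this]
    · rw [Set.indicator_of_notMem hωS]
      have hh : X ω ∉ S := hωS
      have : (Prod.mk (X ω) ⁻¹' ((fun z => (z.1, f z)) ⁻¹' S ×ˢ B)) = ∅ := by
        ext y; simp [hh]
      rw [this, measure_empty]
  have hΨf : Measurable fun z : (((Fin (d + 1) → ℝ) × (Fin n → Fin (d + 1) × ℝ)) × Fin (d + 1)) × ℝ =>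
      Ψ (z.1, f z) := hΨ.comp (measurable_fst.prodMk hf)
  rw [← lintegral_map hΨ (hX.prodMk hA), hlaw, lintegral_map hΨ (measurable_fst.prodMk hf),
    lintegral_prod _ hΨf.aemeasurable, lintegral_map
    (Measurable.lintegral_prod_right' hΨf) hX]
  refine lintegral_congr_ae ?_
  filter_upwards [hpos] with ω hω
  rw [gapMeasure_eq_map hω, lintegral_map (by fun_prop) (by fun_prop)]
  simp only [f, hcX]
  rfl

/-- Decompose according to the finitely many values of the chosen color and use the conditional
probability of each. -/
lemma IsContinuousUrn.lintegral_index [IsProbabilityMeasure μ] (h : IsContinuousUrn L I A μ)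
    {n : ℕ} {Ψ : ((Fin (d + 1) → ℝ) × (Fin n → Fin (d + 1) × ℝ)) × Fin (d + 1) → ℝ≥0∞}
    (hΨ : Measurable Ψ) :
    ∫⁻ ω, Ψ (past L I A n ω, I n ω) ∂μ =
      ∫⁻ ω, ∑ i, ENNReal.ofReal (proportion L n ω i) * Ψ (past L I A n ω, i) ∂μ := by
  have hX := h.measurable_past n
  have hI := h.measurable_index n
  have hΨi : ∀ i, Measurable fun x => Ψ (x, i) := fun i => by fun_prop
  have hρ : ∀ i, AEMeasurable (fun ω => ENNReal.ofReal (proportion L n ω i)) μ := fun i =>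
    (aemeasurable_of_condExp hX (h.index_cond n i)).ennreal_ofReal
  have hm : ∀ i ∈ Finset.univ, AEMeasurable
      (fun ω => ENNReal.ofReal (proportion L n ω i) * Ψ (past L I A n ω, i)) μ := fun i _ =>
    (hρ i).mul ((hΨi i).comp hX).aemeasurable
  rw [lintegral_finsetSum' _ hm]
  have : ∀ i, ∫⁻ ω, ENNReal.ofReal (proportion L n ω i) * Ψ (past L I A n ω, i) ∂μ =
      ∫⁻ ω, (I n ⁻¹' {i}).indicator (fun ω => Ψ (past L I A n ω, i)) ω ∂μ := fun i => by
    rw [lintegral_indicator (hI (measurableSet_singleton i)),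
      setLIntegral_of_condExp hX (hI (measurableSet_singleton i)) (h.index_cond n i) (hΨi i)]
  simp_rw [this]
  have hm2 : ∀ i ∈ Finset.univ, Measurable
      ((I n ⁻¹' {i}).indicator fun ω => Ψ (past L I A n ω, i)) := fun i _ =>
    ((hΨi i).comp hX).indicator (hI (measurableSet_singleton i))
  rw [← lintegral_finsetSum _ hm2]
  refine lintegral_congr fun ω => ?_
  rw [Finset.sum_eq_single (I n ω)]
  · rw [Set.indicator_of_mem (by simp)]
  · intro i _ hi
    rw [Set.indicator_of_notMem (by simpa using hi.symm)]
  · simp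

/-- The gap laws charge only (0, ∞), so positivity propagates from the initial quantities.
Nonnegativity of the total at step n is what permits integrating out the next addition. -/
lemma IsContinuousUrn.ae_L_pos [IsProbabilityMeasure μ] (h : IsContinuousUrn L I A μ) (n : ℕ) :
    ∀ᵐ ω ∂μ, ∀ i, 0 < L n ω i := by
  induction n with
  | zero => exact h.ae_initial_pos
  | succ n ih =>
    have hpos : ∀ᵐ ω ∂μ, 0 ≤ total L n ω := ih.mono fun ω hω =>
      Finset.sum_nonneg fun i _ => (hω i).le
    have hA : ∀ᵐ ω ∂μ, 0 < A n ω := by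
      have hm : MeasurableSet {ω | 0 < A n ω} :=
        measurableSet_lt measurable_const (h.measurable_addition n)
      have h1 := h.lintegral_addition hpos
        (Ψ := fun z => (Set.Ioi (0 : ℝ))ᶜ.indicator 1 z.2)
        ((measurable_one.indicator measurableSet_Ioi.compl).comp measurable_snd)
      have h2 : ∀ c : ℝ, ∫⁻ a, (Set.Ioi (0 : ℝ))ᶜ.indicator 1 a ∂(gapMeasure c) = 0 := fun c => by
        rw [lintegral_gapMeasure (measurable_one.indicator measurableSet_Ioi.compl),
          setLIntegral_congr_fun (g := fun _ => 0) measurableSet_Ioi, lintegral_zero]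
        intro a ha
        simp only
        rw [Set.indicator_of_notMem (by simpa using ha), mul_zero]
      simp only [h2, lintegral_zero] at h1
      rw [ae_iff, ← Set.compl_ofPred, ← lintegral_indicator_one hm.compl, ← h1]
      rfl
    filter_upwards [ih, hA] with ω hω hAω i
    rw [h.succ_eq]
    by_cases hi : i = I n ω
    · subst hi
      simp only [Function.update_self]
      linarith [hω (I n ω)]
    · rw [Function.update_of_ne hi]
      exact hω i

/-- The law of the urn after `n + 1` steps in terms of its law after `n` steps. -/
lemma IsContinuousUrn.lintegral_trunc_succ [IsProbabilityMeasure μ] (h : IsContinuousUrn L I A μ)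
    (n : ℕ) {H : Path d → ℝ≥0∞} (hH : Measurable H) :
    ∫⁻ ω, H (Path.trunc (n + 1) (pathOf L I A ω)) ∂μ =
      ∫⁻ ω, ∑ i, ENNReal.ofReal (proportion L n ω i) *
        ∫⁻ a, H (Path.set n (Path.trunc n (pathOf L I A ω)) (i, a)) ∂(gapMeasure (total L n ω))
          ∂μ := by
  have hpos : ∀ᵐ ω ∂μ, 0 ≤ total L n ω := (h.ae_L_pos n).mono fun ω hω =>
    Finset.sum_nonneg fun i _ => (hω i).le
  set Ψ : (((Fin (d + 1) → ℝ) × (Fin n → Fin (d + 1) × ℝ)) × Fin (d + 1)) × ℝ → ℝ≥0∞ :=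
    fun z => H (Path.set n (pastPath n z.1.1) (z.1.2, z.2))
  have hΨ : Measurable Ψ := hH.comp ((Path.measurable_set n).comp
    (((measurable_pastPath n).comp (by fun_prop)).prodMk (by fun_prop)))
  have h1 : ∫⁻ ω, H (Path.trunc (n + 1) (pathOf L I A ω)) ∂μ =
      ∫⁻ ω, Ψ ((past L I A n ω, I n ω), A n ω) ∂μ := by
    refine lintegral_congr fun ω => ?_
    rw [Path.trunc_succ, trunc_pathOf]
    rfl
  rw [h1, h.lintegral_addition hpos hΨ]
  set c : ((Fin (d + 1) → ℝ) × (Fin n → Fin (d + 1) × ℝ)) × Fin (d + 1) → ℝ :=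
    fun x => ∑ i, Path.L n (pastPath n x.1) i
  have hc : Measurable c := by
    have : Measurable fun x : ((Fin (d + 1) → ℝ) × (Fin n → Fin (d + 1) × ℝ)) × Fin (d + 1) =>
      Path.L n (pastPath n x.1) :=
      (Path.measurable_L n).comp ((measurable_pastPath n).comp measurable_fst)
    fun_prop
  have hcX : ∀ ω i, c (past L I A n ω, i) = total L n ω := fun ω i => by
    simp only [c, total, h.L_eq_pastPath n ω]
  -- Written with its density, the integral over the addition is a measurable function of history
  -- and color, as needed to integrate out the color next.
  have h2 : ∀ ω i, ∫⁻ a, Ψ ((past L I A n ω, i), a) ∂(gapMeasure (total L n ω)) =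
      ∫⁻ a in Set.Ioi 0, ENNReal.ofReal ((a + c (past L I A n ω, i)) *
        Real.exp (-(1 / 2) * (a + c (past L I A n ω, i)) ^ 2 +
          (1 / 2) * c (past L I A n ω, i) ^ 2)) * Ψ ((past L I A n ω, i), a) := fun ω i => by
    rw [lintegral_gapMeasure (by fun_prop), hcX]
  have h3 := h.lintegral_index (n := n)
      (Ψ := fun x => ∫⁻ a in Set.Ioi 0, ENNReal.ofReal ((a + c x) *
        Real.exp (-(1 / 2) * (a + c x) ^ 2 + (1 / 2) * c x ^ 2)) * Ψ (x, a))
        (Measurable.lintegral_prod_right' (f := fun z : (((Fin (d + 1) → ℝ) ×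
          (Fin n → Fin (d + 1) × ℝ)) × Fin (d + 1)) × ℝ => ENNReal.ofReal ((z.2 + c z.1) *
          Real.exp (-(1 / 2) * (z.2 + c z.1) ^ 2 + (1 / 2) * c z.1 ^ 2)) * Ψ z) (by fun_prop))
  simp_rw [h2]
  rw [h3]
  refine lintegral_congr fun ω => Finset.sum_congr rfl fun i _ => ?_
  rw [← h2, trunc_pathOf]

end Urn

end

section

/-! ### The mixture model -/

/-- Resampling one coordinate of a product measure leaves it invariant. -/
lemma map_update_infinitePi {ι : Type*} [DecidableEq ι] {X : ι → Type*}
    [∀ i, MeasurableSpace (X i)] (ρ : ∀ i, Measure (X i)) [∀ i, IsProbabilityMeasure (ρ i)]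
    (j : ι) :
    ((Measure.infinitePi ρ).prod (ρ j)).map (fun z => Function.update z.1 j z.2) =
      Measure.infinitePi ρ := by
  have hm : Measurable fun z : (∀ i, X i) × X j => Function.update z.1 j z.2 :=
    measurable_update'
  refine Measure.eq_infinitePi _ fun s t ht => ?_
  rw [Measure.map_apply hm (.pi s.countable_toSet fun _ _ => ht _)]
  by_cases hj : j ∈ s
  · have : (fun z : (∀ i, X i) × X j => Function.update z.1 j z.2) ⁻¹' (s : Set ι).pi t =
        ((s.erase j : Finset ι) : Set ι).pi t ×ˢ t j := by
      ext z
      simp only [Set.mem_preimage, Set.mem_pi, Finset.mem_coe, Set.mem_prod, Finset.mem_erase]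
      constructor
      · intro h
        refine ⟨fun k hk => ?_, by simpa using h j hj⟩
        simpa [Function.update_of_ne hk.1] using h k hk.2
      · rintro ⟨h1, h2⟩ k hk
        by_cases hkj : k = j
        · subst hkj; simpa using h2
        · rw [Function.update_of_ne hkj]; exact h1 k ⟨hkj, hk⟩
    rw [this, Measure.prod_prod, Measure.infinitePi_pi _ fun i _ => ht i, mul_comm,
      Finset.mul_prod_erase s (fun i => ρ i (t i)) hj]
  · have : (fun z : (∀ i, X i) × X j => Function.update z.1 j z.2) ⁻¹' (s : Set ι).pi t =
        (s : Set ι).pi t ×ˢ Set.univ := by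
      ext z
      simp only [Set.mem_preimage, Set.mem_pi, Finset.mem_coe, Set.mem_prod, Set.mem_univ, and_true]
      refine forall₂_congr fun k hk => ?_
      have hkj : k ≠ j := by rintro rfl; exact hj hk
      rw [Function.update_of_ne hkj]
    rw [this, Measure.prod_prod, Measure.infinitePi_pi _ fun i _ => ht i, measure_univ, mul_one]

lemma lintegral_update_infinitePi {ι : Type*} [DecidableEq ι] {X : ι → Type*}
    [∀ i, MeasurableSpace (X i)] (ρ : ∀ i, Measure (X i)) [∀ i, IsProbabilityMeasure (ρ i)]
    (j : ι) {F : (∀ i, X i) → ℝ≥0∞} (hF : Measurable F) :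
    ∫⁻ x, F x ∂(Measure.infinitePi ρ) =
      ∫⁻ x, ∫⁻ y, F (Function.update x j y) ∂(ρ j) ∂(Measure.infinitePi ρ) := by
  have hm : Measurable fun z : (∀ i, X i) × X j => Function.update z.1 j z.2 :=
    measurable_update'
  conv_lhs => rw [← map_update_infinitePi ρ j]
  have hFm : Measurable fun z : (∀ i, X i) × X j => F (Function.update z.1 j z.2) := hF.comp hm
  rw [lintegral_map hF hm, lintegral_prod _ hFm.aemeasurable]

variable {d : ℕ}

/-- The set of probability vectors. -/
def probSimplex (d : ℕ) : Set (Fin (d + 1) → ℝ) := {p | (∀ i, 0 ≤ p i) ∧ ∑ i, p i = 1}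

lemma measurableSet_probSimplex : MeasurableSet (probSimplex d) := by
  have h : probSimplex d = (⋂ i, {p : Fin (d + 1) → ℝ | 0 ≤ p i}) ∩ {p | ∑ i, p i = 1} := by
    ext p; simp [probSimplex]
  rw [h]
  exact (MeasurableSet.iInter fun i => measurableSet_le measurable_const
    (measurable_pi_apply i)).inter (measurableSet_eq_fun (by fun_prop) measurable_const)

open scoped Classical in
/-- The law on the colors with probabilities `p`. -/
def categorical (d : ℕ) : Kernel (Fin (d + 1) → ℝ) (Fin (d + 1)) :=
  Kernel.piecewise (s := probSimplex d) measurableSet_probSimplex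
    { toFun := fun p => ∑ i, ENNReal.ofReal (p i) • Measure.dirac i
      measurable' := by
        refine Measure.measurable_of_measurable_coe _ fun s _ => ?_
        simp only [Measure.coe_finsetSum, Finset.sum_apply, Measure.smul_apply, smul_eq_mul]
        fun_prop }
    -- An arbitrary value off the simplex, so that the kernel is Markov everywhere.
    (Kernel.const _ (Measure.dirac 0))

lemma categorical_apply {p : Fin (d + 1) → ℝ} (h0 : ∀ i, 0 ≤ p i) (h1 : ∑ i, p i = 1) :
    categorical d p = ∑ i, ENNReal.ofReal (p i) • Measure.dirac i := by
  have h : p ∈ probSimplex d := ⟨h0, h1⟩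
  classical
  rw [categorical, Kernel.piecewise_apply, if_pos h]
  rfl

instance : IsMarkovKernel (categorical d) := by
  classical
  refine ⟨fun p => ?_⟩
  by_cases h : p ∈ probSimplex d
  · rw [categorical_apply h.1 h.2]
    refine ⟨?_⟩
    simp only [Measure.coe_finsetSum, Finset.sum_apply, Measure.smul_apply, smul_eq_mul,
      measure_univ, mul_one]
    rw [← ENNReal.ofReal_sum_of_nonneg fun i _ => h.1 i, h.2, ENNReal.ofReal_one]
  · rw [categorical, Kernel.piecewise_apply, if_neg h, Kernel.const_apply]
    infer_instance

/-- A color with probabilities `p`, as a function of a uniform variable. -/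
def quantile (d : ℕ) : (Fin (d + 1) → ℝ) → unitInterval → Fin (d + 1) :=
  (Kernel.exists_measurable_map_eq_unitInterval (categorical d)).choose

lemma measurable_quantile {α : Type*} [MeasurableSpace α] {f : α → Fin (d + 1) → ℝ}
    {g : α → unitInterval} (hf : Measurable f) (hg : Measurable g) :
    Measurable fun x => quantile d (f x) (g x) :=
  (Kernel.exists_measurable_map_eq_unitInterval (categorical d)).choose_spec.1.comp (hf.prodMk hg)

lemma map_quantile (p : Fin (d + 1) → ℝ) :
    (volume : Measure unitInterval).map (quantile d p) = categorical d p :=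
  (Kernel.exists_measurable_map_eq_unitInterval (categorical d)).choose_spec.2 p

lemma lintegral_quantile {p : Fin (d + 1) → ℝ} (h0 : ∀ i, 0 ≤ p i) (h1 : ∑ i, p i = 1)
    (F : Fin (d + 1) → ℝ≥0∞) :
    ∫⁻ v, F (quantile d p v) = ∑ i, ENNReal.ofReal (p i) * F i := by
  have hm : Measurable (quantile d p) := measurable_quantile measurable_const measurable_id
  rw [← lintegral_map (μ := volume) (f := F) (by fun_prop) hm, map_quantile,
      categorical_apply h0 h1,
    lintegral_finsetSum_measure]
  simp

/-- The randomness used by the mixture model: uniform variables for the choices, and unit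
exponential variables for the initial quantities and for the additions. -/
abbrev Noise (d : ℕ) : Type := (ℕ → unitInterval) × (Fin (d + 1) ⊕ ℕ → ℝ)

/-- The law of the randomness used by the mixture model. -/
def noiseMeasure (d : ℕ) : Measure (Noise d) :=
  (Measure.infinitePi fun _ : ℕ => (volume : Measure unitInterval)).prod
    (Measure.infinitePi fun _ : Fin (d + 1) ⊕ ℕ => expMeasure 1)

instance : IsProbabilityMeasure (noiseMeasure d) := by
  unfold noiseMeasure; infer_instance

/-- A sample of the mixture model: a vector of proportions and the noise. -/
abbrev Sample (d : ℕ) : Type := (Fin (d + 1) → ℝ) × Noise d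

/-- The chosen colors of the mixture model. -/
def mixI (n : ℕ) (w : Sample d) : Fin (d + 1) := quantile d w.1 (w.2.1 n)

/-- The total of the exponential variables attributed to each color. -/
def mixClock (n : ℕ) (w : Sample d) (i : Fin (d + 1)) : ℝ :=
  w.2.2 (Sum.inl i) + ∑ k ∈ Finset.range n, if mixI k w = i then w.2.2 (Sum.inr k) else 0

/-- The quantities in the mixture model. -/
def mixL (n : ℕ) (w : Sample d) (i : Fin (d + 1)) : ℝ := √(2 * w.1 i * mixClock n w i)

/-- The additions in the mixture model. -/
def mixA (n : ℕ) (w : Sample d) : ℝ := mixL (n + 1) w (mixI n w) - mixL n w (mixI n w)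

lemma measurable_mixI (n : ℕ) : Measurable (mixI (d := d) n) :=
  measurable_quantile (by fun_prop) (by fun_prop)

lemma measurable_mixClock (n : ℕ) (i : Fin (d + 1)) :
    Measurable fun w : Sample d => mixClock n w i := by
  unfold mixClock
  refine Measurable.add (by fun_prop) (Finset.measurable_sum _ fun k _ => ?_)
  exact Measurable.ite (measurable_mixI k (measurableSet_singleton i)) (by fun_prop)
    measurable_const

lemma measurable_mixL (n : ℕ) : Measurable (mixL (d := d) n) := by
  refine measurable_pi_lambda _ fun i => ?_
  have := measurable_mixClock (d := d) n i
  unfold mixL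
  fun_prop

lemma measurable_mixA (n : ℕ) : Measurable (mixA (d := d) n) := by
  have h : ∀ k, Measurable fun w : Sample d => mixL k w (mixI n w) := fun k => by
    have : (fun w : Sample d => mixL k w (mixI n w)) =
        fun w => ∑ i, if mixI n w = i then mixL k w i else 0 := by
      ext w; simp
    rw [this]
    refine Finset.measurable_sum _ fun i _ => ?_
    exact Measurable.ite (measurable_mixI n (measurableSet_singleton i))
      ((measurable_pi_apply i).comp (measurable_mixL k)) measurable_const
  exact (h _).sub (h _)

lemma mixClock_succ (n : ℕ) (w : Sample d) (i : Fin (d + 1)) :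
    mixClock (n + 1) w i = mixClock n w i + if mixI n w = i then w.2.2 (Sum.inr n) else 0 := by
  simp [mixClock, Finset.sum_range_succ, add_assoc]

lemma mixL_succ (n : ℕ) (w : Sample d) : mixL (n + 1) w =
    Function.update (mixL n w) (mixI n w) (mixL n w (mixI n w) + mixA n w) := by
  ext i
  by_cases hi : i = mixI n w
  · subst hi; simp [mixA]
  · rw [Function.update_of_ne hi, mixL, mixClock_succ, if_neg (Ne.symm hi), add_zero, mixL]

/-- The path of the mixture model. -/
def mixPath : Sample d → Path d := pathOf mixL mixI mixA

lemma measurable_mixPath : Measurable (mixPath (d := d)) :=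
  measurable_pathOf (measurable_mixL 0) measurable_mixI measurable_mixA

lemma L_mixPath (n : ℕ) (w : Sample d) : Path.L n (mixPath w) = mixL n w :=
  Path.L_pathOf mixL_succ n w

/-- Replacing the two noise variables of step n + 1 by fresh copies leaves the noise law unchanged.
This is how independence of that step from the earlier ones is used. -/
lemma lintegral_resample (n : ℕ) {F : Noise d → ℝ≥0∞} (hF : Measurable F) :
    ∫⁻ w, F w ∂(noiseMeasure d) = ∫⁻ w, (∫⁻ v, ∫⁻ y, F (Function.update w.1 n v,
      Function.update w.2 (Sum.inr n) y) ∂(expMeasure 1)) ∂(noiseMeasure d) := by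
  have hu : Measurable fun z : (ℕ → unitInterval) × unitInterval => Function.update z.1 n z.2 :=
    measurable_update'
  have he : Measurable fun z : (Fin (d + 1) ⊕ ℕ → ℝ) × ℝ =>
      Function.update z.1 (Sum.inr n) z.2 :=
    measurable_update'
  have hm1 : Measurable fun z : ((ℕ → unitInterval) × (Fin (d + 1) ⊕ ℕ → ℝ)) × unitInterval =>
      ∫⁻ y, F (Function.update z.1.1 n z.2, Function.update z.1.2 (Sum.inr n) y)
          ∂(expMeasure 1) := by
    refine Measurable.lintegral_prod_right' (f := fun q : (((ℕ → unitInterval) ×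
      (Fin (d + 1) ⊕ ℕ → ℝ)) × unitInterval) × ℝ => F (Function.update q.1.1.1 n q.1.2,
        Function.update q.1.1.2 (Sum.inr n) q.2)) ?_
    refine hF.comp (Measurable.prodMk ?_ ?_)
    · exact hu.comp (f := fun q : (((ℕ → unitInterval) ×
        (Fin (d + 1) ⊕ ℕ → ℝ)) × unitInterval) × ℝ => (q.1.1.1, q.1.2)) (by fun_prop)
    · exact he.comp (f := fun q : (((ℕ → unitInterval) ×
        (Fin (d + 1) ⊕ ℕ → ℝ)) × unitInterval) × ℝ => (q.1.1.2, q.2)) (by fun_prop)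
  have hm2 : Measurable fun w : Noise d => ∫⁻ v, ∫⁻ y, F (Function.update w.1 n v,
      Function.update w.2 (Sum.inr n) y) ∂(expMeasure 1) := Measurable.lintegral_prod_right' hm1
  rw [noiseMeasure, lintegral_prod _ hF.aemeasurable, lintegral_prod _ hm2.aemeasurable,
    lintegral_update_infinitePi _ n (Measurable.lintegral_prod_right' hF)]
  refine lintegral_congr fun u => ?_
  symm
  rw [lintegral_lintegral_swap]
  · refine lintegral_congr fun v => ?_
    rw [lintegral_update_infinitePi _ (Sum.inr n)
      (F := fun ε => F (Function.update u n v, ε)) (by fun_prop)]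
  · refine Measurable.aemeasurable ?_
    exact hm1.comp (f := fun z : (Fin (d + 1) ⊕ ℕ → ℝ) × unitInterval => ((u, z.1), z.2))
      (by fun_prop)

lemma ae_noise_pos : ∀ᵐ w ∂(noiseMeasure d), ∀ j, 0 < w.2 j := by
  rw [ae_all_iff]
  intro j
  have h : ∀ᵐ ε ∂(Measure.infinitePi fun _ : Fin (d + 1) ⊕ ℕ => expMeasure 1), 0 < ε j :=
    (measurePreserving_eval_infinitePi (fun _ : Fin (d + 1) ⊕ ℕ => expMeasure 1)
      j).quasiMeasurePreserving.ae ae_expMeasure_pos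
  exact Measure.quasiMeasurePreserving_snd.ae h

lemma mixClock_pos {w : Sample d} (hw : ∀ j, 0 < w.2.2 j) (n : ℕ) (i : Fin (d + 1)) :
    0 < mixClock n w i :=
  add_pos_of_pos_of_nonneg (hw _) (Finset.sum_nonneg fun k _ => by
    split_ifs
    · exact (hw _).le
    · exact le_rfl)

/-- Since l² = 2 p_i × clock_i, advancing the clock by y moves l to √(l² + 2 p_i y). The addition
therefore depends on the past only through l. -/
lemma mixA_eq {w : Sample d} (hp : ∀ i, 0 < w.1 i) (hw : ∀ j, 0 < w.2.2 j) (n : ℕ) :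
    mixA n w = √(mixL n w (mixI n w) ^ 2 + 2 * w.1 (mixI n w) * w.2.2 (Sum.inr n)) -
      mixL n w (mixI n w) := by
  have h1 := hp (mixI n w)
  have h2 := mixClock_pos hw n (mixI n w)
  have e : mixL n w (mixI n w) ^ 2 = 2 * w.1 (mixI n w) * mixClock n w (mixI n w) :=
    Real.sq_sqrt (by positivity)
  rw [mixA, e, mixL, mixClock_succ, if_pos rfl]
  congr 2
  ring

/-- One step of the mixture model. -/
lemma lintegral_mixPath_succ (n : ℕ) {p : Fin (d + 1) → ℝ} (hp : ∀ i, 0 < p i)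
    (hp1 : ∑ i, p i = 1) {F : Path d → ℝ≥0∞} (hF : Measurable F) :
    ∫⁻ w, F (Path.trunc (n + 1) (mixPath (p, w))) ∂(noiseMeasure d) =
      ∫⁻ w, (∑ i, ENNReal.ofReal (p i) * ∫⁻ a in Set.Ioi 0,
        ENNReal.ofReal ((a + Path.L n (Path.trunc n (mixPath (p, w))) i) / p i *
          Real.exp (-(((a + Path.L n (Path.trunc n (mixPath (p, w))) i) ^ 2 -
            Path.L n (Path.trunc n (mixPath (p, w))) i ^ 2) / (2 * p i)))) *
        F (Path.set n (Path.trunc n (mixPath (p, w))) (i, a))) ∂(noiseMeasure d) := by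
  have hmp : Measurable fun w : Noise d => mixPath (p, w) := measurable_mixPath.comp (by fun_prop)
  set G : Path d → unitInterval → ℝ → ℝ≥0∞ := fun z v y =>
    F (Path.set n z (quantile d p v, √(Path.L n z (quantile d p v) ^ 2 +
      2 * p (quantile d p v) * y) - Path.L n z (quantile d p v))) with hG
  have hGm : Measurable fun q : Noise d =>
      G (Path.trunc n (mixPath (p, q))) (q.1 n) (q.2 (Sum.inr n)) := by
    have hz : Measurable fun q : Noise d => Path.trunc n (mixPath (p, q)) :=
      (Path.measurable_trunc n).comp hmp
    have hq : Measurable fun q : Noise d => quantile d p (q.1 n) :=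
      measurable_quantile measurable_const (by fun_prop)
    have hl : Measurable fun q : Noise d =>
        Path.L n (Path.trunc n (mixPath (p, q))) (quantile d p (q.1 n)) := by
      have : (fun q : Noise d => Path.L n (Path.trunc n (mixPath (p, q))) (quantile d p (q.1 n))) =
          fun q => ∑ i, if quantile d p (q.1 n) = i then
            Path.L n (Path.trunc n (mixPath (p, q))) i else 0 := by
        ext q; simp
      rw [this]
      refine Finset.measurable_sum _ fun i _ => ?_
      exact Measurable.ite (hq (measurableSet_singleton i))
        ((measurable_pi_apply i).comp ((Path.measurable_L n).comp hz)) measurable_const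
    have hpq : Measurable fun q : Noise d => p (quantile d p (q.1 n)) :=
      (measurable_of_countable p).comp hq
    exact hF.comp ((Path.measurable_set n).comp (hz.prodMk (hq.prodMk (by fun_prop))))
  have h1 : ∫⁻ w, F (Path.trunc (n + 1) (mixPath (p, w))) ∂(noiseMeasure d) =
      ∫⁻ w, G (Path.trunc n (mixPath (p, w))) (w.1 n) (w.2 (Sum.inr n)) ∂(noiseMeasure d) := by
    refine lintegral_congr_ae ?_
    filter_upwards [ae_noise_pos] with w hw
    simp only [hG]
    rw [Path.trunc_succ, Path.L_trunc, L_mixPath]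
    have : (mixPath (p, w)).2 n = (mixI n (p, w), mixA n (p, w)) := rfl
    rw [this, mixA_eq hp hw]
    rfl
  rw [h1, lintegral_resample n hGm]
  refine lintegral_congr_ae ?_
  filter_upwards [ae_noise_pos] with w hw
  -- The first n steps do not see the noise variables of step n + 1, so resampling these leaves the
  -- truncated path fixed.
  have htr : ∀ v y, Path.trunc n (mixPath (p, (Function.update w.1 n v,
      Function.update w.2 (Sum.inr n) y))) = Path.trunc n (mixPath (p, w)) := by
    intro v y
    have hI : ∀ k < n, mixI k (p, (Function.update w.1 n v,
        Function.update w.2 (Sum.inr n) y)) = mixI k (p, w) := fun k hk => by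
      simp [mixI, Function.update_of_ne hk.ne]
    have hC : ∀ k ≤ n, mixL k (p, (Function.update w.1 n v,
        Function.update w.2 (Sum.inr n) y)) = mixL k (p, w) := fun k hk => by
      ext i
      simp only [mixL, mixClock]
      congr 3
      refine Finset.sum_congr rfl fun j hj => ?_
      have hjn : j < n := (Finset.mem_range.1 hj).trans_le hk
      rw [hI j hjn]
      simp [Function.update_of_ne (fun h => hjn.ne (Sum.inr_injective h))]
    refine Prod.ext (hC 0 (Nat.zero_le _)) (funext fun k => ?_)
    by_cases hk : k < n
    · simp only [Path.trunc, hk, if_true, mixPath, pathOf, mixA]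
      rw [hI k hk, hC k hk.le, hC (k + 1) hk]
    · simp [Path.trunc, hk]
  simp only [htr, Function.update_self]
  have hl : ∀ i, 0 ≤ Path.L n (Path.trunc n (mixPath (p, w))) i := fun i => by
    rw [Path.L_trunc, L_mixPath]; exact Real.sqrt_nonneg _
  generalize Path.trunc n (mixPath (p, w)) = z at *
  have hi : ∀ i, ∫⁻ y, F (Path.set n z (i, √(Path.L n z i ^ 2 + 2 * p i * y) - Path.L n z i))
      ∂(expMeasure 1) = ∫⁻ a in Set.Ioi 0, ENNReal.ofReal ((a + Path.L n z i) / p i *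
          Real.exp (-(((a + Path.L n z i) ^ 2 - Path.L n z i ^ 2) / (2 * p i)))) *
        F (Path.set n z (i, a)) := fun i =>
    lintegral_expMeasure_sqrt_sub (hp i) (hl i)
      (F := fun a => F (Path.set n z (i, a)))
      (hF.comp ((Path.measurable_set n).comp
        (measurable_const.prodMk (measurable_const.prodMk measurable_id))))
  rw [lintegral_quantile (fun i => (hp i).le) hp1 (fun i => ∫⁻ y, F (Path.set n z
    (i, √(Path.L n z i ^ 2 + 2 * p i * y) - Path.L n z i)) ∂(expMeasure 1))]
  simp_rw [hi]

/-- At time 0 the clocks are independent unit exponentials, so the quantities √(2 p_i ε_i) are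
independent Rayleigh variables. -/
lemma lintegral_mixPath_zero {p : Fin (d + 1) → ℝ} (hp : ∀ i, 0 < p i)
    {F : (Fin (d + 1) → ℝ) → ℝ≥0∞} (hF : Measurable F) :
    ∫⁻ w, F (mixL 0 (p, w)) ∂(noiseMeasure d) =
      ∫⁻ l, ({l : Fin (d + 1) → ℝ | ∀ i, 0 < l i}.indicator (fun l => ∏ i, ENNReal.ofReal
        (l i / p i * Real.exp (-(l i ^ 2 / (2 * p i))))) l) * F l := by
  set f : Fin (d + 1) → ℝ → ℝ≥0∞ := fun i => (Set.Ioi 0).indicator fun a =>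
    ENNReal.ofReal (a / p i * Real.exp (-(a ^ 2 / (2 * p i)))) with hfdef
  have hf : ∀ i, Measurable (f i) := fun i => Measurable.indicator (by fun_prop) measurableSet_Ioi
  have h1 : ∀ i, (expMeasure 1).map (fun y => √(2 * p i * y)) = volume.withDensity (f i) := by
    intro i
    refine Measure.ext_of_lintegral _ fun H hH => ?_
    have := lintegral_expMeasure_sqrt_sub (hp i) le_rfl hH
    simp only [ne_eq, OfNat.ofNat_ne_zero, not_false_eq_true, zero_pow, zero_add, sub_zero,
      add_zero] at this
    rw [lintegral_map hH (by fun_prop), this, lintegral_withDensity_eq_lintegral_mul _ (hf i) hH,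
      ← lintegral_indicator measurableSet_Ioi]
    refine lintegral_congr fun a => ?_
    by_cases ha : a ∈ Set.Ioi (0 : ℝ)
    · simp [hfdef, Set.indicator_of_mem ha]
    · simp [hfdef, Set.indicator_of_notMem ha]
  have hprob : ∀ i, IsProbabilityMeasure ((volume : Measure ℝ).withDensity (f i)) := fun i => by
    rw [← h1 i]; exact Measure.isProbabilityMeasure_map (by fun_prop)
  have h2 : (noiseMeasure d).map (fun w => mixL 0 (p, w)) =
      (volume : Measure (Fin (d + 1) → ℝ)).withDensity fun x => ∏ i, f i (x i) := by
    have e1 : (fun w : Noise d => mixL 0 (p, w)) =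
        (fun y : Fin (d + 1) → ℝ => fun i => √(2 * p i * y i)) ∘
          (fun ε : Fin (d + 1) ⊕ ℕ → ℝ => fun i => ε (Sum.inl i)) ∘ Prod.snd := by
      ext w i
      simp [mixL, mixClock]
    rw [e1, ← Measure.map_map (by fun_prop) (by fun_prop), ← Measure.map_map (by fun_prop)
      (by fun_prop), noiseMeasure, Measure.map_snd_prod, measure_univ, one_smul,
      -- Only the finitely many initial exponentials matter, so the infinite product reduces to a
      -- finite one, which has a product density.
      Measure.map_infinitePi_infinitePi_of_inj Sum.inl_injective,
      Measure.infinitePi_map_pi _ (f := fun i y => √(2 * p i * y)) (fun i => by fun_prop)]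
    simp_rw [h1]
    rw [Measure.infinitePi_eq_pi, pi_withDensity hf]
  have hm : Measurable fun w : Noise d => mixL 0 (p, w) := (measurable_mixL 0).comp (by fun_prop)
  have hfm : Measurable fun x : Fin (d + 1) → ℝ => ∏ i, f i (x i) :=
    Finset.measurable_prod _ fun i _ => (hf i).comp (measurable_pi_apply i)
  rw [← lintegral_map hF hm, h2, lintegral_withDensity_eq_lintegral_mul _ hfm hF]
  refine lintegral_congr fun l => ?_
  rw [Pi.mul_apply]
  congr 1
  by_cases hl : ∀ i, 0 < l i
  · rw [Set.indicator_of_mem (by exact hl)]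
    refine Finset.prod_congr rfl fun i _ => ?_
    simp only [hfdef]
    rw [Set.indicator_of_mem (Set.mem_Ioi.2 (hl i))]
  · rw [Set.indicator_of_notMem (by exact hl)]
    push Not at hl
    obtain ⟨i, hi⟩ := hl
    refine Finset.prod_eq_zero (Finset.mem_univ i) ?_
    simp only [hfdef]
    rw [Set.indicator_of_notMem (by simpa using hi)]

end

section

/-! ### The law of the urn is the law of the mixture model -/

variable {d : ℕ}

/-- Bayes' rule for one step. Both sides are joint densities of the choice of color i, an addition a
and p: on the left p comes from the current posterior and the step from the mixture, on the right
the step comes from the urn and p from the updated posterior. Since h(l + a, p) / h(l, p) = ((l + a)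
/ l) exp(−((l + a)² − l²) / (2p)), the factor of color i turns the mixture transition into l_i, and
the normalizing factor, at level C and time 1, supplies 1 / C and the gap density. -/
lemma posteriorDensity_update {l p : Fin (d + 1) → ℝ} (hl : ∀ j, 0 < l j) (i : Fin (d + 1))
    {a : ℝ} (ha : 0 < a) :
    ENNReal.ofReal (p i) * ENNReal.ofReal ((a + l i) / p i *
      Real.exp (-(((a + l i) ^ 2 - l i ^ 2) / (2 * p i)))) * posteriorDensity l p =
    ENNReal.ofReal (l i / ∑ j, l j) * ENNReal.ofReal ((a + ∑ j, l j) *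
      Real.exp (-(1 / 2) * (a + ∑ j, l j) ^ 2 + (1 / 2) * (∑ j, l j) ^ 2)) *
      posteriorDensity (Function.update l i (l i + a)) p := by
  have hC : 0 < ∑ j, l j := Finset.sum_pos (fun i _ => hl i) (by simp)
  set C := ∑ j, l j with hCdef
  have hli := hl i
  have hsum : ∑ j, Function.update l i (l i + a) j = a + C := by
    rw [Finset.sum_update_of_mem (Finset.mem_univ i), hCdef,
      ← Finset.add_sum_erase _ _ (Finset.mem_univ i), Finset.sdiff_singleton_eq_erase]
    ring
  have hprod : ∏ j, hittingDensity (Function.update l i (l i + a) j) (p j) =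
      hittingDensity (l i + a) (p i) * ∏ j ∈ Finset.univ.erase i, hittingDensity (l j) (p j) := by
    rw [← Finset.mul_prod_erase _ _ (Finset.mem_univ i), Function.update_self]
    congr 1
    refine Finset.prod_congr rfl fun j hj => ?_
    rw [Function.update_of_ne (Finset.ne_of_mem_erase hj)]
  rw [posteriorDensity, posteriorDensity, hsum, hprod, ← hCdef,
    ← Finset.mul_prod_erase _ (fun j => hittingDensity (l j) (p j)) (Finset.mem_univ i)]
  set R := ∏ j ∈ Finset.univ.erase i, hittingDensity (l j) (p j)
  rcases le_or_gt (p i) 0 with hp | hp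
  · simp [hittingDensity_of_nonpos hp]
  have hR : 0 ≤ R := Finset.prod_nonneg fun j _ => hittingDensity_nonneg (hl j).le _
  have hg1 : 0 < hittingDensity C 1 := hittingDensity_pos hC one_pos
  have hg2 : 0 < hittingDensity (a + C) 1 := hittingDensity_pos (by positivity) one_pos
  have hg3 := hittingDensity_nonneg hli.le (p i)
  rw [← ENNReal.ofReal_mul hp.le, ← ENNReal.ofReal_mul (by positivity),
    ← ENNReal.ofReal_mul (by positivity), ← ENNReal.ofReal_mul (by positivity)]
  congr 1
  rw [hittingDensity_of_pos hp, hittingDensity_of_pos hp, hittingDensity_of_pos one_pos,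
    hittingDensity_of_pos one_pos]
  have e1 : Real.exp (-((l i + a) ^ 2 / (2 * p i))) =
      Real.exp (-(((a + l i) ^ 2 - l i ^ 2) / (2 * p i))) * Real.exp (-(l i ^ 2 / (2 * p i))) := by
    rw [← Real.exp_add]; congr 1; field_simp; ring
  have e2 : Real.exp (-(C ^ 2 / (2 * 1))) * Real.exp (-(1 / 2) * (a + C) ^ 2 + (1 / 2) * C ^ 2) =
      Real.exp (-((a + C) ^ 2 / (2 * 1))) := by
    rw [← Real.exp_add]; congr 1; ring
  rw [e1, ← e2]
  have h1 := Real.exp_pos (-(C ^ 2 / (2 * 1)))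
  have h2 := Real.exp_pos (-(1 / 2) * (a + C) ^ 2 + (1 / 2) * C ^ 2)
  have h3 : 0 < √(2 * Real.pi) := by positivity
  have h4 : 0 < √(p i) := Real.sqrt_pos.2 hp
  have h5 : 0 < a + C := by positivity
  generalize Real.exp (-(C ^ 2 / (2 * 1))) = E1 at *
  generalize Real.exp (-(1 / 2) * (a + C) ^ 2 + (1 / 2) * C ^ 2) = E2 at *
  generalize Real.exp (-(((a + l i) ^ 2 - l i ^ 2) / (2 * p i))) = E3 at *
  generalize Real.exp (-(l i ^ 2 / (2 * p i))) = E4 at *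
  simp only [Real.sqrt_one, mul_one, div_one]
  field_simp
  ring

section Urn

variable {Ω : Type*} [MeasurableSpace Ω] {μ : Measure Ω} [IsProbabilityMeasure μ]
  {L : ℕ → Ω → Fin (d + 1) → ℝ} {I : ℕ → Ω → Fin (d + 1)} {A : ℕ → Ω → ℝ}

/-- Tonelli exchanges the integrals over p and l, and `dirichlet_mul_rayleigh` identifies the joint
densities pointwise. -/
lemma IsContinuousUrn.lintegral_mixture_zero (h : IsContinuousUrn L I A μ)
    {F : (Fin (d + 1) → ℝ) × (Fin (d + 1) → ℝ) → ℝ≥0∞} (hF : Measurable F) :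
    ∫⁻ p, ∫⁻ w, F (mixL 0 (p, w), p) ∂(noiseMeasure d) ∂(dirichletMeasure fun _ => 1 / 2) =
      ∫⁻ ω, (∫⁻ x, F (L 0 ω, simplexPoint x) * posteriorDensity (L 0 ω) (simplexPoint x)) ∂μ := by
  set r : (Fin (d + 1) → ℝ) × (Fin (d + 1) → ℝ) → ℝ≥0∞ := fun z =>
    {l : Fin (d + 1) → ℝ | ∀ i, 0 < l i}.indicator (fun l => ∏ i, ENNReal.ofReal
        (l i / z.2 i * Real.exp (-(l i ^ 2 / (2 * z.2 i))))) z.1 with hrdef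
  have hr : Measurable r := by
    have : r = ((Prod.fst ⁻¹' {l : Fin (d + 1) → ℝ | ∀ i, 0 < l i}).indicator
        fun z : (Fin (d + 1) → ℝ) × (Fin (d + 1) → ℝ) => ∏ i,
            ENNReal.ofReal (z.1 i / z.2 i * Real.exp (-(z.1 i ^ 2 / (2 * z.2 i))))) := by
      ext z; simp [hrdef, Set.indicator]
    rw [this]
    exact Measurable.indicator (by fun_prop) (measurable_fst measurableSet_pos)
  have h1 : ∫⁻ p, ∫⁻ w, F (mixL 0 (p, w), p) ∂(noiseMeasure d) ∂(dirichletMeasure fun _ => 1 / 2) =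
      ∫⁻ p, (∫⁻ l, r (l, p) * F (l, p)) ∂(dirichletMeasure fun _ => 1 / 2) := by
    refine lintegral_congr_ae ?_
    filter_upwards [ae_dirichletMeasure_pos fun _ : Fin (d + 1) => (1 / 2 : ℝ)] with p hp
    exact lintegral_mixPath_zero hp.1 (F := fun l => F (l, p)) (by fun_prop)
  set D : (Fin (d + 1) → ℝ) → ℝ≥0∞ := {p : Fin (d + 1) → ℝ | ∀ j, 0 < p j}.indicator
    (fun p => ENNReal.ofReal (Real.Gamma (∑ _j : Fin (d + 1), (1 / 2 : ℝ)) /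
      (∏ _j : Fin (d + 1), Real.Gamma (1 / 2)) * ∏ j, p j ^ ((1 / 2 : ℝ) - 1))) with hD
  have hDm : Measurable D := Measurable.indicator (by fun_prop) measurableSet_pos
  have hGm : Measurable fun l : Fin (d + 1) → ℝ =>
      ∫⁻ x, F (l, simplexPoint x) * posteriorDensity l (simplexPoint x) := by
    refine Measurable.lintegral_prod_right' (f := fun z : (Fin (d + 1) → ℝ) × (Fin d → ℝ) =>
      F (z.1, simplexPoint z.2) * posteriorDensity z.1 (simplexPoint z.2)) ?_
    exact Measurable.mul (by fun_prop) (measurable_posteriorDensity measurable_fst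
      (measurable_simplexPoint.comp measurable_snd))
  rw [h1, lintegral_dirichletMeasure (Measurable.lintegral_prod_left' (f := fun z => r z * F z)
    (by fun_prop)), h.lintegral_initial hGm]
  have h2 : ∀ x : Fin d → ℝ, D (simplexPoint x) * ∫⁻ l, r (l, simplexPoint x) *
      F (l, simplexPoint x) = ∫⁻ l, D (simplexPoint x) * (r (l, simplexPoint x) *
      F (l, simplexPoint x)) := fun x => by
    rw [lintegral_const_mul _ (by fun_prop)]
  simp_rw [← hD, h2]
  rw [lintegral_lintegral_swap (Measurable.aemeasurable (by fun_prop))]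
  refine lintegral_congr fun l => ?_
  have hpl : Measurable fun x : Fin d → ℝ => posteriorDensity l (simplexPoint x) :=
    measurable_posteriorDensity measurable_const measurable_simplexPoint
  rw [← lintegral_const_mul _ (by fun_prop)]
  refine lintegral_congr fun x => ?_
  by_cases hl : ∀ i, 0 < l i
  · have := dirichlet_mul_rayleigh (p := simplexPoint x) hl
    rw [← hD] at this
    simp only [hrdef]
    rw [Set.indicator_of_mem (by exact hl), ← mul_assoc, this, mul_assoc, mul_comm (F _)]
  · rw [initialDensity, Set.indicator_of_notMem (by exact hl)]
    simp only [hrdef]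
    rw [Set.indicator_of_notMem (by exact hl)]
    simp

/-- Conditionally on the first `n` steps, the vector of proportions of the mixture model has the
posterior density. -/
lemma IsContinuousUrn.lintegral_mixture (h : IsContinuousUrn L I A μ) (n : ℕ)
    {F : Path d × (Fin (d + 1) → ℝ) → ℝ≥0∞} (hF : Measurable F) :
    ∫⁻ p, ∫⁻ w, F (Path.trunc n (mixPath (p, w)), p) ∂(noiseMeasure d)
        ∂(dirichletMeasure fun _ => 1 / 2) =
      ∫⁻ ω, (∫⁻ x, F (Path.trunc n (pathOf L I A ω), simplexPoint x) *
        posteriorDensity (L n ω) (simplexPoint x)) ∂μ := by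
  induction n generalizing F with
  | zero =>
    have := h.lintegral_mixture_zero (F := fun z => F ((z.1, fun _ => (0, 0)), z.2)) (by fun_prop)
    simpa [Path.trunc, mixPath, pathOf] using this
  | succ n ih =>
    -- The result of integrating out step n + 1 of the mixture, given the truncated path and p. The
    -- induction hypothesis is applied to it.
    set G : Path d × (Fin (d + 1) → ℝ) → ℝ≥0∞ := fun z => ∑ i, ENNReal.ofReal (z.2 i) *
      ∫⁻ a in Set.Ioi 0, ENNReal.ofReal ((a + Path.L n z.1 i) / z.2 i *
        Real.exp (-(((a + Path.L n z.1 i) ^ 2 - Path.L n z.1 i ^ 2) / (2 * z.2 i)))) *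
        F (Path.set n z.1 (i, a), z.2) with hGdef
    have hLi : ∀ i, Measurable fun z : Path d => Path.L n z i := fun i =>
      (measurable_pi_apply i).comp (Path.measurable_L n)
    have hset : ∀ i, Measurable fun q : (Path d × (Fin (d + 1) → ℝ)) × ℝ =>
        F (Path.set n q.1.1 (i, q.2), q.1.2) := fun i =>
      hF.comp (((Path.measurable_set n).comp (measurable_fst.fst.prodMk
        (measurable_const.prodMk measurable_snd))).prodMk measurable_fst.snd)
    have hLq : ∀ i, Measurable fun q : (Path d × (Fin (d + 1) → ℝ)) × ℝ => Path.L n q.1.1 i :=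
      fun i => (hLi i).comp measurable_fst.fst
    have hker : ∀ i, Measurable fun q : (Path d × (Fin (d + 1) → ℝ)) × ℝ =>
        ENNReal.ofReal ((q.2 + Path.L n q.1.1 i) / q.1.2 i * Real.exp (-(((q.2 +
          Path.L n q.1.1 i) ^ 2 - Path.L n q.1.1 i ^ 2) / (2 * q.1.2 i)))) *
          F (Path.set n q.1.1 (i, q.2), q.1.2) := fun i => by
      have := hLq i
      exact Measurable.mul (by fun_prop) (hset i)
    have hG : Measurable G := by
      refine Finset.measurable_sum _ fun i _ => Measurable.mul (by fun_prop) ?_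
      exact Measurable.lintegral_prod_right' (hker i)
    have hl : ∫⁻ p, ∫⁻ w, F (Path.trunc (n + 1) (mixPath (p, w)), p) ∂(noiseMeasure d)
        ∂(dirichletMeasure fun _ => 1 / 2) =
        ∫⁻ p, ∫⁻ w, G (Path.trunc n (mixPath (p, w)), p) ∂(noiseMeasure d)
        ∂(dirichletMeasure fun _ => 1 / 2) := by
      refine lintegral_congr_ae ?_
      filter_upwards [ae_dirichletMeasure_pos fun _ : Fin (d + 1) => (1 / 2 : ℝ)] with p hp
      exact lintegral_mixPath_succ n hp.1 hp.2 (F := fun z => F (z, p)) (by fun_prop)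
    set H : Path d → ℝ≥0∞ := fun z =>
      ∫⁻ x, F (z, simplexPoint x) * posteriorDensity (Path.L (n + 1) z) (simplexPoint x) with hHdef
    have hHint : Measurable fun q : Path d × (Fin d → ℝ) =>
        F (q.1, simplexPoint q.2) * posteriorDensity (Path.L (n + 1) q.1) (simplexPoint q.2) :=
      Measurable.mul (by fun_prop) (measurable_posteriorDensity
        ((Path.measurable_L (n + 1)).comp measurable_fst)
        (measurable_simplexPoint.comp measurable_snd))
    have hH : Measurable H := Measurable.lintegral_prod_right' hHint
    have hr : ∫⁻ ω, (∫⁻ x, F (Path.trunc (n + 1) (pathOf L I A ω), simplexPoint x) *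
        posteriorDensity (L (n + 1) ω) (simplexPoint x)) ∂μ =
        ∫⁻ ω, H (Path.trunc (n + 1) (pathOf L I A ω)) ∂μ := by
      refine lintegral_congr fun ω => ?_
      rw [hHdef]
      simp only [Path.L_trunc, Path.L_pathOf h.succ_eq]
    rw [hl, ih hG, hr, h.lintegral_trunc_succ n hH]
    refine lintegral_congr_ae ?_
    filter_upwards [h.ae_L_pos n] with ω hω
    have hz : Path.L n (Path.trunc n (pathOf L I A ω)) = L n ω := by
      rw [Path.L_trunc, Path.L_pathOf h.succ_eq]
    simp only [proportion, total]
    generalize Path.trunc n (pathOf L I A ω) = z at *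
    rw [← hz] at hω ⊢
    set l := Path.L n z
    have hK : ∀ i, Measurable fun q : (Fin d → ℝ) × ℝ =>
        ENNReal.ofReal ((q.2 + l i) / simplexPoint q.1 i * Real.exp (-(((q.2 +
          l i) ^ 2 - l i ^ 2) / (2 * simplexPoint q.1 i)))) *
          F (Path.set n z (i, q.2), simplexPoint q.1) := fun i =>
      (hker i).comp (f := fun q : (Fin d → ℝ) × ℝ => ((z, simplexPoint q.1), q.2)) (by fun_prop)
    have hpl : Measurable fun x : Fin d → ℝ => posteriorDensity l (simplexPoint x) :=
      measurable_posteriorDensity measurable_const measurable_simplexPoint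
    have e1 : ∀ x : Fin d → ℝ, G (z, simplexPoint x) * posteriorDensity l (simplexPoint x) =
        ∑ i, ∫⁻ a in Set.Ioi 0, ENNReal.ofReal (simplexPoint x i) *
          (ENNReal.ofReal ((a + l i) / simplexPoint x i *
          Real.exp (-(((a + l i) ^ 2 - l i ^ 2) / (2 * simplexPoint x i)))) *
          F (Path.set n z (i, a), simplexPoint x)) * posteriorDensity l (simplexPoint x) := by
      intro x
      rw [hGdef, Finset.sum_mul]
      refine Finset.sum_congr rfl fun i _ => ?_
      have hKi : Measurable fun a : ℝ => ENNReal.ofReal ((a + l i) / simplexPoint x i *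
          Real.exp (-(((a + l i) ^ 2 - l i ^ 2) / (2 * simplexPoint x i)))) *
          F (Path.set n z (i, a), simplexPoint x)
              := (hK i).comp (measurable_const.prodMk measurable_id)
      rw [lintegral_mul_const _ (by fun_prop), lintegral_const_mul _ hKi]
    simp_rw [e1]
    have hxi : ∀ i, Measurable fun x : Fin d → ℝ => simplexPoint x i := fun i => by fun_prop
    have hbig : ∀ i, Measurable fun q : (Fin d → ℝ) × ℝ => ENNReal.ofReal (simplexPoint q.1 i) *
          (ENNReal.ofReal ((q.2 + l i) / simplexPoint q.1 i *
          Real.exp (-(((q.2 + l i) ^ 2 - l i ^ 2) / (2 * simplexPoint q.1 i)))) *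
          F (Path.set n z (i, q.2), simplexPoint q.1)) *
          posteriorDensity l (simplexPoint q.1) := fun i =>
      ((((hxi i).comp measurable_fst).ennreal_ofReal).mul (hK i)).mul (hpl.comp measurable_fst)
    rw [lintegral_finsetSum _ fun i _ => Measurable.lintegral_prod_right' (hbig i)]
    refine Finset.sum_congr rfl fun i _ => ?_
    have hHs : ∀ a, Measurable fun x : Fin d → ℝ => F (Path.set n z (i, a), simplexPoint x) *
        posteriorDensity (Path.L (n + 1) (Path.set n z (i, a))) (simplexPoint x) := fun a =>
      hHint.comp (measurable_const.prodMk measurable_id)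
    have hHm : Measurable fun a => H (Path.set n z (i, a)) :=
      hH.comp ((Path.measurable_set n).comp
        (measurable_const.prodMk (measurable_const.prodMk measurable_id)))
    have hgm : Measurable fun a => ENNReal.ofReal ((a + ∑ i, l i) *
        Real.exp (-(1 / 2) * (a + ∑ i, l i) ^ 2 + 1 / 2 * (∑ i, l i) ^ 2)) *
        H (Path.set n z (i, a)) := Measurable.mul (by fun_prop) hHm
    rw [lintegral_lintegral_swap (hbig i).aemeasurable, lintegral_gapMeasure hHm,
      ← lintegral_const_mul _ hgm]
    refine setLIntegral_congr_fun measurableSet_Ioi fun a ha => ?_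
    simp only [hHdef]
    rw [← lintegral_const_mul _ (hHs a), ← lintegral_const_mul _ ((hHs a).const_mul _)]
    refine lintegral_congr fun x => ?_
    rw [Path.L_succ_set]
    -- After the exchange of integrals the two sides agree for each color, each addition and each p.
    have := posteriorDensity_update (p := simplexPoint x) hω i ha
    calc _ = (ENNReal.ofReal (simplexPoint x i) * ENNReal.ofReal ((a + l i) / simplexPoint x i *
          Real.exp (-(((a + l i) ^ 2 - l i ^ 2) / (2 * simplexPoint x i)))) *
          posteriorDensity l (simplexPoint x)) * F (Path.set n z (i, a), simplexPoint x) := by ring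
      _ = _ := by rw [this]; ring

/-- The posterior has mass 1, so p integrates out. -/
lemma IsContinuousUrn.lintegral_trunc (h : IsContinuousUrn L I A μ) (n : ℕ)
    {F : Path d → ℝ≥0∞} (hF : Measurable F) :
    ∫⁻ p, ∫⁻ w, F (Path.trunc n (mixPath (p, w))) ∂(noiseMeasure d)
        ∂(dirichletMeasure fun _ => 1 / 2) = ∫⁻ ω, F (Path.trunc n (pathOf L I A ω)) ∂μ := by
  rw [h.lintegral_mixture n (F := fun z => F z.1) (by fun_prop)]
  refine lintegral_congr_ae ?_
  filter_upwards [h.ae_L_pos n] with ω hω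
  rw [lintegral_const_mul _ (measurable_posteriorDensity measurable_const
    measurable_simplexPoint), lintegral_posteriorDensity hω, mul_one]

/-- No Dirichlet integral is computed: the mass of the prior equals that of `μ`, by the matching of
the two models with a constant test function. -/
lemma IsContinuousUrn.isProbabilityMeasure_dirichlet (h : IsContinuousUrn L I A μ) :
    IsProbabilityMeasure (dirichletMeasure (d := d) fun _ => 1 / 2) := by
  have := h.lintegral_trunc 0 (F := fun _ => 1) measurable_const
  simp only [lintegral_const, measure_univ, mul_one, one_mul] at this
  exact ⟨this⟩

/-- The law of the mixture model. -/
def mixMeasure (d : ℕ) : Measure (Sample d) :=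
  (dirichletMeasure fun _ => 1 / 2).prod (noiseMeasure d)

lemma Path.tendsto_trunc (z : Path d) : Tendsto (fun n => Path.trunc n z) atTop (𝓝 z) := by
  refine Tendsto.prodMk_nhds tendsto_const_nhds (tendsto_pi_nhds.2 fun k => ?_)
  refine tendsto_const_nhds.congr' ?_
  filter_upwards [eventually_gt_atTop k] with n hn
  simp [hn]

lemma tendsto_lintegral_trunc {Ω' : Type*} [MeasurableSpace Ω'] (ρ : Measure Ω')
    [IsProbabilityMeasure ρ] (f : BoundedContinuousFunction (Path d) NNReal) {g : Ω' → Path d}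
    (hg : Measurable g) :
    Tendsto (fun n => ∫⁻ ω, f (Path.trunc n (g ω)) ∂ρ) atTop (𝓝 (∫⁻ ω, f (g ω) ∂ρ)) := by
  have hf : Measurable fun z => (f z : ℝ≥0∞) := f.continuous.measurable.coe_nnreal_ennreal
  refine tendsto_lintegral_of_dominated_convergence (fun _ => (nndist f 0 : ℝ≥0∞))
    (fun n => hf.comp ((Path.measurable_trunc n).comp hg)) (fun n => ae_of_all _ fun ω => ?_)
    (by simp) (ae_of_all _ fun ω => ?_)
  · exact ENNReal.coe_le_coe.2 (BoundedContinuousFunction.NNReal.upper_bound f _)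
  · exact (ENNReal.continuous_coe.comp f.continuous).continuousAt.tendsto.comp
      (Path.tendsto_trunc (g ω))

/-- Truncated paths have equal laws and converge pointwise to the full paths, while bounded
continuous functions determine a finite measure. -/
lemma IsContinuousUrn.map_pathOf (h : IsContinuousUrn L I A μ) :
    μ.map (pathOf L I A) = (mixMeasure d).map mixPath := by
  have hdir := h.isProbabilityMeasure_dirichlet
  have : IsProbabilityMeasure (mixMeasure d) := by unfold mixMeasure; infer_instance
  have hm1 := h.measurable_pathOf
  have hm2 := measurable_mixPath (d := d)
  have : IsFiniteMeasure (μ.map (pathOf L I A)) := Measure.isFiniteMeasure_map _ _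
  refine ext_of_forall_lintegral_eq_of_IsFiniteMeasure fun f => ?_
  have hf : Measurable fun z => (f z : ℝ≥0∞) := f.continuous.measurable.coe_nnreal_ennreal
  rw [lintegral_map hf hm1, lintegral_map hf hm2]
  refine tendsto_nhds_unique (tendsto_lintegral_trunc μ f hm1)
      ((tendsto_lintegral_trunc (mixMeasure d) f hm2).congr fun n => ?_)
  have hfm : Measurable fun w : Sample d => (f (Path.trunc n (mixPath w)) : ℝ≥0∞) :=
    hf.comp ((Path.measurable_trunc n).comp hm2)
  rw [mixMeasure, lintegral_prod _ hfm.aemeasurable]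
  exact h.lintegral_trunc n hf

end Urn

end

section

/-! ### Sums of independent exponential variables -/

lemma lintegral_id_expMeasure : ∫⁻ y, ENNReal.ofReal y ∂(expMeasure 1) = 1 := by
  rw [lintegral_expMeasure_one (by fun_prop)]
  have h := Real.Gamma_eq_integral (s := 2) (by norm_num)
  have hi := Real.GammaIntegral_convergent (s := 2) (by norm_num)
  rw [Real.Gamma_two] at h
  rw [← ENNReal.ofReal_one, h, ofReal_integral_eq_lintegral_ofReal hi]
  · refine setLIntegral_congr_fun measurableSet_Ioi fun y hy => ?_
    rw [← ENNReal.ofReal_mul (Real.exp_pos _).le]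
    norm_num
  · refine (ae_restrict_iff' measurableSet_Ioi).2 (ae_of_all _ fun y hy => ?_)
    have : (0 : ℝ) < y := hy
    simp only [Pi.zero_apply]
    positivity

lemma integrable_id_expMeasure : Integrable (fun y : ℝ => y) (expMeasure 1) := by
  refine ⟨measurable_id.aestronglyMeasurable, ?_⟩
  rw [hasFiniteIntegral_iff_ofReal (ae_expMeasure_pos.mono fun y hy => hy.le),
    lintegral_id_expMeasure]
  exact ENNReal.one_lt_top

lemma integral_id_expMeasure : ∫ y, y ∂(expMeasure 1) = 1 := by
  rw [integral_eq_lintegral_of_nonneg_ae (ae_expMeasure_pos.mono fun y hy => hy.le)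
    measurable_id.aestronglyMeasurable, lintegral_id_expMeasure, ENNReal.toReal_one]

/-- The law of a sequence of independent unit exponential variables. -/
def expSeq : Measure (ℕ → ℝ) := Measure.infinitePi fun _ => expMeasure 1

instance : IsProbabilityMeasure expSeq := by unfold expSeq; infer_instance

lemma ae_expSeq_pos : ∀ᵐ x ∂expSeq, ∀ k, 0 < x k := by
  rw [ae_all_iff]
  intro k
  exact (measurePreserving_eval_infinitePi (fun _ : ℕ => expMeasure 1)
      k).quasiMeasurePreserving.ae ae_expMeasure_pos

lemma jumpTime_succ (x : ℕ → ℝ) (k : ℕ) : jumpTime x (k + 1) = jumpTime x k + x (k + 1) := by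
  simp [jumpTime, Finset.sum_range_succ]

/-- By the strong law of large numbers, the partial sums are asymptotic to n. -/
lemma ae_expSeq_tendsto : ∀ᵐ x ∂expSeq, Tendsto (jumpTime x) atTop atTop := by
  have hmp := fun k => measurePreserving_eval_infinitePi (fun _ : ℕ => expMeasure 1) k
  have hind : iIndepFun (fun (k : ℕ) (x : ℕ → ℝ) => x k) expSeq :=
    iIndepFun_infinitePi (X := fun _ y => y) fun _ => measurable_id
  have hint0 : Integrable (fun x : ℕ → ℝ => x 0) expSeq :=
    (hmp 0).integrable_comp_of_integrable integrable_id_expMeasure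
  have hid : ∀ k, IdentDistrib (fun x : ℕ → ℝ => x k) (fun x => x 0) expSeq expSeq := fun k =>
    ⟨(measurable_pi_apply k).aemeasurable, (measurable_pi_apply 0).aemeasurable,
      (hmp k).map_eq.trans (hmp 0).map_eq.symm⟩
  have hmean : ∫ x, x 0 ∂expSeq = 1 := by
    rw [← integral_id_expMeasure, ← (hmp 0).map_eq, integral_map (hmp 0).measurable.aemeasurable
      (f := fun y : ℝ => y) (by fun_prop)]
    rfl
  have h := strong_law_ae_real (fun (k : ℕ) (x : ℕ → ℝ) => x k) hint0
    (fun i j hij => hind.indepFun hij) hid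
  rw [hmean] at h
  filter_upwards [h] with x hx
  have h2 : Tendsto (fun n : ℕ => ∑ i ∈ Finset.range n, x i) atTop atTop := by
    have h3 := hx.pos_mul_atTop one_pos (tendsto_natCast_atTop_atTop (R := ℝ))
    refine h3.congr' ?_
    filter_upwards [eventually_gt_atTop 0] with n hn
    have : (n : ℝ) ≠ 0 := by positivity
    field_simp
  exact h2.comp (tendsto_add_atTop_nat 1)

/-! ### Counting jumps -/

@[fun_prop]
lemma measurable_jumpTime (k : ℕ) : Measurable fun x => jumpTime x k := by
  unfold jumpTime; fun_prop

lemma measurable_jumpCount (s t : ℝ) : Measurable (jumpCount s t) := by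
  -- A series of indicators counts the jumps. The default values agree when there are infinitely
  -- many: `ncard` is 0, and so is `ENNReal.toReal ⊤`.
  have h : jumpCount s t = fun x => ⌊(∑' k, (Set.Ioc s t).indicator (fun _ => (1 : ℝ≥0∞))
      (jumpTime x k)).toReal⌋₊ := by
    ext x
    have e : ∑' k, (Set.Ioc s t).indicator (fun _ => (1 : ℝ≥0∞)) (jumpTime x k) =
        ({k : ℕ | jumpTime x k ∈ Set.Ioc s t}.encard : ℝ≥0∞) := by
      rw [← ENNReal.tsum_set_one, tsum_subtype _ fun _ => (1 : ℝ≥0∞)]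
      rfl
    rw [e, jumpCount]
    by_cases hf : {k : ℕ | jumpTime x k ∈ Set.Ioc s t}.Finite
    · rw [← hf.cast_ncard_eq]; simp
    · rw [Set.Infinite.ncard hf, Set.Infinite.encard_eq hf]; simp
  rw [h]
  refine Nat.measurable_floor.comp (ENNReal.measurable_toReal.comp
    (Measurable.tsum fun k => ?_))
  exact (measurable_const.indicator measurableSet_Ioc).comp (measurable_jumpTime k)

lemma finite_jumps {x : ℕ → ℝ} (hx : Tendsto (jumpTime x) atTop atTop) (s t : ℝ) :
    {k : ℕ | jumpTime x k ∈ Set.Ioc s t}.Finite := by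
  obtain ⟨N, hN⟩ := eventually_atTop.1 (hx.eventually_gt_atTop t)
  refine (Set.finite_lt_nat N).subset fun k hk => ?_
  by_contra hc
  exact absurd hk.2 (not_le.2 (hN k (not_lt.1 hc)))

/-- Put a first gap in front of a sequence. -/
def consSeq (a : ℝ) (x : ℕ → ℝ) : ℕ → ℝ
  | 0 => a
  | k + 1 => x k

lemma measurable_consSeq : Measurable fun z : ℝ × (ℕ → ℝ) => consSeq z.1 z.2 := by
  refine measurable_pi_lambda _ fun k => ?_
  cases k <;> simp only [consSeq] <;> fun_prop

/-- Cylinders over initial segments suffice: missing coordinates are filled with the whole space. -/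
lemma eq_infinitePi_of_range {X : Type*} [MeasurableSpace X] {ρ : ℕ → Measure X}
    [∀ i, IsProbabilityMeasure (ρ i)] {ν : Measure (ℕ → X)}
    (h : ∀ (N : ℕ) (t : ℕ → Set X), (∀ i, MeasurableSet (t i)) →
      ν (((Finset.range (N + 1) : Finset ℕ) : Set ℕ).pi t)
          = ∏ i ∈ Finset.range (N + 1), ρ i (t i)) :
    ν = Measure.infinitePi ρ := by
  refine Measure.eq_infinitePi _ fun s t ht => ?_
  obtain ⟨N, hN⟩ : ∃ N, s ⊆ Finset.range (N + 1) :=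
    ⟨s.sup id, fun i hi => Finset.mem_range.2 (Nat.lt_succ_of_le (Finset.le_sup (f := id) hi))⟩
  set t' : ℕ → Set X := fun i => if i ∈ s then t i else Set.univ with ht'
  have hmt' : ∀ i, MeasurableSet (t' i) := fun i => by
    simp only [ht']; split_ifs
    · exact ht i
    · exact .univ
  have hpi : (s : Set ℕ).pi t = ((Finset.range (N + 1) : Finset ℕ) : Set ℕ).pi t' := by
    ext x
    simp only [Set.mem_pi, Finset.mem_coe, ht']
    constructor
    · intro h i _
      split_ifs with hi
      · exact h i hi
      · trivial
    · intro h i hi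
      simpa [hi] using h i (hN hi)
  have hprod : ∏ i ∈ s, ρ i (t i) = ∏ i ∈ Finset.range (N + 1), ρ i (t' i) := by
    rw [← Finset.prod_subset hN]
    · exact Finset.prod_congr rfl fun i hi => by simp [ht', hi]
    · intro i _ hi
      simp [ht', hi]
  rw [hpi, hprod, h N t' hmt']

lemma map_consSeq_expSeq :
    ((expMeasure 1).prod expSeq).map (fun z => consSeq z.1 z.2) = expSeq := by
  refine eq_infinitePi_of_range fun N t' hmt' => ?_
  rw [Measure.map_apply measurable_consSeq
    (.pi (Finset.countable_toSet _) fun i _ => hmt' i)]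
  have hpre : (fun z : ℝ × (ℕ → ℝ) => consSeq z.1 z.2) ⁻¹'
      ((Finset.range (N + 1) : Finset ℕ) : Set ℕ).pi t' =
      t' 0 ×ˢ ((Finset.range N : Finset ℕ) : Set ℕ).pi fun i => t' (i + 1) := by
    ext z
    simp only [Set.mem_preimage, Set.mem_pi, Finset.mem_coe, Finset.mem_range, Set.mem_prod]
    constructor
    · intro h
      exact ⟨h 0 (by omega), fun i hi => h (i + 1) (by omega)⟩
    · rintro ⟨h0, h1⟩ i hi
      cases i with
      | zero => exact h0
      | succ i => exact h1 i (by omega)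
  rw [hpre, Measure.prod_prod, expSeq, Measure.infinitePi_pi _ fun i _ => hmt' (i + 1),
    Finset.prod_range_succ', mul_comm]

/-- Conditioning on the first gap, whose removal leaves a sequence of the same law. -/
lemma expSeq_apply_eq {E : Set (ℕ → ℝ)} (hE : MeasurableSet E) :
    expSeq E = ∫⁻ a in Set.Ioi 0, ENNReal.ofReal (Real.exp (-a)) *
      expSeq {x | consSeq a x ∈ E} := by
  have hpre := measurable_consSeq hE
  conv_lhs => rw [← map_consSeq_expSeq]
  rw [Measure.map_apply measurable_consSeq hE, Measure.prod_apply hpre,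
    lintegral_expMeasure_one (measurable_measure_prodMk_left hpre)]
  rfl

lemma jumpTime_consSeq_zero (a : ℝ) (x : ℕ → ℝ) : jumpTime (consSeq a x) 0 = a := by
  simp [jumpTime, consSeq]

lemma jumpTime_consSeq_succ (a : ℝ) (x : ℕ → ℝ) (k : ℕ) :
    jumpTime (consSeq a x) (k + 1) = a + jumpTime x k := by
  rw [jumpTime, Finset.sum_range_succ', jumpTime, add_comm]
  rfl

/-- The first jump contributes one and the others are shifted by a. Divergence of the jump times
ensures finiteness, without which `ncard` would not increase by one. -/
lemma jumpCount_consSeq_of_mem {a s t : ℝ} {x : ℕ → ℝ} (ha : a ∈ Set.Ioc s t)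
    (hx : Tendsto (jumpTime x) atTop atTop) :
    jumpCount s t (consSeq a x) = jumpCount (s - a) (t - a) x + 1 := by
  have h : {k : ℕ | jumpTime (consSeq a x) k ∈ Set.Ioc s t} =
      insert 0 (Nat.succ '' {k : ℕ | jumpTime x k ∈ Set.Ioc (s - a) (t - a)}) := by
    ext k
    cases k with
    | zero => simpa [jumpTime_consSeq_zero] using ha
    | succ k =>
      simp only [Set.mem_ofPred_eq, jumpTime_consSeq_succ, Set.mem_insert_iff, Nat.succ_ne_zero,
        false_or, Nat.succ_eq_add_one, Set.mem_image, Nat.add_right_cancel_iff, exists_eq_right,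
        Set.mem_Ioc]
      constructor <;> rintro ⟨h1, h2⟩ <;> constructor <;> linarith
  rw [jumpCount, h, Set.ncard_insert_of_notMem (by simp) ((finite_jumps hx _ _).image _),
    Set.ncard_image_of_injective _ Nat.succ_injective]
  rfl

lemma jumpCount_consSeq_of_notMem {a s t : ℝ} {x : ℕ → ℝ} (ha : a ∉ Set.Ioc s t) :
    jumpCount s t (consSeq a x) = jumpCount (s - a) (t - a) x := by
  have h : {k : ℕ | jumpTime (consSeq a x) k ∈ Set.Ioc s t} =
      Nat.succ '' {k : ℕ | jumpTime x k ∈ Set.Ioc (s - a) (t - a)} := by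
    ext k
    cases k with
    | zero => simpa [jumpTime_consSeq_zero] using ha
    | succ k =>
      simp only [Set.mem_ofPred_eq, jumpTime_consSeq_succ,
        Nat.succ_eq_add_one, Set.mem_image, Nat.add_right_cancel_iff, exists_eq_right,
        Set.mem_Ioc]
      constructor <;> rintro ⟨h1, h2⟩ <;> constructor <;> linarith
  rw [jumpCount, h, Set.ncard_image_of_injective _ Nat.succ_injective]
  rfl

lemma jumpTime_consSeq_sub (a c : ℝ) (x : ℕ → ℝ) (k : ℕ) :
    jumpTime (consSeq (a - c) x) k = jumpTime (consSeq a x) k - c := by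
  cases k with
  | zero => simp [jumpTime_consSeq_zero]
  | succ k => simp only [jumpTime_consSeq_succ]; ring

lemma jumpCount_consSeq_sub (a c s t : ℝ) (x : ℕ → ℝ) :
    jumpCount (s - c) (t - c) (consSeq (a - c) x) = jumpCount s t (consSeq a x) := by
  simp [jumpCount, jumpTime_consSeq_sub]

lemma jumpTime_pos {x : ℕ → ℝ} (hx : ∀ k, 0 < x k) (k : ℕ) : 0 < jumpTime x k :=
  Finset.sum_pos (fun j _ => hx j) (by simp)

lemma jumpCount_eq_of_pos {x : ℕ → ℝ} (hx : ∀ k, 0 < x k) {s : ℝ} (hs : s ≤ 0) (t : ℝ) :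
    jumpCount s t x = jumpCount 0 t x := by
  unfold jumpCount
  congr 1
  ext k
  have := jumpTime_pos hx k
  simp only [Set.mem_ofPred_eq, Set.mem_Ioc]
  constructor <;> rintro ⟨h1, h2⟩ <;> constructor <;> linarith

lemma jumpCount_consSeq_eq_zero {a s t : ℝ} {x : ℕ → ℝ} (hx : ∀ k, 0 < x k) (ha : t < a) :
    jumpCount s t (consSeq a x) = 0 := by
  have h : {k : ℕ | jumpTime (consSeq a x) k ∈ Set.Ioc s t} = ∅ := by
    ext k
    simp only [Set.mem_ofPred_eq, Set.mem_Ioc, Set.mem_empty_iff_false, iff_false, not_and, not_le]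
    intro _
    cases k with
    | zero => simpa [jumpTime_consSeq_zero] using ha
    | succ k =>
      rw [jumpTime_consSeq_succ]
      linarith [jumpTime_pos hx k]
  rw [jumpCount, h, Set.ncard_empty]

/-- The Poisson weights. -/
def poissonWeight (r : ℝ) (n : ℕ) : ℝ := Real.exp (-r) * r ^ n / n.factorial

/-- The exponentials combine to the constant e^(−r), and what remains is the integral of (r − a)^n /
n!. -/
lemma lintegral_exp_mul_poissonWeight {r : ℝ} (hr : 0 ≤ r) (n : ℕ) :
    ∫⁻ a in Set.Ioc 0 r, ENNReal.ofReal (Real.exp (-a)) * ENNReal.ofReal (poissonWeight (r - a) n) =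
      ENNReal.ofReal (poissonWeight r (n + 1)) := by
  have h1 : ∀ a ∈ Set.Ioc 0 r, ENNReal.ofReal (Real.exp (-a)) *
      ENNReal.ofReal (poissonWeight (r - a) n) =
      ENNReal.ofReal (Real.exp (-r) / n.factorial * (r - a) ^ n) := by
    intro a _
    rw [← ENNReal.ofReal_mul (Real.exp_pos _).le, poissonWeight]
    congr 1
    rw [show -(r - a) = -r + a by ring, Real.exp_add, Real.exp_neg a]
    have := Real.exp_pos a
    field_simp
  have hcont : Continuous fun a : ℝ => Real.exp (-r) / n.factorial * (r - a) ^ n := by fun_prop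
  rw [setLIntegral_congr_fun measurableSet_Ioc h1, ← ofReal_integral_eq_lintegral_ofReal
    ((hcont.integrableOn_Icc).mono_set Set.Ioc_subset_Icc_self),
    ← intervalIntegral.integral_of_le hr]
  · congr 1
    rw [intervalIntegral.integral_const_mul,
      intervalIntegral.integral_comp_sub_left (fun x => x ^ n) r, integral_pow, poissonWeight,
      Nat.factorial_succ]
    push_cast
    simp
    field_simp
  · refine (ae_restrict_iff' measurableSet_Ioc).2 (ae_of_all _ fun a ha => ?_)
    have : 0 ≤ r - a := by linarith [ha.2]
    simp only [Pi.zero_apply]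
    positivity

lemma measurableSet_jumpCount_eq (t : ℕ → ℝ) (n : ℕ → ℕ) (K : ℕ) :
    MeasurableSet {x | ∀ k < K, jumpCount (t k) (t (k + 1)) x = n k} := by
  have : {x | ∀ k < K, jumpCount (t k) (t (k + 1)) x = n k} =
      ⋂ k, ⋂ (_ : k < K), jumpCount (t k) (t (k + 1)) ⁻¹' {n k} := by
    ext x; simp
  rw [this]
  exact .iInter fun k => .iInter fun _ => measurable_jumpCount _ _ (measurableSet_singleton _)

/-- The memoryless property of the exponential law. -/
lemma setLIntegral_Ioi_exp_shift {c : ℝ} (Φ : ℝ → ℝ≥0∞) :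
    ∫⁻ a in Set.Ioi c, ENNReal.ofReal (Real.exp (-a)) * Φ (a - c) =
      ENNReal.ofReal (Real.exp (-c)) *
        ∫⁻ b in Set.Ioi 0, ENNReal.ofReal (Real.exp (-b)) * Φ b := by
  rw [← lintegral_const_mul' _ _ ENNReal.ofReal_ne_top, ← lintegral_indicator measurableSet_Ioi,
    ← lintegral_indicator measurableSet_Ioi, ← lintegral_add_right_eq_self _ c]
  refine lintegral_congr fun b => ?_
  by_cases hb : 0 < b
  · rw [Set.indicator_of_mem (by simpa using hb), Set.indicator_of_mem (by simpa using hb),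
      ← mul_assoc, ← ENNReal.ofReal_mul (Real.exp_pos _).le, ← Real.exp_add]
    congr 4
    · ring
    · ring
  · rw [Set.indicator_of_notMem (by simpa using hb), Set.indicator_of_notMem (by simpa using hb)]

/-- The joint law of the numbers of jumps of a unit-rate Poisson process in successive
intervals. -/
lemma expSeq_jumpCount_eq (K : ℕ) (n : ℕ → ℕ) (t : ℕ → ℝ) (ht0 : t 0 = 0) (ht : Monotone t) :
    expSeq {x | ∀ k < K, jumpCount (t k) (t (k + 1)) x = n k} =
      ∏ k ∈ Finset.range K, ENNReal.ofReal (poissonWeight (t (k + 1) - t k) (n k)) := by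
  induction K generalizing n t with
  | zero => simp
  | succ K ihK =>
    -- Inside the induction on the number of intervals, a second induction runs on the number of
    -- jumps required in the first interval.
    obtain ⟨j, hj⟩ : ∃ j, n 0 = j := ⟨_, rfl⟩
    have ht1 : 0 ≤ t 1 := ht0 ▸ ht (Nat.zero_le 1)
    induction j generalizing n t with
    | zero =>
      -- No jump in the first interval means that the first gap exceeds t 1. By the memoryless
      -- property its excess b is again exponential, so the first interval can be dropped and time
      -- restarted at t 1.
      set Φ : ℝ → ℝ≥0∞ := fun b => expSeq {x | ∀ k < K, jumpCount (t (k + 1) - t 1)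
        (t (k + 1 + 1) - t 1) (consSeq b x) = n (k + 1)} with hΦ
      have hstep : ∀ a ∈ Set.Ioi (0 : ℝ), ENNReal.ofReal (Real.exp (-a)) * expSeq {x | consSeq a x ∈
          {x | ∀ k < K + 1, jumpCount (t k) (t (k + 1)) x = n k}} =
          (Set.Ioi (t 1)).indicator
            (fun a => ENNReal.ofReal (Real.exp (-a)) * Φ (a - t 1)) a := by
        intro a ha
        by_cases hat : a ∈ Set.Ioi (t 1)
        · rw [Set.indicator_of_mem hat]
          congr 1
          refine measure_congr ?_
          filter_upwards [ae_expSeq_pos] with x hx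
          refine propext ?_
          constructor
          · intro h k hk
            have := h (k + 1) (by omega)
            rwa [jumpCount_consSeq_sub]
          · intro h k hk
            cases k with
            | zero => rw [hj]; exact jumpCount_consSeq_eq_zero hx hat
            | succ k =>
              have := h k (by omega)
              rwa [jumpCount_consSeq_sub] at this
        · rw [Set.indicator_of_notMem hat, mul_eq_zero]
          right
          rw [← nonpos_iff_eq_zero, ← measure_empty (μ := expSeq)]
          refine measure_mono_ae ?_
          filter_upwards [ae_expSeq_tendsto] with x hx h
          have h0 := h 0 (by omega)
          rw [jumpCount_consSeq_of_mem ⟨by rw [ht0]; exact ha, not_lt.1 hat⟩ hx, hj] at h0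
          omega
      rw [expSeq_apply_eq (measurableSet_jumpCount_eq _ _ _),
        setLIntegral_congr_fun measurableSet_Ioi hstep, lintegral_indicator measurableSet_Ioi,
        Measure.restrict_restrict measurableSet_Ioi,
        Set.inter_eq_left.2 (Set.Ioi_subset_Ioi ht1), setLIntegral_Ioi_exp_shift]
      have h2 := ihK (fun k => n (k + 1)) (fun k => t (k + 1) - t 1) (by simp)
        (fun a b hab => by simpa using ht (by omega))
      rw [expSeq_apply_eq (measurableSet_jumpCount_eq _ _ _)] at h2
      have h3 : ∫⁻ b in Set.Ioi 0, ENNReal.ofReal (Real.exp (-b)) * Φ b =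
          ∏ k ∈ Finset.range K, ENNReal.ofReal (poissonWeight (t (k + 1 + 1) - t (k + 1))
            (n (k + 1))) := by
        refine h2.trans (Finset.prod_congr rfl fun k _ => ?_)
        rw [sub_sub_sub_cancel_right]
      rw [h3, Finset.prod_range_succ', mul_comm, hj]
      simp [poissonWeight, ht0]
    | succ j ihj =>
      have hstep : ∀ a ∈ Set.Ioi (0 : ℝ), ENNReal.ofReal (Real.exp (-a)) * expSeq {x | consSeq a x ∈
          {x | ∀ k < K + 1, jumpCount (t k) (t (k + 1)) x = n k}} =
          (Set.Iic (t 1)).indicator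
            (fun a => ENNReal.ofReal (Real.exp (-a)) *
              ENNReal.ofReal (poissonWeight (t 1 - a) j)) a *
            ∏ k ∈ Finset.range K, ENNReal.ofReal (poissonWeight (t (k + 1 + 1) - t (k + 1))
            (n (k + 1))) := by
        intro a ha
        have ha0 : 0 < a := ha
        by_cases hat : a ∈ Set.Iic (t 1)
        · have hat' : a ≤ t 1 := hat
          have hk1 : ∀ k, a ≤ t (k + 1) := fun k => hat'.trans (ht (by omega))
          rw [Set.indicator_of_mem hat, mul_assoc]
          congr 1
          -- Remove the first jump, at a ≤ t 1, and restart time there: one jump fewer is required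
          -- in the first interval, now (0, t 1 − a]. The maximum with 0 affects only the left
          -- endpoint, which becomes 0 instead of −a.
          set n' : ℕ → ℕ := fun k => if k = 0 then j else n k
          set t' : ℕ → ℝ := fun k => max 0 (t k - a)
          have ht'0 : t' 0 = 0 := by simp [t', ht0, ha0.le]
          have ht'k : ∀ k, t' (k + 1) = t (k + 1) - a := fun k =>
            max_eq_right (by linarith [hk1 k])
          have h4 := ihj n' t' ht'0 (fun a b hab => max_le_max le_rfl (by linarith [ht hab]))
            (by simp [n']) (by rw [ht'k 0]; linarith)
          have h5 : expSeq {x | consSeq a x ∈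
              {x | ∀ k < K + 1, jumpCount (t k) (t (k + 1)) x = n k}} =
              expSeq {x | ∀ k < K + 1, jumpCount (t' k) (t' (k + 1)) x = n' k} := by
            refine measure_congr ?_
            filter_upwards [ae_expSeq_pos, ae_expSeq_tendsto] with x hx hx'
            refine propext (forall₂_congr fun k hk => ?_)
            cases k with
            | zero =>
              rw [jumpCount_consSeq_of_mem ⟨by rw [ht0]; exact ha0, hat'⟩ hx', hj, ht'0, ht'k,
                jumpCount_eq_of_pos hx (by rw [ht0]; linarith)]
              simp [n']
            | succ k =>
              rw [jumpCount_consSeq_of_notMem (fun h => absurd h.1 (not_lt.2 (hk1 k))), ht'k, ht'k]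
              simp [n']
          rw [h5, h4, Finset.prod_range_succ', mul_comm, ht'0, ht'k]
          congr 1
          · simp [n']
          · refine Finset.prod_congr rfl fun k _ => ?_
            rw [ht'k, ht'k, sub_sub_sub_cancel_right]
            simp [n']
        · rw [Set.indicator_of_notMem hat, zero_mul, mul_eq_zero]
          right
          rw [← nonpos_iff_eq_zero, ← measure_empty (μ := expSeq)]
          refine measure_mono_ae ?_
          filter_upwards [ae_expSeq_pos] with x hx h
          have h0 := h 0 (by omega)
          rw [jumpCount_consSeq_eq_zero hx (not_le.1 hat), hj] at h0
          omega
      rw [expSeq_apply_eq (measurableSet_jumpCount_eq _ _ _),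
        setLIntegral_congr_fun measurableSet_Ioi hstep, lintegral_mul_const',
        lintegral_indicator measurableSet_Iic, Measure.restrict_restrict measurableSet_Iic,
        Set.inter_comm, Set.Ioi_inter_Iic, lintegral_exp_mul_poissonWeight ht1,
        Finset.prod_range_succ', mul_comm, hj, ht0]
      · simp
      · exact ENNReal.prod_ne_top fun _ _ => ENNReal.ofReal_ne_top

end

section

/-! ### Poisson processes -/

lemma poissonMeasure_singleton_eq {r : ℝ} (hr : 0 ≤ r) (n : ℕ) :
    poissonMeasure r.toNNReal {n} = ENNReal.ofReal (poissonWeight r n) := by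
  rw [poissonMeasure_singleton, poissonWeight, Real.coe_toNNReal _ hr]

/-- Counts are discrete, so their joint law on finitely many intervals is determined by the masses
of points, which `expSeq_jumpCount_eq` provides. -/
lemma map_jumpCount_expSeq {t : ℕ → ℝ} (ht0 : t 0 = 0) (ht : Monotone t) :
    expSeq.map (fun x k => jumpCount (t k) (t (k + 1)) x) =
      Measure.infinitePi fun k => poissonMeasure (t (k + 1) - t k).toNNReal := by
  have hm : ∀ k, Measurable fun x => jumpCount (t k) (t (k + 1)) x := fun k =>
    measurable_jumpCount _ _
  refine eq_infinitePi_of_range fun N s hs => ?_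
  have hfin : expSeq.map (fun x (k : Fin (N + 1)) => jumpCount (t k) (t (k + 1)) x) =
      Measure.pi fun k : Fin (N + 1) => poissonMeasure (t (k + 1) - t k).toNNReal := by
    refine Measure.ext_of_singleton fun n => ?_
    rw [Measure.map_apply (by fun_prop) (measurableSet_singleton n), Measure.pi_singleton]
    set n' : ℕ → ℕ := fun k => if hk : k < N + 1 then n ⟨k, hk⟩ else 0
    have hn' : ∀ (k : ℕ) (hk : k < N + 1), n' k = n ⟨k, hk⟩ := fun k hk => dif_pos hk
    have h := expSeq_jumpCount_eq (N + 1) n' t ht0 ht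
    have e : (fun x (k : Fin (N + 1)) => jumpCount (t k) (t (k + 1)) x) ⁻¹' {n} =
        {x | ∀ k < N + 1, jumpCount (t k) (t (k + 1)) x = n' k} := by
      ext x
      simp only [Set.mem_preimage, Set.mem_singleton_iff, Set.mem_ofPred_eq, funext_iff]
      constructor
      · intro h k hk
        rw [hn' k hk]; exact h ⟨k, hk⟩
      · intro h k
        rw [h k k.2, hn' k k.2]
    rw [e, h, ← Fin.prod_univ_eq_prod_range
      (fun k => ENNReal.ofReal (poissonWeight (t (k + 1) - t k) (n' k)))]
    refine Finset.prod_congr rfl fun k _ => ?_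
    rw [poissonMeasure_singleton_eq (by linarith [ht (Nat.le_succ k)]), hn' k k.2]
  rw [Measure.map_apply (by fun_prop) (.pi (Finset.countable_toSet _) fun i _ => hs i)]
  have e : (fun x k => jumpCount (t k) (t (k + 1)) x) ⁻¹'
      ((Finset.range (N + 1) : Finset ℕ) : Set ℕ).pi s =
      (fun x (k : Fin (N + 1)) => jumpCount (t k) (t (k + 1)) x) ⁻¹'
        Set.univ.pi fun k : Fin (N + 1) => s k := by
    ext x
    simp only [Set.mem_preimage, Set.mem_pi, Finset.mem_coe, Finset.mem_range, Set.mem_univ,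
      true_imp_iff]
    exact ⟨fun h k => h k k.2, fun h k hk => h ⟨k, hk⟩⟩
  rw [e, ← Measure.map_apply (by fun_prop)
    (MeasurableSet.univ_pi fun k : Fin (N + 1) => hs k), hfin, Measure.pi_pi,
    Fin.prod_univ_eq_prod_range (fun k => poissonMeasure (t (k + 1) - t k).toNNReal (s k))]

lemma map_jumpCount_expSeq_apply {t : ℕ → ℝ} (ht0 : t 0 = 0) (ht : Monotone t) (k : ℕ) :
    expSeq.map (jumpCount (t k) (t (k + 1))) = poissonMeasure (t (k + 1) - t k).toNNReal := by
  have hm : ∀ k, Measurable fun x => jumpCount (t k) (t (k + 1)) x := fun k =>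
    measurable_jumpCount _ _
  rw [← Measure.infinitePi_map_eval (fun k => poissonMeasure (t (k + 1) - t k).toNNReal) k,
    ← map_jumpCount_expSeq ht0 ht, Measure.map_map (by fun_prop) (by fun_prop)]
  rfl

lemma iIndepFun_jumpCount_expSeq {t : ℕ → ℝ} (ht0 : t 0 = 0) (ht : Monotone t) :
    iIndepFun (fun k => jumpCount (t k) (t (k + 1))) expSeq := by
  rw [iIndepFun_iff_map_fun_eq_infinitePi_map fun k => measurable_jumpCount _ _,
    map_jumpCount_expSeq ht0 ht]
  simp_rw [map_jumpCount_expSeq_apply ht0 ht]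

/-- The inter-jump times of the process of rate `t` at time `t` whose `k`-th jump time is
`√(2 s)`, where `s` is the `k`-th jump time of the process with inter-jump times `e`. -/
def rateGaps (e : ℕ → ℝ) : ℕ → ℝ
  | 0 => √(2 * jumpTime e 0)
  | k + 1 => √(2 * jumpTime e (k + 1)) - √(2 * jumpTime e k)

lemma measurable_rateGaps : Measurable rateGaps := by
  refine measurable_pi_lambda _ fun k => ?_
  cases k <;> simp only [rateGaps] <;> fun_prop

lemma jumpTime_rateGaps (e : ℕ → ℝ) (k : ℕ) : jumpTime (rateGaps e) k = √(2 * jumpTime e k) := by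
  induction k with
  | zero => simp [jumpTime, rateGaps]
  | succ k ih => rw [jumpTime_succ, ih, rateGaps]; ring

lemma jumpCount_rateGaps {e : ℕ → ℝ} {s t : ℝ} (hs : 0 ≤ s) (ht : 0 ≤ t) :
    jumpCount s t (rateGaps e) = jumpCount (s ^ 2 / 2) (t ^ 2 / 2) e := by
  unfold jumpCount
  congr 1
  ext k
  simp only [Set.mem_ofPred_eq, Set.mem_Ioc, jumpTime_rateGaps, Real.lt_sqrt hs,
    Real.sqrt_le_left ht]
  constructor <;> rintro ⟨h1, h2⟩ <;> constructor <;> linarith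

/-- The law of the inter-jump times of the Poisson process of rate `t` at time `t`. -/
def rateLaw : Measure (ℕ → ℝ) := expSeq.map rateGaps

instance : IsProbabilityMeasure rateLaw :=
  Measure.isProbabilityMeasure_map measurable_rateGaps.aemeasurable

lemma isPoissonInterJumpLaw_rateLaw : IsPoissonInterJumpLaw (fun t => t) rateLaw where
  isProbabilityMeasure := inferInstance
  pos := by
    have hm : MeasurableSet {x : ℕ → ℝ | ∀ k, 0 < x k} := by
      have : {x : ℕ → ℝ | ∀ k, 0 < x k} = ⋂ k, {x : ℕ → ℝ | 0 < x k} := by ext; simp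
      rw [this]
      exact .iInter fun k => measurableSet_lt measurable_const (measurable_pi_apply k)
    rw [rateLaw, ae_map_iff measurable_rateGaps.aemeasurable hm]
    filter_upwards [ae_expSeq_pos] with e he k
    cases k with
    | zero => exact Real.sqrt_pos.2 (mul_pos two_pos (jumpTime_pos he 0))
    | succ k =>
      rw [rateGaps, sub_pos, jumpTime_succ]
      exact Real.sqrt_lt_sqrt (mul_nonneg zero_le_two (jumpTime_pos he k).le)
        (by linarith [he (k + 1)])
  tendsto_jumpTime := by
    have hm : MeasurableSet {x : ℕ → ℝ | Tendsto (jumpTime x) atTop atTop} := by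
      have : {x : ℕ → ℝ | Tendsto (jumpTime x) atTop atTop} =
          ⋂ m : ℕ, ⋃ N : ℕ, ⋂ k : ℕ, ⋂ (_ : N ≤ k), {x | (m : ℝ) ≤ jumpTime x k} := by
        ext x
        simp only [Set.mem_ofPred_eq, Set.mem_iInter, Set.mem_iUnion]
        constructor
        · intro h m
          exact eventually_atTop.1 (h.eventually_ge_atTop m)
        · intro h
          refine tendsto_atTop.2 fun b => ?_
          obtain ⟨m, hm⟩ := exists_nat_ge b
          filter_upwards [eventually_atTop.2 (h m)] with k hk using hm.trans hk
      rw [this]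
      exact .iInter fun m => .iUnion fun N => .iInter fun k => .iInter fun _ =>
        measurableSet_le measurable_const (measurable_jumpTime k)
    rw [rateLaw, ae_map_iff measurable_rateGaps.aemeasurable hm]
    filter_upwards [ae_expSeq_tendsto] with e he
    have h1 : jumpTime (rateGaps e) = fun k => √(2 * jumpTime e k) :=
      funext (jumpTime_rateGaps e)
    rw [h1]
    exact Real.tendsto_sqrt_atTop.comp (he.const_mul_atTop two_pos)
  hasLaw_jumpCount := by
    intro s t hs hst
    refine ⟨(measurable_jumpCount s t).aemeasurable, ?_⟩
    -- The partition must start at 0, so the interval of interest is made its second one.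
    set τ : ℕ → ℝ := fun k => if k = 0 then 0 else if k = 1 then s ^ 2 / 2 else t ^ 2 / 2 with hτ
    have hmono : Monotone τ := by
      refine monotone_nat_of_le_succ fun k => ?_
      rcases k with _ | _ | k
      · simp only [hτ]; norm_num; positivity
      · simp only [hτ]; norm_num; gcongr
      · simp [hτ]
    have h := map_jumpCount_expSeq_apply (t := τ) (by simp [hτ]) hmono 1
    have e1 : jumpCount s t ∘ rateGaps = jumpCount (τ 1) (τ (1 + 1)) := by
      ext e
      simp [hτ, jumpCount_rateGaps hs (hs.trans hst)]
    rw [rateLaw, Measure.map_map (measurable_jumpCount s t) measurable_rateGaps, e1, h, integral_id]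
    congr 2
    simp [hτ]
    ring
  indep_jumpCount := by
    intro t ht0 ht
    have htk : ∀ k, 0 ≤ t k := fun k => ht0.trans (ht (Nat.zero_le k))
    set τ : ℕ → ℝ := fun k => if k = 0 then 0 else t (k - 1) ^ 2 / 2 with hτ
    have hmono : Monotone τ := by
      refine monotone_nat_of_le_succ fun k => ?_
      rcases k with _ | k
      · simp only [hτ]; norm_num; positivity
      · have := htk k
        have := ht (Nat.le_succ k)
        simp only [hτ]; simp only [Nat.add_one_ne_zero, if_false, Nat.add_sub_cancel]; gcongr
    -- The partition is prolonged down to 0, and the additional first interval is then discarded.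
    have h := (iIndepFun_jumpCount_expSeq (t := τ) (by simp [hτ]) hmono).precomp Nat.succ_injective
    have e1 : ∀ k, (fun e => jumpCount (t k) (t (k + 1)) (rateGaps e)) =
        jumpCount (τ (Nat.succ k)) (τ (Nat.succ k + 1)) := fun k => by
      ext e
      simp [hτ, jumpCount_rateGaps (htk k) (htk (k + 1))]
    have hm : ∀ k, Measurable (jumpCount (t k) (t (k + 1))) := fun k => measurable_jumpCount _ _
    have h2 : iIndepFun (fun k e => jumpCount (t k) (t (k + 1)) (rateGaps e)) expSeq := by
      have := funext e1
      rw [this]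
      exact h
    have h3 := (iIndepFun_iff_map_fun_eq_infinitePi_map
      (X := fun k e => jumpCount (t k) (t (k + 1)) (rateGaps e))
      fun k => (hm k).comp measurable_rateGaps).1 h2
    rw [iIndepFun_iff_map_fun_eq_infinitePi_map hm, rateLaw,
      Measure.map_map (by fun_prop) measurable_rateGaps]
    simp_rw [Measure.map_map (hm _) measurable_rateGaps]
    exact h3

end

section

variable {d : ℕ}

/-! ### Almost sure behavior of the mixture model -/

/-- The noise of step n + 1 is independent of any functional that ignores it. -/
lemma lintegral_mul_step (n : ℕ) {G : Noise d → ℝ≥0∞} (hG : Measurable G)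
    (hGn : ∀ w v y, G (Function.update w.1 n v, Function.update w.2 (Sum.inr n) y) = G w)
    {H : unitInterval × ℝ → ℝ≥0∞} (hH : Measurable H) :
    ∫⁻ w, G w * H (w.1 n, w.2 (Sum.inr n)) ∂(noiseMeasure d) =
      (∫⁻ w, G w ∂(noiseMeasure d)) * ∫⁻ v, ∫⁻ y, H (v, y) ∂(expMeasure 1) := by
  rw [lintegral_resample n (by fun_prop)]
  simp only [hGn, Function.update_self]
  have h1 : Measurable fun v => ∫⁻ y, H (v, y) ∂(expMeasure 1) :=
    Measurable.lintegral_prod_right' hH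
  have h2 : ∀ w : Noise d, ∫⁻ v, ∫⁻ y, G w * H (v, y) ∂(expMeasure 1) =
      G w * ∫⁻ v, ∫⁻ y, H (v, y) ∂(expMeasure 1) := fun w => by
    rw [← lintegral_const_mul _ h1]
    refine lintegral_congr fun v => ?_
    rw [lintegral_const_mul _ (by fun_prop)]
  simp_rw [h2]
  rw [lintegral_mul_const _ hG]

/-- The exponential variable used at step `n + 1`, if it is attributed to color `i`. -/
def mixTick (p : Fin (d + 1) → ℝ) (i : Fin (d + 1)) (z : unitInterval × ℝ) : ℝ :=
  if quantile d p z.1 = i then z.2 else 0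

lemma measurable_mixTick (p : Fin (d + 1) → ℝ) (i : Fin (d + 1)) : Measurable (mixTick p i) := by
  have : Measurable fun z : unitInterval × ℝ => quantile d p z.1 :=
    measurable_quantile measurable_const measurable_fst
  exact Measurable.ite (this (measurableSet_singleton i)) measurable_snd measurable_const

lemma measurable_mixTick_noise (p : Fin (d + 1) → ℝ) (i : Fin (d + 1)) (n : ℕ) :
    Measurable fun w : Noise d => mixTick p i (w.1 n, w.2 (Sum.inr n)) :=
  (measurable_mixTick p i).comp (by fun_prop)

lemma noiseMeasure_mixTick (p : Fin (d + 1) → ℝ) (i : Fin (d + 1)) (n : ℕ)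
    {B : Set ℝ} (hB : MeasurableSet B) :
    noiseMeasure d ((fun w => mixTick p i (w.1 n, w.2 (Sum.inr n))) ⁻¹' B) =
      ∫⁻ v, ∫⁻ y, B.indicator 1 (mixTick p i (v, y)) ∂(expMeasure 1) := by
  have h := lintegral_mul_step (d := d) n (G := 1) measurable_one (fun _ _ _ => rfl)
    (H := fun z => B.indicator 1 (mixTick p i z))
    ((measurable_one.indicator hB).comp (measurable_mixTick p i))
  simp only [Pi.one_apply, one_mul, lintegral_one, measure_univ] at h
  rw [← h, ← lintegral_indicator_one (measurable_mixTick_noise p i n hB)]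
  rfl

lemma identDistrib_mixTick (p : Fin (d + 1) → ℝ) (i : Fin (d + 1)) (n : ℕ) :
    IdentDistrib (fun w : Noise d => mixTick p i (w.1 n, w.2 (Sum.inr n)))
      (fun w : Noise d => mixTick p i (w.1 0, w.2 (Sum.inr 0)))
      (noiseMeasure d) (noiseMeasure d) := by
  refine ⟨(measurable_mixTick_noise p i n).aemeasurable,
    (measurable_mixTick_noise p i 0).aemeasurable, ?_⟩
  ext B hB
  rw [Measure.map_apply (measurable_mixTick_noise p i n) hB,
    Measure.map_apply (measurable_mixTick_noise p i 0) hB, noiseMeasure_mixTick p i n hB,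
    noiseMeasure_mixTick p i 0 hB]

lemma indepFun_mixTick (p : Fin (d + 1) → ℝ) (i : Fin (d + 1)) {m n : ℕ} (hmn : m ≠ n) :
    IndepFun (fun w : Noise d => mixTick p i (w.1 m, w.2 (Sum.inr m)))
      (fun w : Noise d => mixTick p i (w.1 n, w.2 (Sum.inr n))) (noiseMeasure d) := by
  rw [indepFun_iff_measure_inter_preimage_eq_mul]
  intro B B' hB hB'
  have h := lintegral_mul_step (d := d) n
    (G := fun w => B.indicator 1 (mixTick p i (w.1 m, w.2 (Sum.inr m))))
    ((measurable_one.indicator hB).comp (measurable_mixTick_noise p i m))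
    (fun w v y => by
      simp [Function.update_of_ne hmn])
    (H := fun z => B'.indicator 1 (mixTick p i z))
    ((measurable_one.indicator hB').comp (measurable_mixTick p i))
  rw [← noiseMeasure_mixTick p i n hB'] at h
  have h1 : ∫⁻ w : Noise d, B.indicator 1 (mixTick p i (w.1 m, w.2 (Sum.inr m)))
      ∂(noiseMeasure d) = noiseMeasure d
        ((fun w => mixTick p i (w.1 m, w.2 (Sum.inr m))) ⁻¹' B) := by
    rw [← lintegral_indicator_one (measurable_mixTick_noise p i m hB)]
    rfl
  rw [h1] at h
  rw [← h, ← lintegral_indicator_one ((measurable_mixTick_noise p i m hB).inter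
    (measurable_mixTick_noise p i n hB'))]
  refine lintegral_congr fun w => ?_
  rw [Set.inter_indicator_one]
  rfl

/-- Probability p_i of choosing color i, times the unit mean of the exponential. -/
lemma lintegral_mixTick {p : Fin (d + 1) → ℝ} (h0 : ∀ i, 0 ≤ p i) (h1 : ∑ i, p i = 1)
    (i : Fin (d + 1)) (n : ℕ) :
    ∫⁻ w : Noise d, ENNReal.ofReal (mixTick p i (w.1 n, w.2 (Sum.inr n))) ∂(noiseMeasure d) =
      ENNReal.ofReal (p i) := by
  have h := lintegral_mul_step (d := d) n (G := 1) measurable_one (fun _ _ _ => rfl)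
    (H := fun z => ENNReal.ofReal (mixTick p i z)) (measurable_mixTick p i).ennreal_ofReal
  simp only [Pi.one_apply, one_mul, lintegral_one, measure_univ] at h
  rw [h]
  have h2 : ∀ v, ∫⁻ y, ENNReal.ofReal (mixTick p i (v, y)) ∂(expMeasure 1) =
      (fun j => if j = i then (1 : ℝ≥0∞) else 0) (quantile d p v) := fun v => by
    simp only [mixTick]
    split_ifs
    · exact lintegral_id_expMeasure
    · simp
  simp_rw [h2]
  rw [lintegral_quantile h0 h1 fun j => if j = i then (1 : ℝ≥0∞) else 0]
  simp

lemma ae_mixTick_nonneg (p : Fin (d + 1) → ℝ) (i : Fin (d + 1)) (n : ℕ) :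
    0 ≤ᵐ[noiseMeasure d] fun w : Noise d => mixTick p i (w.1 n, w.2 (Sum.inr n)) := by
  filter_upwards [ae_noise_pos] with w hw
  simp only [mixTick]
  split_ifs
  · exact (hw _).le
  · exact le_rfl

lemma integrable_mixTick {p : Fin (d + 1) → ℝ} (h0 : ∀ i, 0 ≤ p i) (h1 : ∑ i, p i = 1)
    (i : Fin (d + 1)) (n : ℕ) :
    Integrable (fun w : Noise d => mixTick p i (w.1 n, w.2 (Sum.inr n))) (noiseMeasure d) := by
  refine ⟨(measurable_mixTick_noise p i n).aestronglyMeasurable, ?_⟩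
  rw [hasFiniteIntegral_iff_ofReal (ae_mixTick_nonneg p i n), lintegral_mixTick h0 h1]
  exact ENNReal.ofReal_lt_top

lemma integral_mixTick {p : Fin (d + 1) → ℝ} (h0 : ∀ i, 0 ≤ p i) (h1 : ∑ i, p i = 1)
    (i : Fin (d + 1)) (n : ℕ) :
    ∫ w : Noise d, mixTick p i (w.1 n, w.2 (Sum.inr n)) ∂(noiseMeasure d) = p i := by
  rw [integral_eq_lintegral_of_nonneg_ae (ae_mixTick_nonneg p i n)
    (measurable_mixTick_noise p i n).aestronglyMeasurable, lintegral_mixTick h0 h1,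
    ENNReal.toReal_ofReal (h0 i)]

/-- The clock is an initial value, negligible after division by n, plus a sum of identically
distributed, pairwise independent ticks of mean p_i. -/
lemma ae_tendsto_mixClock {p : Fin (d + 1) → ℝ} (h0 : ∀ i, 0 ≤ p i) (h1 : ∑ i, p i = 1) :
    ∀ᵐ w ∂(noiseMeasure d), ∀ i,
      Tendsto (fun n : ℕ => mixClock n (p, w) i / n) atTop (𝓝 (p i)) := by
  rw [ae_all_iff]
  intro i
  have h := strong_law_ae_real
    (fun n (w : Noise d) => mixTick p i (w.1 n, w.2 (Sum.inr n))) (integrable_mixTick h0 h1 i 0)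
    (fun m n hmn => indepFun_mixTick p i hmn) (identDistrib_mixTick p i)
  rw [integral_mixTick h0 h1] at h
  filter_upwards [h] with w hw
  have h2 : Tendsto (fun n : ℕ => w.2 (Sum.inl i) / (n : ℝ)) atTop (𝓝 0) :=
    tendsto_const_div_atTop_nhds_zero_nat _
  have h3 := h2.add hw
  rw [zero_add] at h3
  refine h3.congr fun n => ?_
  rw [← add_div]
  rfl

/-- A color chosen finitely often has a bounded clock, which divided by n would tend to 0 rather
than to p_i > 0. -/
lemma infinite_of_tendsto_mixClock {w : Sample d} {i : Fin (d + 1)} (hp : 0 < w.1 i)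
    (hw : ∀ j, 0 < w.2.2 j)
    (h : Tendsto (fun n : ℕ => mixClock n w i / n) atTop (𝓝 (w.1 i))) :
    {n | mixI n w = i}.Infinite := by
  intro hfin
  have hle : ∀ n, mixClock n w i ≤ w.2.2 (Sum.inl i) + ∑ k ∈ hfin.toFinset, w.2.2 (Sum.inr k) := by
    intro n
    unfold mixClock
    gcongr
    rw [← Finset.sum_filter]
    refine Finset.sum_le_sum_of_subset_of_nonneg (fun k hk => ?_) fun k _ _ => (hw _).le
    simpa using (Finset.mem_filter.1 hk).2
  have h0 : Tendsto (fun n : ℕ => mixClock n w i / n) atTop (𝓝 0) :=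
    squeeze_zero (fun n => div_nonneg (mixClock_pos hw n i).le n.cast_nonneg)
      (fun n => div_le_div_of_nonneg_right (hle n) n.cast_nonneg)
      (tendsto_const_div_atTop_nhds_zero_nat _)
  exact hp.ne' (tendsto_nhds_unique h h0)

/-- A clock of order p_i n gives a quantity of order √(2 p_i · p_i n) = √2 p_i √n. The factor √p_i
in the definition of the quantities is what makes this linear in p_i, so that the total is of order
√2 √n. -/
lemma tendsto_proportion_mixL {w : Sample d} (h0 : ∀ i, 0 ≤ w.1 i) (h1 : ∑ i, w.1 i = 1)
    (h : ∀ i, Tendsto (fun n : ℕ => mixClock n w i / n) atTop (𝓝 (w.1 i))) :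
    Tendsto (fun n => proportion mixL n w) atTop (𝓝 w.1) := by
  have hl : ∀ i, Tendsto (fun n : ℕ => mixL n w i / √n) atTop (𝓝 (√2 * w.1 i)) := fun i => by
    have h2 := (h i).const_mul (2 * w.1 i)
    have h3 := h2.sqrt
    have e : √(2 * w.1 i * w.1 i) = √2 * w.1 i := by
      rw [mul_assoc, Real.sqrt_mul zero_le_two, Real.sqrt_mul_self (h0 i)]
    rw [e] at h3
    refine h3.congr fun n => ?_
    rw [mixL, ← mul_div_assoc, Real.sqrt_div' _ n.cast_nonneg]
  have ht : Tendsto (fun n : ℕ => total mixL n w / √n) atTop (𝓝 √2) := by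
    have := tendsto_finsetSum Finset.univ fun i _ => hl i
    rw [← Finset.mul_sum, h1, mul_one] at this
    refine this.congr fun n => ?_
    rw [total, Finset.sum_div]
  refine tendsto_pi_nhds.2 fun i => ?_
  have h2 := (hl i).div ht (by positivity)
  rw [mul_div_cancel_left₀ _ (by positivity)] at h2
  refine h2.congr' ?_
  filter_upwards [eventually_gt_atTop 0] with n hn
  have : (0 : ℝ) < √n := Real.sqrt_pos.2 (by exact_mod_cast hn)
  simp only [Pi.div_apply, proportion]
  rw [div_div_div_cancel_right₀ this.ne']

/-! ### The additions to each color in the mixture model -/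

/-- The index of the `k`-th exponential variable attributed to color `i`. -/
def tickIndex (I : ℕ → Fin (d + 1)) : Fin (d + 1) × ℕ → Fin (d + 1) ⊕ ℕ
  | (i, 0) => Sum.inl i
  | (i, k + 1) => Sum.inr (Nat.nth (fun n => I n = i) k)

/-- The step at which a variable is used determines the color receiving it, and an infinite set is
enumerated injectively. If a color were chosen finitely often, the default value of `Nat.nth` would
be repeated. -/
lemma tickIndex_injective {I : ℕ → Fin (d + 1)} (hI : ∀ i, {n | I n = i}.Infinite) :
    Function.Injective (tickIndex I) := by
  rintro ⟨i, _ | k⟩ ⟨j, _ | l⟩ h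
  · simp only [tickIndex, Sum.inl.injEq] at h
    rw [h]
  · simp [tickIndex] at h
  · simp [tickIndex] at h
  · simp only [tickIndex, Sum.inr.injEq] at h
    have h1 : I (Nat.nth (fun n => I n = i) k) = i := Nat.nth_mem_of_infinite (hI i) k
    have h2 : I (Nat.nth (fun n => I n = j) l) = j := Nat.nth_mem_of_infinite (hI j) l
    have hij : i = j := by rw [← h1, h, h2]
    subst hij
    rw [Nat.nth_injective (hI i) h]

/-- The initial exponential is the gap of index 0, so after c choices of the color the clock stands
at jump time number c. -/
lemma mixClock_eq_jumpTime (w : Sample d) (i : Fin (d + 1)) (n : ℕ) :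
    mixClock n w i = jumpTime (fun k => w.2.2 (tickIndex (fun n => mixI n w) (i, k)))
      (Nat.count (fun n => mixI n w = i) n) := by
  induction n with
  | zero => simp [mixClock, jumpTime, tickIndex]
  | succ n ih =>
    rw [mixClock_succ, ih, Nat.count_succ]
    split_ifs with h
    · rw [jumpTime_succ]
      congr 1
      simp only [tickIndex]
      rw [Nat.nth_count (p := fun n => mixI n w = i) h]
    · simp

lemma colorAdditions_mix {w : Sample d} (hp : ∀ i, 0 ≤ w.1 i)
    (hI : ∀ i, {n | mixI n w = i}.Infinite) (i : Fin (d + 1)) :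
    colorAdditions mixL mixI mixA i w = fun k => √(w.1 i) *
      rateGaps (fun k => w.2.2 (tickIndex (fun n => mixI n w) (i, k))) k := by
  have hs : ∀ n k, Nat.count (fun n => mixI n w = i) n = k → mixL n w i = √(w.1 i) *
      √(2 * jumpTime (fun k => w.2.2 (tickIndex (fun n => mixI n w) (i, k))) k) := by
    rintro n k rfl
    rw [mixL, mixClock_eq_jumpTime, ← Real.sqrt_mul (hp i)]
    congr 1
    ring
  ext k
  cases k with
  | zero => exact hs 0 0 (by simp)
  | succ k =>
    have h1 : mixI (Nat.nth (fun n => mixI n w = i) k) w = i := Nat.nth_mem_of_infinite (hI i) k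
    have h2 := Nat.count_nth_of_infinite (p := fun n => mixI n w = i) (hI i) k
    simp only [colorAdditions, mixA, rateGaps]
    rw [h1, hs _ k h2, hs _ (k + 1) (by rw [Nat.count_succ, if_pos h1, h2]), mul_sub]

/-- The law of the inter-jump times, multiplied by `√r`. -/
def scaledRateLaw (r : ℝ) : Measure (ℕ → ℝ) := rateLaw.map fun x k => √r * x k

instance (r : ℝ) : IsProbabilityMeasure (scaledRateLaw r) :=
  Measure.isProbabilityMeasure_map (Measurable.aemeasurable (by fun_prop))

/-- An injective reindexing of an i.i.d. family is i.i.d.; currying then groups it into independent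
sequences, one for each color. -/
lemma map_scaled_rateGaps {I : ℕ → Fin (d + 1)} (hI : ∀ i, {n | I n = i}.Infinite)
    (p : Fin (d + 1) → ℝ) :
    (Measure.infinitePi fun _ : Fin (d + 1) ⊕ ℕ => expMeasure 1).map
      (fun ε i k => √(p i) * rateGaps (fun k => ε (tickIndex I (i, k))) k) =
      Measure.infinitePi fun i => scaledRateLaw (p i) := by
  have hm : ∀ i, Measurable fun (x : ℕ → ℝ) (k : ℕ) => √(p i) * rateGaps x k := fun i => by
    have := measurable_rateGaps
    fun_prop
  have hf : Measurable fun (y : Fin (d + 1) → ℕ → ℝ) i (k : ℕ) => √(p i) * rateGaps (y i) k :=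
    measurable_pi_lambda _ fun i => (hm i).comp (measurable_pi_apply i)
  have h1 := Measure.map_infinitePi_infinitePi_of_inj
    (P := fun _ : Fin (d + 1) ⊕ ℕ => expMeasure 1) (tickIndex_injective hI)
  have h2 := Measure.infinitePi_map_curry (fun (_ : Fin (d + 1)) (_ : ℕ) => expMeasure 1)
  have h3 := Measure.infinitePi_map_pi (fun _ : Fin (d + 1) => expSeq) hm
  have h4 : ∀ i, expSeq.map (fun (x : ℕ → ℝ) (k : ℕ) => √(p i) * rateGaps x k) =
      scaledRateLaw (p i) := fun i => by
    rw [scaledRateLaw, rateLaw, Measure.map_map (by fun_prop) measurable_rateGaps]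
    rfl
  simp_rw [h4] at h3
  rw [← h3]
  unfold expSeq
  rw [← h2, ← h1, Measure.map_map (MeasurableEquiv.measurable _) (by fun_prop),
    Measure.map_map hf ((MeasurableEquiv.measurable _).comp (by fun_prop))]
  rfl

end

section

variable {d : ℕ}

/-! ### Measurability of the additions to each color -/

lemma nth_eq_iff_of_ne_zero {q : ℕ → Prop} [DecidablePred q] {k n : ℕ} (hn : n ≠ 0) :
    Nat.nth q k = n ↔ q n ∧ Nat.count q n = k := by
  constructor
  · rintro rfl
    exact ⟨Nat.nth_mem_of_ne_zero hn, Nat.count_nth (Nat.lt_card_toFinset_of_nth_ne_zero hn)⟩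
  · rintro ⟨h, rfl⟩
    exact Nat.nth_count h

/-- A nonzero value n is attained exactly when q holds at n and k earlier indices satisfy q. The
value 0 may also be the default for too few occurrences, so it is handled as the complement of the
others. -/
lemma measurable_nth {α : Type*} [MeasurableSpace α] {q : ℕ → α → Prop}
    (hq : ∀ n, MeasurableSet {x | q n x}) (k : ℕ) :
    Measurable fun x => Nat.nth (fun n => q n x) k := by
  classical
  have hc : ∀ n, Measurable fun x => Nat.count (fun n => q n x) n := fun n => by
    simp only [Nat.count_eq_card_filter_range, Finset.card_filter]
    exact Finset.measurable_sum _ fun m _ => Measurable.ite (hq m) measurable_const measurable_const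
  have hne : ∀ n, n ≠ 0 → MeasurableSet ((fun x => Nat.nth (fun n => q n x) k) ⁻¹' {n}) := by
    intro n hn
    have : (fun x => Nat.nth (fun n => q n x) k) ⁻¹' {n} =
        {x | q n x} ∩ (fun x => Nat.count (fun n => q n x) n) ⁻¹' {k} := by
      ext x
      exact nth_eq_iff_of_ne_zero hn
    rw [this]
    exact (hq n).inter (hc n (measurableSet_singleton k))
  refine measurable_to_countable' fun n => ?_
  rcases eq_or_ne n 0 with rfl | hn
  · have : (fun x => Nat.nth (fun n => q n x) k) ⁻¹' {0} =
        (⋃ m : ℕ, (fun x => Nat.nth (fun n => q n x) k) ⁻¹' {m + 1})ᶜ := by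
      ext x
      simp only [Set.mem_preimage, Set.mem_singleton_iff, Set.mem_compl_iff, Set.mem_iUnion]
      constructor
      · rintro h ⟨m, hm⟩
        omega
      · intro h
        by_contra h0
        exact h ⟨_, (Nat.succ_pred h0).symm⟩
    rw [this]
    exact (MeasurableSet.iUnion fun m => hne _ m.succ_ne_zero).compl
  · exact hne n hn

lemma measurable_colorAdditions {Ω : Type*} [MeasurableSpace Ω] {L : ℕ → Ω → Fin (d + 1) → ℝ}
    {I : ℕ → Ω → Fin (d + 1)} {A : ℕ → Ω → ℝ} (hL : Measurable (L 0))
    (hI : ∀ n, Measurable (I n)) (hA : ∀ n, Measurable (A n)) (i : Fin (d + 1)) :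
    Measurable (colorAdditions L I A i) := by
  refine measurable_pi_lambda _ fun k => ?_
  cases k with
  | zero => exact (measurable_pi_apply i).comp hL
  | succ k =>
    have h1 : Measurable fun ω => Nat.nth (fun n => I n ω = i) k :=
      measurable_nth (fun n => hI n (measurableSet_singleton i)) k
    have h2 : Measurable fun z : ℕ × Ω => A z.1 z.2 :=
      measurable_from_prod_countable_right fun n => hA n
    exact h2.comp (h1.prodMk measurable_id)

/-! ### Joint laws in the mixture model with given proportions -/

lemma noiseMeasure_mixI (p : Fin (d + 1) → ℝ) (S : Finset ℕ) {B : ℕ → Set (Fin (d + 1))}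
    (hB : ∀ n, MeasurableSet (B n)) :
    noiseMeasure d (⋂ n ∈ S, (fun w => mixI n (p, w)) ⁻¹' B n) =
      ∏ n ∈ S, categorical d p (B n) := by
  have hq : Measurable (quantile d p) := measurable_quantile measurable_const measurable_id
  have e : (⋂ n ∈ S, (fun w : Noise d => mixI n (p, w)) ⁻¹' B n) =
      Prod.fst ⁻¹' ((S : Set ℕ).pi fun n => quantile d p ⁻¹' B n) := by
    ext w
    simp [mixI, Set.mem_pi]
  rw [e, noiseMeasure, ← Measure.map_apply measurable_fst
    (.pi (Finset.countable_toSet _) fun n _ => hq (hB n)), Measure.map_fst_prod, measure_univ,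
    one_smul, Measure.infinitePi_pi _ fun n _ => hq (hB n)]
  refine Finset.prod_congr rfl fun n _ => ?_
  rw [← map_quantile, Measure.map_apply hq (hB n)]

lemma ae_infinite_mixI {p : Fin (d + 1) → ℝ} (hp : ∀ i, 0 < p i) (h1 : ∑ i, p i = 1) :
    ∀ᵐ w ∂(noiseMeasure d), ∀ i, {n | mixI n (p, w) = i}.Infinite := by
  filter_upwards [ae_noise_pos, ae_tendsto_mixClock (fun i => (hp i).le) h1] with w hw h i
  exact infinite_of_tendsto_mixClock (w := (p, w)) (hp i) hw (h i)

/-- Tonelli over the uniform variables: once these are fixed, the choices are deterministic, and the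
resulting product does not depend on them. -/
lemma noiseMeasure_colorAdditions {p : Fin (d + 1) → ℝ} (hp : ∀ i, 0 < p i) (h1 : ∑ i, p i = 1)
    (S : Finset (Fin (d + 1))) {B : Fin (d + 1) → Set (ℕ → ℝ)} (hB : ∀ i, MeasurableSet (B i)) :
    noiseMeasure d (⋂ i ∈ S, (fun w => colorAdditions mixL mixI mixA i (p, w)) ⁻¹' B i) =
      ∏ i ∈ S, scaledRateLaw (p i) (B i) := by
  have hm : ∀ i, Measurable fun w : Noise d => colorAdditions mixL mixI mixA i (p, w) := fun i =>
    (measurable_colorAdditions (measurable_mixL 0) measurable_mixI measurable_mixA i).comp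
      (by fun_prop)
  have hE : MeasurableSet
      (⋂ i ∈ S, (fun w : Noise d => colorAdditions mixL mixI mixA i (p, w)) ⁻¹' B i) :=
    Finset.measurableSet_biInter _ fun i _ => hm i (hB i)
  have hinf := Measure.ae_ae_of_ae_prod (ae_infinite_mixI hp h1)
  rw [noiseMeasure, Measure.prod_apply hE]
  have : ∀ᵐ u ∂(Measure.infinitePi fun _ : ℕ => (volume : Measure unitInterval)),
      (Measure.infinitePi fun _ : Fin (d + 1) ⊕ ℕ => expMeasure 1) (Prod.mk u ⁻¹'
        ⋂ i ∈ S, (fun w : Noise d => colorAdditions mixL mixI mixA i (p, w)) ⁻¹' B i) =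
      ∏ i ∈ S, scaledRateLaw (p i) (B i) := by
    filter_upwards [hinf] with u hu
    -- The choices depend only on u, so a single exponential sample transfers the property to all of
    -- them.
    obtain ⟨ε₀, hε₀⟩ := hu.exists
    have hI : ∀ i, {n | quantile d p (u n) = i}.Infinite := hε₀
    have hmg : Measurable fun (ε : Fin (d + 1) ⊕ ℕ → ℝ) (i : Fin (d + 1)) (k : ℕ) => √(p i) *
        rateGaps (fun k => ε (tickIndex (fun n => quantile d p (u n)) (i, k))) k := by
      have := measurable_rateGaps
      refine measurable_pi_lambda _ fun i => measurable_pi_lambda _ fun k => ?_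
      have h2 : Measurable fun ε : Fin (d + 1) ⊕ ℕ → ℝ =>
        rateGaps fun k => ε (tickIndex (fun n => quantile d p (u n)) (i, k)) :=
        measurable_rateGaps.comp (by fun_prop)
      fun_prop
    have e : (Prod.mk u ⁻¹'
        ⋂ i ∈ S, (fun w : Noise d => colorAdditions mixL mixI mixA i (p, w)) ⁻¹' B i) =
        (fun (ε : Fin (d + 1) ⊕ ℕ → ℝ) (i : Fin (d + 1)) (k : ℕ) => √(p i) *
          rateGaps (fun k => ε (tickIndex (fun n => quantile d p (u n)) (i, k))) k) ⁻¹'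
          (S : Set (Fin (d + 1))).pi B := by
      ext ε
      simp only [Set.mem_preimage, Set.mem_iInter, Set.mem_pi, Finset.mem_coe]
      refine forall₂_congr fun i _ => ?_
      rw [colorAdditions_mix (w := (p, (u, ε))) (fun i => (hp i).le) hI i]
      rfl
    rw [e, ← Measure.map_apply hmg (.pi (Finset.countable_toSet _) fun i _ => hB i),
      map_scaled_rateGaps hI p, Measure.infinitePi_pi _ fun i _ => hB i]
  rw [lintegral_congr_ae this, lintegral_const, measure_univ, mul_one]

/-! ### The limiting proportions -/

/-- The limiting proportions along a path. -/
def limitShare (z : Path d) (i : Fin (d + 1)) : ℝ :=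
  limsup (fun n => proportion Path.L n z i) atTop

lemma Path.measurable_proportion (n : ℕ) : Measurable (proportion (Path.L (d := d)) n) := by
  have := Path.measurable_L (d := d) n
  unfold proportion total
  fun_prop

/-- A limsup is defined and measurable on all paths, whether or not the proportions converge. -/
lemma measurable_limitShare : Measurable (limitShare (d := d)) :=
  measurable_pi_lambda _ fun i => Measurable.limsup fun n =>
    (measurable_pi_apply i).comp (Path.measurable_proportion n)

lemma ae_mix_regular [IsProbabilityMeasure (dirichletMeasure fun _ : Fin (d + 1) => 1 / 2)] :
    ∀ᵐ w ∂(mixMeasure d), (∀ i, 0 < w.1 i) ∧ (∑ i, w.1 i = 1) ∧ (∀ j, 0 < w.2.2 j) ∧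
      ∀ i, Tendsto (fun n : ℕ => mixClock n w i / n) atTop (𝓝 (w.1 i)) := by
  have hd := ae_dirichletMeasure_pos (d := d) fun _ => 1 / 2
  have h1 : ∀ᵐ w ∂(mixMeasure d), (∀ i, 0 < w.1 i) ∧ ∑ i, w.1 i = 1 :=
    Measure.quasiMeasurePreserving_fst.ae hd
  have h2 : ∀ᵐ w ∂(mixMeasure d), ∀ j, 0 < w.2.2 j :=
    Measure.quasiMeasurePreserving_snd.ae ae_noise_pos
  have hm : MeasurableSet {w : Sample d | ∀ i,
      Tendsto (fun n : ℕ => mixClock n w i / n) atTop (𝓝 (w.1 i))} := by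
    rw [Set.ofPred_forall]
    exact .iInter fun i => measurableSet_tendsto_fun
      (fun n => (measurable_mixClock n i).div_const _) (by fun_prop)
  have h3 : ∀ᵐ w ∂(mixMeasure d), w ∈ {w : Sample d | ∀ i,
      Tendsto (fun n : ℕ => mixClock n w i / n) atTop (𝓝 (w.1 i))} := by
    rw [mixMeasure, Measure.ae_prod_mem_iff_ae_ae_mem hm]
    filter_upwards [hd] with p hp
    exact ae_tendsto_mixClock (fun i => (hp.1 i).le) hp.2
  filter_upwards [h1, h2, h3] with w h1 h2 h3 using ⟨h1.1, h1.2, h2, h3⟩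

lemma proportion_mixPath (n : ℕ) (w : Sample d) :
    proportion Path.L n (mixPath w) = proportion mixL n w := by
  unfold proportion total
  rw [L_mixPath]

lemma ae_tendsto_mixPath [IsProbabilityMeasure (dirichletMeasure fun _ : Fin (d + 1) => 1 / 2)] :
    ∀ᵐ w ∂(mixMeasure d),
      Tendsto (fun n => proportion Path.L n (mixPath w)) atTop (𝓝 w.1) := by
  filter_upwards [ae_mix_regular] with w hw
  simp_rw [proportion_mixPath]
  exact tendsto_proportion_mixL (fun i => (hw.1 i).le) hw.2.1 hw.2.2.2

lemma ae_limitShare_mixPath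
    [IsProbabilityMeasure (dirichletMeasure fun _ : Fin (d + 1) => 1 / 2)] :
    ∀ᵐ w ∂(mixMeasure d), limitShare (mixPath w) = w.1 := by
  filter_upwards [ae_tendsto_mixPath] with w hw
  ext i
  exact (tendsto_pi_nhds.1 hw i).limsup_eq

lemma colorAdditions_pathOf {Ω : Type*} (L : ℕ → Ω → Fin (d + 1) → ℝ) (I : ℕ → Ω → Fin (d + 1))
    (A : ℕ → Ω → ℝ) (i : Fin (d + 1)) (ω : Ω) :
    colorAdditions Path.L Path.I Path.A i (pathOf L I A ω) = colorAdditions L I A i ω := by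
  ext k
  cases k <;> rfl

lemma colorAdditions_mixPath (i : Fin (d + 1)) (w : Sample d) :
    colorAdditions Path.L Path.I Path.A i (mixPath w) = colorAdditions mixL mixI mixA i w :=
  colorAdditions_pathOf mixL mixI mixA i w

lemma categorical_real_singleton {p : Fin (d + 1) → ℝ} (h0 : ∀ i, 0 ≤ p i) (h1 : ∑ i, p i = 1)
    (i : Fin (d + 1)) : (categorical d p).real {i} = p i := by
  rw [measureReal_def, categorical_apply h0 h1]
  simp [Set.indicator_apply, h0 i]

lemma IsContinuousUrn.measurable_limitShare_pathOf {Ω : Type*} [MeasurableSpace Ω]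
    {μ : Measure Ω} {L : ℕ → Ω → Fin (d + 1) → ℝ} {I : ℕ → Ω → Fin (d + 1)} {A : ℕ → Ω → ℝ}
    (h : IsContinuousUrn L I A μ) :
    Measurable fun ω => limitShare (pathOf L I A ω) :=
  measurable_limitShare.comp h.measurable_pathOf

/-! ### Transfer from the mixture model to the urn -/

section Urn

variable {Ω : Type*} [MeasurableSpace Ω] {μ : Measure Ω} [IsProbabilityMeasure μ]
  {L : ℕ → Ω → Fin (d + 1) → ℝ} {I : ℕ → Ω → Fin (d + 1)} {A : ℕ → Ω → ℝ}

lemma IsContinuousUrn.ae_of_mix (h : IsContinuousUrn L I A μ) {s : Set (Path d)}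
    (hs : MeasurableSet s) (hmix : ∀ᵐ w ∂(mixMeasure d), mixPath w ∈ s) :
    ∀ᵐ ω ∂μ, pathOf L I A ω ∈ s := by
  have h1 := (ae_map_iff (measurable_mixPath (d := d)).aemeasurable hs).2 hmix
  rw [← h.map_pathOf] at h1
  exact (ae_map_iff h.measurable_pathOf.aemeasurable hs).1 h1

lemma IsContinuousUrn.ae_tendsto (h : IsContinuousUrn L I A μ) :
    ∀ᵐ ω ∂μ, Tendsto (fun n => proportion L n ω) atTop (𝓝 (limitShare (pathOf L I A ω))) := by
  have := h.isProbabilityMeasure_dirichlet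
  have hs : MeasurableSet {z : Path d |
      Tendsto (fun n => proportion Path.L n z) atTop (𝓝 (limitShare z))} :=
    measurableSet_tendsto_fun Path.measurable_proportion measurable_limitShare
  have h1 := h.ae_of_mix hs (by
    filter_upwards [ae_tendsto_mixPath, ae_limitShare_mixPath] with w h1 h2
    rw [h2]
    exact h1)
  filter_upwards [h1] with ω hω
  refine Tendsto.congr (fun n => ?_) hω
  unfold proportion total
  rw [Path.L_pathOf h.succ_eq]

lemma IsContinuousUrn.ae_infinite (h : IsContinuousUrn L I A μ) :
    ∀ᵐ ω ∂μ, ∀ i, {n | I n ω = i}.Infinite := by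
  have := h.isProbabilityMeasure_dirichlet
  have hs : MeasurableSet {z : Path d | ∀ i, {n | Path.I n z = i}.Infinite} := by
    have : {z : Path d | ∀ i, {n | Path.I n z = i}.Infinite} =
        ⋂ i, ⋂ N : ℕ, ⋃ n : ℕ, ⋃ (_ : N < n), Path.I n ⁻¹' {i} := by
      ext z
      simp only [Set.mem_ofPred_eq, Set.mem_iInter, Set.mem_iUnion, Set.mem_preimage,
        Set.mem_singleton_iff]
      refine forall_congr' fun i => ⟨fun hz N => ?_, fun hz => ?_⟩
      · obtain ⟨n, hn, hN⟩ := hz.exists_gt N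
        exact ⟨n, hN, hn⟩
      · refine Set.infinite_of_forall_exists_gt fun N => ?_
        obtain ⟨n, hN, hn⟩ := hz N
        exact ⟨n, hn, hN⟩
    rw [this]
    exact .iInter fun i => .iInter fun N => .iUnion fun n => .iUnion fun _ =>
      Path.measurable_I n (measurableSet_singleton i)
  exact h.ae_of_mix hs (by
    filter_upwards [ae_mix_regular] with w hw i
    exact infinite_of_tendsto_mixClock (hw.1 i) hw.2.2.1 (hw.2.2.2 i))

/-- Along mixture paths the limiting share is almost surely the p that was drawn, so the joint law
of path and limit disintegrates over the Dirichlet law. -/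
lemma IsContinuousUrn.measure_inter_limitShare (h : IsContinuousUrn L I A μ) {E : Set (Path d)}
    (hE : MeasurableSet E) {S : Set (Fin (d + 1) → ℝ)} (hS : MeasurableSet S) :
    μ (pathOf L I A ⁻¹' E ∩ (fun ω => limitShare (pathOf L I A ω)) ⁻¹' S) =
      ∫⁻ p in S, noiseMeasure d ((fun w => mixPath (p, w)) ⁻¹' E)
        ∂(dirichletMeasure fun _ => 1 / 2) := by
  have := h.isProbabilityMeasure_dirichlet
  have h1 : pathOf L I A ⁻¹' E ∩ (fun ω => limitShare (pathOf L I A ω)) ⁻¹' S =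
      pathOf L I A ⁻¹' (E ∩ limitShare ⁻¹' S) := rfl
  have hm := hE.inter (measurable_limitShare hS)
  have hm2 : MeasurableSet (mixPath ⁻¹' E ∩ Prod.fst ⁻¹' S : Set (Sample d)) :=
    (measurable_mixPath hE).inter (measurable_fst hS)
  have h2 : (mixPath ⁻¹' (E ∩ limitShare ⁻¹' S) : Set (Sample d)) =ᵐ[mixMeasure d]
      (mixPath ⁻¹' E ∩ Prod.fst ⁻¹' S : Set (Sample d)) := by
    filter_upwards [ae_limitShare_mixPath] with w hw
    refine propext ?_
    change mixPath w ∈ E ∧ limitShare (mixPath w) ∈ S ↔ mixPath w ∈ E ∧ w.1 ∈ S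
    rw [hw]
  rw [h1, ← Measure.map_apply h.measurable_pathOf hm, h.map_pathOf,
    Measure.map_apply measurable_mixPath hm, measure_congr h2, mixMeasure,
    Measure.prod_apply hm2, ← lintegral_indicator hS]
  refine lintegral_congr fun p => ?_
  by_cases hp : p ∈ S
  · rw [Set.indicator_of_mem hp]
    congr 1
    ext w
    simp [hp]
  · rw [Set.indicator_of_notMem hp]
    convert measure_empty (μ := noiseMeasure d)
    ext w
    simp [hp]

lemma IsContinuousUrn.hasLaw_limitShare (h : IsContinuousUrn L I A μ) :
    HasLaw (fun ω => limitShare (pathOf L I A ω)) (dirichletMeasure fun _ => 1 / 2) μ := by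
  refine ⟨h.measurable_limitShare_pathOf.aemeasurable, ?_⟩
  ext S hS
  have := h.measure_inter_limitShare MeasurableSet.univ hS
  simp only [Set.preimage_univ, Set.univ_inter, measure_univ, lintegral_one,
    Measure.restrict_apply_univ] at this
  rw [Measure.map_apply h.measurable_limitShare_pathOf hS, this]

lemma IsContinuousUrn.ae_limitShare_pos (h : IsContinuousUrn L I A μ) :
    ∀ᵐ ω ∂μ, (∀ i, 0 < limitShare (pathOf L I A ω) i) ∧
      ∑ i, limitShare (pathOf L I A ω) i = 1 := by
  have h1 := ae_dirichletMeasure_pos (d := d) fun _ => 1 / 2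
  rw [← h.hasLaw_limitShare.map_eq] at h1
  exact ae_of_ae_map h.measurable_limitShare_pathOf.aemeasurable h1

/-- Conditionally on the limiting proportions, the path is that of the mixture model. -/
lemma IsContinuousUrn.condExp_pathOf (h : IsContinuousUrn L I A μ) {E : Set (Path d)}
    (hE : MeasurableSet E) :
    μ⟦pathOf L I A ⁻¹' E | MeasurableSpace.comap (fun ω => limitShare (pathOf L I A ω))
      inferInstance⟧ =ᵐ[μ] fun ω => (noiseMeasure d).real
        ((fun w => mixPath (limitShare (pathOf L I A ω), w)) ⁻¹' E) := by
  have hP := h.measurable_limitShare_pathOf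
  have hg : Measurable fun p : Fin (d + 1) → ℝ =>
      noiseMeasure d ((fun w => mixPath (p, w)) ⁻¹' E) :=
    measurable_measure_prodMk_left (measurable_mixPath hE)
  refine condExp_eq_of_measure_inter hP (h.measurable_pathOf hE)
    (g := fun p => (noiseMeasure d).real ((fun w => mixPath (p, w)) ⁻¹' E)) hg.ennreal_toReal
    (fun p => measureReal_nonneg) (fun p => measureReal_le_one) fun S hS => ?_
  simp_rw [ofReal_measureReal (measure_ne_top _ _)]
  rw [h.measure_inter_limitShare hE hS, ← h.hasLaw_limitShare.map_eq, setLIntegral_map hS hg hP]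

/-- A family of functionals of the path which is independent in the mixture model with given
proportions is conditionally independent given the limiting proportions, with the same laws. -/
lemma IsContinuousUrn.condIndepFamily_hasCondLaw (h : IsContinuousUrn L I A μ)
    {ι 𝓨 : Type*} [MeasurableSpace 𝓨] {Z : ι → Path d → 𝓨} (hZ : ∀ i, Measurable (Z i))
    {κ : ι → (Fin (d + 1) → ℝ) → Measure 𝓨}
    (hκ : ∀ p : Fin (d + 1) → ℝ, (∀ i, 0 < p i) → ∑ i, p i = 1 → ∀ (S : Finset ι)
      (B : ι → Set 𝓨), (∀ i, MeasurableSet (B i)) →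
        noiseMeasure d (⋂ i ∈ S, (fun w => Z i (mixPath (p, w))) ⁻¹' B i) =
          ∏ i ∈ S, κ i p (B i)) :
    CondIndepFamily (fun i ω => Z i (pathOf L I A ω)) (fun ω => limitShare (pathOf L I A ω)) μ ∧
      ∀ i, HasCondLaw (fun ω => Z i (pathOf L I A ω)) (fun ω => limitShare (pathOf L I A ω))
        (fun ω => κ i (limitShare (pathOf L I A ω))) μ := by
  have hlaw : ∀ i, HasCondLaw (fun ω => Z i (pathOf L I A ω))
      (fun ω => limitShare (pathOf L I A ω))
      (fun ω => κ i (limitShare (pathOf L I A ω))) μ := fun i B hB => by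
    refine (h.condExp_pathOf (hZ i hB)).trans ?_
    filter_upwards [h.ae_limitShare_pos] with ω hω
    -- The product formula for a single index gives the marginal law.
    have := hκ _ hω.1 hω.2 {i} (fun _ => B) fun _ => hB
    simp only [Finset.mem_singleton, Set.iInter_iInter_eq_left, Finset.prod_singleton] at this
    rw [measureReal_def, measureReal_def, ← this]
    rfl
  refine ⟨fun S B hB => ?_, hlaw⟩
  have hE : MeasurableSet (⋂ i ∈ S, Z i ⁻¹' B i) :=
    Finset.measurableSet_biInter _ fun i _ => hZ i (hB i)
  have e : (⋂ i ∈ S, (fun ω => Z i (pathOf L I A ω)) ⁻¹' B i) =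
      pathOf L I A ⁻¹' ⋂ i ∈ S, Z i ⁻¹' B i := by
    simp only [Set.preimage_iInter]; rfl
  have hall : ∀ᵐ ω ∂μ, ∀ i ∈ S, (μ⟦(fun ω => Z i (pathOf L I A ω)) ⁻¹' B i |
      MeasurableSpace.comap (fun ω => limitShare (pathOf L I A ω)) inferInstance⟧) ω =
        (κ i (limitShare (pathOf L I A ω))).real (B i) := by
    rw [eventually_all_finset]
    exact fun i _ => hlaw i (B i) (hB i)
  rw [e]
  refine (h.condExp_pathOf hE).trans ?_
  filter_upwards [h.ae_limitShare_pos, hall] with ω hω hω2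
  rw [Finset.prod_congr rfl hω2, measureReal_def]
  have := hκ _ hω.1 hω.2 S B hB
  simp only [measureReal_def]
  rw [← ENNReal.toReal_prod, ← this]
  simp only [Set.preimage_iInter]
  rfl

end Urn

end

end ContinuousUrn

end

/-! ### The theorem on the continuous urn -/

theorem mainTheorem5 {Ω : Type*} [MeasurableSpace Ω] (μ : Measure Ω) [IsProbabilityMeasure μ]
    (d : ℕ) (L : ℕ → Ω → Fin (d + 1) → ℝ) (I : ℕ → Ω → Fin (d + 1)) (A : ℕ → Ω → ℝ)
    (hurn : ContinuousUrn.IsContinuousUrn L I A μ) :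
    ∃ P : Ω → Fin (d + 1) → ℝ, Measurable P ∧
      -- the proportions converge almost surely to a Dirichlet(1/2, …, 1/2) vector
      (∀ᵐ ω ∂μ, Tendsto (fun n => ContinuousUrn.proportion L n ω) atTop (𝓝 (P ω))) ∧
      HasLaw P (ContinuousUrn.dirichletMeasure fun _ => 1 / 2) μ ∧
      -- given the limit, the chosen colors are i.i.d. with law given by the limit
      ContinuousUrn.CondIndepFamily I P μ ∧
      (∀ n i, μ⟦I n ⁻¹' {i} | MeasurableSpace.comap P inferInstance⟧ =ᵐ[μ] fun ω => P ω i) ∧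
      -- every color is added to infinitely often, and given the limit the sequences of additions
      -- are independent rescaled sequences of inter-jump times
      (∀ᵐ ω ∂μ, ∀ i, {n | I n ω = i}.Infinite) ∧
      ContinuousUrn.CondIndepFamily (ContinuousUrn.colorAdditions L I A) P μ ∧
      ∃ ν : Measure (ℕ → ℝ), ContinuousUrn.IsPoissonInterJumpLaw (fun t => t) ν ∧
        ∀ i, ContinuousUrn.HasCondLaw (ContinuousUrn.colorAdditions L I A i) P
          (fun ω => ν.map fun x k => √(P ω i) * x k) μ := by
  -- Additions and choices are functionals of the path, so their conditional laws are read off from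
  -- the mixture with p fixed.
  have hcolor := hurn.condIndepFamily_hasCondLaw
    (Z := ContinuousUrn.colorAdditions ContinuousUrn.Path.L ContinuousUrn.Path.I
      ContinuousUrn.Path.A)
    (ContinuousUrn.measurable_colorAdditions (ContinuousUrn.Path.measurable_L 0)
      ContinuousUrn.Path.measurable_I ContinuousUrn.Path.measurable_A)
    (κ := fun i p => ContinuousUrn.scaledRateLaw (p i))
    (fun p hp h1 S B hB => by
      rw [← ContinuousUrn.noiseMeasure_colorAdditions hp h1 S hB]
      simp_rw [ContinuousUrn.colorAdditions_mixPath])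
  simp_rw [ContinuousUrn.colorAdditions_pathOf] at hcolor
  have hindex := hurn.condIndepFamily_hasCondLaw (Z := ContinuousUrn.Path.I)
    ContinuousUrn.Path.measurable_I (κ := fun _ p => ContinuousUrn.categorical d p)
    (fun p _ _ S B hB => ContinuousUrn.noiseMeasure_mixI p S hB)
  refine ⟨fun ω => ContinuousUrn.limitShare (ContinuousUrn.pathOf L I A ω),
    hurn.measurable_limitShare_pathOf, hurn.ae_tendsto, hurn.hasLaw_limitShare, hindex.1,
    fun n i => ?_, hurn.ae_infinite, hcolor.1, ContinuousUrn.rateLaw,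
    ContinuousUrn.isPoissonInterJumpLaw_rateLaw, hcolor.2⟩
  refine (hindex.2 n {i} (measurableSet_singleton i)).trans ?_
  filter_upwards [hurn.ae_limitShare_pos] with ω hω
  exact ContinuousUrn.categorical_real_singleton (fun i => (hω.1 i).le) hω.2 i
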